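/- **Setting.** Let $(X_{t,T})_{t\in\mathbb Z,\,T\in\mathbb N^*}$ be an array of real random variables on a probability space, with $\mathbb E X_{t,T}=0$ and finite variances $\sigma_{t,T}^2$. Let $f:\mathbb R^2\to[0,\infty)$ be $2\pi$-periodic and locally integrable in its second variable, let $\gamma_k(u):=\int_{-\pi}^{\pi}e^{ik\lambda}f(u,\lambda)\,d\lambda$, and let $m\in\mathbb N^*$. Assume: 1. (local stationarity) $|\mathrm{Cov}(X_{t,T},X_{t-k,T})-\gamma_k(t/T)|\le C/T$ for all $t,k\in\mathbb Z$, $T\ge1$, with $C\ge0$; 2. (mixing) there are $K>0$, $r>1$ with $\alpha(n)\le K r^{-n}$ for all $n\ge1$, where $\alpha(n)$ is the supremum of $|\mathbb P(A\cap B)-\mathbb P(A)\mathbb P(B)|$ over $T\ge1$, $t\in\mathbb Z$, $A\in\sigma(X_{s,T}:s\le t)$, $B\in\sigma(X_{s,T}:s\ge t+n)$; 3. $0<m_f\le |f(u,\lambda)|\le M_f$ for all $u,\lambda$; 4. $f$ is continuously differentiable in $u$ with $|\partial_u f(u,\lambda)|\le M_f'$, where $M'_f\ge0$; 5. (Bernstein-type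 condition) there are $c>0$, $d\ge1/2$ with $\mathbb E|X_{t,T}|^k\le c^{k-2}(k!)^d\sigma_{t,T}^2$ for all $T\ge1$, $t=1,\dots,T+m$, $k=2,3,\dots$ **Procedure.** Fix $T$ and a nonempty set $\mathcal N\subset\{2,\dots,T-m-1\}$. Put $M_1=\{T-2m+1,\dots,T-m\}$ (final part of the training set), $M_2=\{T-m+1,\dots,T\}$ (validation set) and $M_3=\{T+1,\dots,T+m\}$ (test set). For $k=0,1$ let $$\hat\gamma_{k;N,T}(t)=\frac1{N-k}\sum_{\ell=t-N+k+1}^{t}X_{\ell-k,T}X_{\ell,T},\qquad \hat a_{N,T}(t)=\hat\gamma_{1;N,T}(t)/\hat\gamma_{0;N,T}(t).$$ The locally stationary and the stationary forecasts of $X_{t+1,T}$ are $f^{\rm ls}_{t;N}=\hat a_{N,T}(t)X_{t,T}$, $N\in\mathcal N$, and $f^{\rm s}_t=\hat a_{t,T}(t)X_{t,T}$. Let $\hat N$ be an $\mathcal N$-valued random variable that minimises $\sum_{t+1\in M_1}(X_{t+1,T}-f^{\rm ls}_{t;N})^2$ over $N\in\mathcal N$, and for $j=2,3$ let $$\tilde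 R_j=\frac{\frac1m\sum_{t+1\in M_j}(X_{t+1,T}-f^{\rm s}_t)^2}{\frac1m\sum_{t+1\in M_j}(X_{t+1,T}-f^{\rm ls}_{t;\hat N})^2}$$ (here and in $\hat a_{N,T}$, a quotient with denominator $0$ is read as $0$). **Constants.** With suprema over $\frac{T-m}T\le u\le1$ let $$\rho=\sup_u\Big|\frac{\gamma_1(u)}{\gamma_0(u)}\Big|,\qquad D_{\sup}=\sup_u\left|\frac{\int_0^1\gamma_1\big(u+\frac{T-m}T(x-1)\big)dx}{\int_0^1\gamma_0\big(u+\frac{T-m}T(x-1)\big)dx}-\frac{\gamma_1(u)}{\gamma_0(u)}\right|.$$ Let $C_0=(2\pi)^{1/2}M_f/m_f$, $C_1=(2\pi M_f'+C)/m_f$ and, for $a=1,2$, $$\bar C_{1,a}=12\cdot2^{8ad+9}(a!)^{4d}\max\{1,c^2,3\pi M_f\}^{2a}\,e\,\big(1+\tfrac1{\log r}\big)(1+K^{1/2}),$$ $$\bar C_{2,a}=12\cdot2^{3(ad+1)}(a!)^{2d}\max\{1,c^2,3\pi M_f\}^{a}\,e\,\big(1+\tfrac1{\log r}\big).$$ For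 integers $N\ge 2$ and real $\varepsilon\ge0$ let $$\bar\varepsilon=\frac{\varepsilon/4}{2\big((6\pi M_fc^2 24^d)^2+\varepsilon^2/16\big)^{1/4}},\quad \mu=\frac{\bar\varepsilon}{2\big((2C_0+1)^2+\bar\varepsilon\big)^{1/2}},\quad \eta=\frac{m_f}{4}\min\Big\{1,\frac{1}{8C_0}\,\frac{\mu}{\mu+1}\Big\},$$ and $$P^{(1,1)}_{m,N}(\varepsilon)=7\exp\left(-\frac{\varepsilon^2/16}{8\Big((2C_0+1)^4\frac{\bar C_{1,2}}m+\big(\frac\varepsilon8\big)^{\frac{3+8d}{2+4d}}\big((2C_0+1)^2\frac{\bar C_{2,2}}m\big)^{\frac1{2+4d}}\Big)}\right)$$ $$\qquad\qquad+\,12m\exp\left(-\frac{\eta^2}{2\Big(\frac{\bar C_{1,1}}{N-1}+\eta^{\frac{3+4d}{2+2d}}\big(\frac{\bar C_{2,1}}{N-1}\big)^{\frac1{2+2d}}\Big)}\right).$$ **Claim.** Suppose that $\rho<1$ and $\delta\ge 2D_{\sup}^2/(1-\rho^2)$, let $F:=\delta\pi m_f(1-\rho^2)$, and suppose that $T$ is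 large enough in the sense that $$T\ge\max\Big\{6C_1,\ 60F^{-1}(1+\delta)\,2^5C_0^3(2\pi M_f'+C),\ 120F^{-1}(1+\delta)\,m\,C_0^3M_f'\Big\}$$ (if $\delta=0$, then $F=0$ and $F^{-1}$ is read as $0$; the claim is trivial in this case, as the bound below is negative). Then $$\mathbb P\Big((\tilde R_2\ge1+\delta\text{ and }\tilde R_3\ge1+\delta)\text{ or }(\tilde R_2<1+\delta\text{ and }\tilde R_3<1+\delta)\Big)\ \ge\ 1-6\,|\mathcal N|\,P^{(1,1)}_{m,\min\mathcal N}\Big(\frac{\delta}{1+\delta}\,\frac{\pi m_f}{20}(1-\rho^2)\Big).$$ -/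

import Mathlib

open MeasureTheory ProbabilityTheory

noncomputable section

namespace LocStat

/-! ### Local spectral densities and the assumptions on the array -/

/-- A local spectral density: a nonnegative function of local time `u` and frequency, which is
`2π`-periodic and locally integrable in the frequency. -/
structure IsLocalSpectralDensity (f : ℝ → ℝ → ℝ) : Prop where
  nonneg : ∀ u l, 0 ≤ f u l
  periodic : ∀ u, Function.Periodic (f u) (2 * Real.pi)
  locallyIntegrable : ∀ u, LocallyIntegrable (f u) volume

/-- The local covariance function `∫_{-π}^{π} exp(i k l) f(u, l) dl`, as a complex number. -/
def localCovC (f : ℝ → ℝ → ℝ) (k : ℤ) (u : ℝ) : ℂ :=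
  ∫ l in (-Real.pi)..Real.pi, Complex.exp (Complex.I * (k : ℂ) * (l : ℂ)) * ((f u l : ℝ) : ℂ)

/-- The local covariance function as a real number. (For a locally stationary array with `f`
continuous in `u`, the complex number `localCovC f k u` is real.) -/
def localCov (f : ℝ → ℝ → ℝ) (k : ℤ) (u : ℝ) : ℝ := (localCovC f k u).re

/-- The array `X T t` (`T ≥ 1`, `t ∈ ℤ`) of random variables with finite variances is locally
stationary with local spectral density `f` and constant `C`. -/
structure IsLocallyStationary {Ω : Type*} [MeasurableSpace Ω] (μ : Measure Ω)
    (X : ℕ → ℤ → Ω → ℝ) (f : ℝ → ℝ → ℝ) (C : ℝ) : Prop where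
  measurable : ∀ T : ℕ, 1 ≤ T → ∀ t : ℤ, Measurable (X T t)
  memLp_two : ∀ T : ℕ, 1 ≤ T → ∀ t : ℤ, MemLp (X T t) 2 μ
  spectralDensity : IsLocalSpectralDensity f
  const_nonneg : 0 ≤ C
  cov_close : ∀ T : ℕ, 1 ≤ T → ∀ t k : ℤ,
    ‖((covariance (X T t) (X T (t - k)) μ : ℝ) : ℂ) - localCovC f k ((t : ℝ) / (T : ℝ))‖
      ≤ C / (T : ℝ)

/-- The `σ`-algebra generated by the variables `X T s`, `s ∈ S`. -/
@[reducible] def sigmaOf {Ω : Type*} (X : ℕ → ℤ → Ω → ℝ) (T : ℕ) (S : Set ℤ) : MeasurableSpace Ω :=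
  ⨆ s ∈ S, MeasurableSpace.comap (X T s) inferInstance

/-- The strong mixing coefficient `α(k)` of the array: the supremum of `|P(A ∩ B) - P(A) P(B)|`
over all `T ≥ 1`, all `t ∈ ℤ`, all `A ∈ σ(X T s : s ≤ t)` and all `B ∈ σ(X T s : s ≥ t + k)`. -/
def alphaMixing {Ω : Type*} [MeasurableSpace Ω] (μ : Measure Ω) (X : ℕ → ℤ → Ω → ℝ)
    (k : ℕ) : ℝ :=
  sSup {x : ℝ | ∃ (T : ℕ) (t : ℤ) (A B : Set Ω), 1 ≤ T ∧
    MeasurableSet[sigmaOf X T (Set.Iic t)] A ∧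
    MeasurableSet[sigmaOf X T (Set.Ici (t + (k : ℤ)))] B ∧
    x = |μ.real (A ∩ B) - μ.real A * μ.real B|}

/-- Geometric strong mixing with constants `K > 0` and `r > 1`. -/
def IsGeometricallyMixing {Ω : Type*} [MeasurableSpace Ω] (μ : Measure Ω)
    (X : ℕ → ℤ → Ω → ℝ) (K r : ℝ) : Prop :=
  0 < K ∧ 1 < r ∧ ∀ n : ℕ, 1 ≤ n → alphaMixing μ X n ≤ K * (r ^ n)⁻¹

/-- The local spectral density lies between `mf > 0` and `Mf`. -/
def SpectralBounds (f : ℝ → ℝ → ℝ) (mf Mf : ℝ) : Prop :=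
  0 < mf ∧ ∀ u l, mf ≤ |f u l| ∧ |f u l| ≤ Mf

/-- The local spectral density is continuously differentiable in local time, and the partial
derivative is bounded by `Mf'`. -/
def SpectralDerivBound (f : ℝ → ℝ → ℝ) (Mf' : ℝ) : Prop :=
  0 ≤ Mf' ∧ ∀ l, ContDiff ℝ 1 (fun u => f u l) ∧ ∀ u, |deriv (fun v => f v l) u| ≤ Mf'

/-- Bernstein-type moment condition with constants `c > 0`, `d ≥ 1/2`, for the variables that are
observed or are in the test set, that is for `X T t` with `1 ≤ t ≤ T + m`. -/
def BernsteinCondition {Ω : Type*} [MeasurableSpace Ω] (μ : Measure Ω)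
    (X : ℕ → ℤ → Ω → ℝ) (m : ℕ) (c d : ℝ) : Prop :=
  0 < c ∧ 1 / 2 ≤ d ∧ ∀ T : ℕ, 1 ≤ T → ∀ t : ℤ, 1 ≤ t → t ≤ (T : ℤ) + (m : ℤ) →
    ∀ k : ℕ, 2 ≤ k → Integrable (fun ω => |X T t ω| ^ k) μ ∧
      ∫ ω, |X T t ω| ^ k ∂μ ≤ c ^ (k - 2) * ((k.factorial : ℝ) ^ d) * variance (X T t) μ

/-! ### The forecasting procedure -/

/-- The localised empirical autocovariance at lag `k`, computed from the `N` values
`x (t - N + 1), …, x t`. -/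
def acvHat (x : ℤ → ℝ) (k N t : ℤ) : ℝ :=
  (1 / ((N : ℝ) - ((|k| : ℤ) : ℝ))) *
    ∑ l ∈ Finset.Icc (t - N + |k| + 1) t, x (l - |k|) * x l

/-- The localised Yule-Walker estimator of order `p`: the solution `Γ⁻¹ γ` of the empirical
Yule-Walker equations. Entry `i : Fin p` is the coefficient with index `i + 1`. -/
def ywHat (p : ℕ) (x : ℤ → ℝ) (N t : ℤ) : Fin p → ℝ :=
  Matrix.mulVec
    (Matrix.of fun i j : Fin p => acvHat x ((i : ℤ) - (j : ℤ)) N t)⁻¹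
    (fun i : Fin p => acvHat x ((i : ℤ) + 1) N t)

/-- The `1`-step ahead forecast of `x (t + 1)` of order `p` whose coefficients are estimated from
the last `N` values up to time `t`. -/
def forecast (p : ℕ) (x : ℤ → ℝ) (N t : ℤ) : ℝ :=
  ∑ i : Fin p, ywHat p x N t i * x (t - (i : ℤ))

/-- The `1`-step forecast of order `1` for the locally stationary approach, with segment length
`N`. -/
def forecastLS (x : ℤ → ℝ) (N : ℕ) (t : ℤ) : ℝ := forecast 1 x (N : ℤ) t

/-- The `1`-step forecast of order `1` for the stationary approach: all of `x 1, …, x t` are used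
in the estimation. -/
def forecastS (x : ℤ → ℝ) (t : ℤ) : ℝ := forecast 1 x t t

/-- The blocks of length `m`: `block T m 1 = {T-2m+1, …, T-m}` (final part of the training set),
`block T m 2 = {T-m+1, …, T}` (validation set), `block T m 3 = {T+1, …, T+m}` (test set). -/
def block (T m : ℕ) (j : ℤ) : Finset ℤ :=
  Finset.Ioc ((T : ℤ) + (j - 3) * (m : ℤ)) ((T : ℤ) + (j - 2) * (m : ℤ))

/-- Empirical mean squared error, on the block `j`, of the forecasts `g t` of `x (t + 1)`. -/
def empMSPE (x : ℤ → ℝ) (g : ℤ → ℝ) (T m : ℕ) (j : ℤ) : ℝ :=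
  (1 / (m : ℝ)) * ∑ s ∈ block T m j, (x s - g (s - 1)) ^ 2

/-- `N` is a segment length in `𝒩` which minimises, over `𝒩`, the sum of squared forecast errors
on the final part of the training set. -/
def IsSelected (x : ℤ → ℝ) (T m : ℕ) (𝒩 : Finset ℕ) (N : ℕ) : Prop :=
  N ∈ 𝒩 ∧ ∀ N' ∈ 𝒩,
    ∑ s ∈ block T m 1, (x s - forecastLS x N (s - 1)) ^ 2
      ≤ ∑ s ∈ block T m 1, (x s - forecastLS x N' (s - 1)) ^ 2

/-- The ratio of the empirical mean squared prediction errors, on the block `j`, of the stationary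
forecasts and of the locally stationary forecasts with segment length `N`. -/
def ratioMSPE (x : ℤ → ℝ) (T m : ℕ) (N : ℕ) (j : ℤ) : ℝ :=
  empMSPE x (forecastS x) T m j / empMSPE x (forecastLS x N) T m j

/-! ### The quantities in the bound -/

/-- The local times `(T - m) / T ≤ u ≤ 1`. -/
def validationTimes (T m : ℕ) : Set ℝ := Set.Icc (((T : ℝ) - (m : ℝ)) / (T : ℝ)) 1

/-- The supremum of the absolute local autocorrelations of order one, over the validation set. -/
def rhoSup (f : ℝ → ℝ → ℝ) (T m : ℕ) : ℝ :=
  ⨆ u : validationTimes T m, |localCov f 1 u / localCov f 0 u|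

/-- The average of the local autocovariance `γ_k` over the interval `[u - D, u]`. -/
def avgCov (f : ℝ → ℝ → ℝ) (k : ℤ) (D u : ℝ) : ℝ :=
  ∫ x in (0 : ℝ)..1, localCov f k (u + D * (x - 1))

/-- The maximal distance, over the validation set, of the ratio of the averaged autocovariances and
the ratio of the local autocovariances. -/
def DSup (f : ℝ → ℝ → ℝ) (T m : ℕ) : ℝ :=
  ⨆ u : validationTimes T m,
    |avgCov f 1 (((T : ℝ) - (m : ℝ)) / (T : ℝ)) u / avgCov f 0 (((T : ℝ) - (m : ℝ)) / (T : ℝ)) u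
      - localCov f 1 u / localCov f 0 u|

/-- `C₀ = (2π)^{1/2} Mf / mf`. -/
def C0 (mf Mf : ℝ) : ℝ := Real.sqrt (2 * Real.pi) * Mf / mf

/-- `C₁ = (2π Mf' + C) / mf`. -/
def C1 (mf Mf' C : ℝ) : ℝ := (2 * Real.pi * Mf' + C) / mf

/-- The lower bound required of `T`, for model order `p`, forecast horizon `h` and the value `F` of
the gap. -/
def TLargeEnough (T m p h : ℕ) (δ F C mf Mf Mf' : ℝ) : Prop :=
  3 * (h : ℝ) * 2 ^ h * C1 mf Mf' C * (p : ℝ) ^ 2 ≤ (T : ℝ) ∧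
  60 * F⁻¹ * (1 + δ) * (h : ℝ) * 2 ^ (h + 4) * C0 mf Mf ^ (2 * h + 1) * (p : ℝ) ^ 2
      * (2 * Real.pi * Mf' + C) ≤ (T : ℝ) ∧
  40 * F⁻¹ * (1 + δ) * (m : ℝ) * (2 * (h : ℝ) + 1) * C0 mf Mf ^ (2 * h + 1) * Mf' ≤ (T : ℝ)

/-- The constants `12 · 2^{8ad+9} (a!)^{4d} max{1, c², 3π Mf}^{2a} e (1 + 1/log r) (1 + K^{1/2})`. -/
def Cbar1 (Mf c d K r : ℝ) (a : ℕ) : ℝ :=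
  12 * (2 : ℝ) ^ (8 * (a : ℝ) * d + 9) * (a.factorial : ℝ) ^ (4 * d)
    * (max 1 (max (c ^ 2) (3 * Real.pi * Mf))) ^ (2 * a)
    * Real.exp 1 * (1 + 1 / Real.log r) * (1 + Real.sqrt K)

/-- The constants `12 · 2^{3(ad+1)} (a!)^{2d} max{1, c², 3π Mf}^{a} e (1 + 1/log r)`. -/
def Cbar2 (Mf c d r : ℝ) (a : ℕ) : ℝ :=
  12 * (2 : ℝ) ^ (3 * ((a : ℝ) * d + 1)) * (a.factorial : ℝ) ^ (2 * d)
    * (max 1 (max (c ^ 2) (3 * Real.pi * Mf))) ^ a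
    * Real.exp 1 * (1 + 1 / Real.log r)

/-- The auxiliary quantity `ε̄`. -/
def epsBar (p : ℕ) (Mf c d ε : ℝ) : ℝ :=
  (ε / ((p : ℝ) + 1) ^ 2) /
    (2 * ((6 * Real.pi * Mf * c ^ 2 * (24 : ℝ) ^ d) ^ 2 + ε ^ 2 / ((p : ℝ) + 1) ^ 4)
      ^ ((1 : ℝ) / 4))

/-- The auxiliary quantity `μ`. -/
def muAux (p h : ℕ) (mf Mf c d ε : ℝ) : ℝ :=
  epsBar p Mf c d ε / (2 * Real.sqrt ((2 * C0 mf Mf + 1) ^ (2 * h) + epsBar p Mf c d ε))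

/-- The auxiliary quantity `μ̄`. -/
def muBar (p h : ℕ) (mf Mf c d ε : ℝ) : ℝ :=
  (2 : ℝ) ^ (1 - (h : ℤ)) *
    (muAux p h mf Mf c d ε / (muAux p h mf Mf c d ε + (h : ℝ) * (2 * C0 mf Mf) ^ (h - 1)))

/-- The auxiliary quantity `η`. -/
def etaAux (p h : ℕ) (mf Mf c d ε : ℝ) : ℝ :=
  mf / (4 * (p : ℝ)) * min 1 (muBar p h mf Mf c d ε / (8 * C0 mf Mf))

/-- The bound `P^{(p,h)}_{m,N}(ε)`. -/
def PBound (p h m N : ℕ) (mf Mf c d K r ε : ℝ) : ℝ :=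
  (1 + 4 * (p : ℝ) + 2 * (p : ℝ) ^ 2) *
    Real.exp (-((ε ^ 2 / ((p : ℝ) + 1) ^ 4) /
      (8 * ((2 * C0 mf Mf + 1) ^ (4 * h) * (Cbar1 Mf c d K r 2 * ((h : ℝ) + (p : ℝ) - 1) / (m : ℝ))
        + (ε / (2 * ((p : ℝ) + 1) ^ 2)) ^ ((3 + 8 * d) / (2 + 4 * d))
          * ((2 * C0 mf Mf + 1) ^ (2 * h)
              * (Cbar2 Mf c d r 2 * ((h : ℝ) + (p : ℝ) - 1) / (m : ℝ)))
            ^ (1 / (2 + 4 * d))))))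
  + 6 * (m : ℝ) * (p : ℝ) ^ 2 * ((p : ℝ) + 1) *
    Real.exp (-(etaAux p h mf Mf c d ε ^ 2 /
      (2 * (Cbar1 Mf c d K r 1 * ((p : ℝ) / ((N : ℝ) - (p : ℝ)))
        + etaAux p h mf Mf c d ε ^ ((3 + 4 * d) / (2 + 2 * d))
          * (Cbar2 Mf c d r 1 * ((p : ℝ) / ((N : ℝ) - (p : ℝ)))) ^ (1 / (2 + 2 * d))))))

end LocStat

end

open LocStat

open LocStat

/-! The assumption on δ is so strong that only the second alternative matters: with high probability
both ratios lie below 1 + δ, simultaneously for all N in 𝒩. Hence the minimising property of N̂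
plays no role, only N̂ ∈ 𝒩, and a union bound over 𝒩 and over the two blocks finishes the proof.

Fix N and a block. Write g = γ₀ and a = γ₁/γ₀ at the local time of t. The mean squared error of the
forecast b X_t is approximately g (1 - a² + (b - a)²), an innovation variance plus a penalty
(`abs_quadratic_sub_le`). For the locally stationary forecast the penalty is dropped, being
nonnegative. For the stationary forecast, b is close to the ratio of the averaged covariances
(`abs_arRatio_sub_avgCov_le`), so the penalty is about g D_sup² at most. As 2 D_sup² ≤ δ (1 - ρ²)
and g ≥ 2π m_f, the quantity (1 + δ)·(local error) - (stationary error) is at least F = δ π m_f (1 -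
ρ²) per time point, up to approximation errors (`sum_lt_of_gap`). It remains to keep these errors
below F.

The errors of approximation by local covariances are of order 1/T and are controlled by the size of
T. For the random errors, each estimated coefficient is first compared with the same ratio formed
from expectations; then only centred sums of products X_t X_{t+k}, k = 0, 1, with deterministic
weights remain (`abs_arRatio_sub_le`, `abs_sum_sq_sub_le`).

Such sums are handled by a Bernstein inequality under geometric mixing
(`IsMixingFlow.measureReal_sum_ge_le_exp`). The variables are truncated. The truncated sum is cut
into blocks, those of equal parity being nearly independent, and its exponential moment is
propagated from block to block after being frozen at the target level
(`measureReal_sum_ge_le_of_mixing`). The remainders have exponentially small variance, so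
Chebyshev's inequality suffices for them.

Finally the exponents A₁, A₂ of the bound are solved for deviation levels (`bounds_of_exponent_eq`,
`exists_deviation_levels`). If 6P ≥ 1 there is nothing to prove; otherwise A₁, A₂ ≥ 10/3, which the
concentration inequality requires. -/

/-! ### Covariances under strong mixing -/

/-- The strong mixing coefficient of the `σ`-algebras `m₁` and `m₂` is at most `α`. -/
def IsMixingPair {Ω : Type*} {m0 : MeasurableSpace Ω} (μ : Measure Ω)
    (m₁ m₂ : MeasurableSpace Ω) (α : ℝ) : Prop :=
  ∀ A B : Set Ω, MeasurableSet[m₁] A → MeasurableSet[m₂] B →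
    |μ.real (A ∩ B) - μ.real A * μ.real B| ≤ α

section Covariance

variable {Ω : Type*} {m0 : MeasurableSpace Ω} {μ : Measure Ω} [IsProbabilityMeasure μ]

theorem integrable_of_measurable_of_abs_le {f : Ω → ℝ} {a : ℝ} (hf : Measurable f)
    (h : ∀ ω, |f ω| ≤ a) : Integrable f μ :=
  Integrable.of_bound hf.aestronglyMeasurable a (Filter.Eventually.of_forall h)

/-- Conditioning on m replaces G by its conditional expectation. Among f with values in [0, a], the
integral is then largest for a times the indicator of the set where that expectation is positive,
and this set belongs to m. -/
theorem integral_mul_le_of_setIntegral_le {m : MeasurableSpace Ω} (hm : m ≤ m0)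
    {f G : Ω → ℝ} {a c : ℝ} (hf : Measurable[m] f) (hfa : ∀ ω, 0 ≤ f ω ∧ f ω ≤ a)
    (ha : 0 ≤ a) (hG : Integrable G μ)
    (h : ∀ A : Set Ω, MeasurableSet[m] A → ∫ ω in A, G ω ∂μ ≤ c) :
    ∫ ω, f ω * G ω ∂μ ≤ a * c := by
  have hfb : ∀ ω, |f ω| ≤ a := fun ω => abs_le.2 ⟨by linarith [(hfa ω).1], (hfa ω).2⟩
  have hfG : Integrable (fun ω => f ω * G ω) μ :=
    hG.bdd_mul (hf.mono hm le_rfl).aestronglyMeasurable (Filter.Eventually.of_forall hfb)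
  have hcond : μ[fun ω => f ω * G ω | m] =ᵐ[μ] fun ω => f ω * (μ[G | m]) ω :=
    condExp_mul_of_stronglyMeasurable_left hf.stronglyMeasurable hfG hG
  set A : Set Ω := {ω | 0 < (μ[G | m]) ω} with hA
  have hAm : MeasurableSet[m] A :=
    (stronglyMeasurable_condExp (μ := μ) (m := m) (f := G)).measurable measurableSet_Ioi
  calc ∫ ω, f ω * G ω ∂μ = ∫ ω, (μ[fun ω => f ω * G ω | m]) ω ∂μ := (integral_condExp hm).symm
    _ = ∫ ω, f ω * (μ[G | m]) ω ∂μ := integral_congr_ae hcond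
    _ ≤ ∫ ω, A.indicator (fun ω => a * (μ[G | m]) ω) ω ∂μ := by
        refine integral_mono ?_ ?_ ?_
        · exact integrable_condExp.bdd_mul (hf.mono hm le_rfl).aestronglyMeasurable
            (Filter.Eventually.of_forall hfb)
        · exact (integrable_condExp.const_mul a).indicator (hm _ hAm)
        · intro ω
          by_cases hω : ω ∈ A
          · simp only [Set.indicator_of_mem hω]
            exact mul_le_mul_of_nonneg_right (hfa ω).2 (le_of_lt hω)
          · simp only [Set.indicator_of_notMem hω]
            exact mul_nonpos_of_nonneg_of_nonpos (hfa ω).1 (not_lt.1 hω)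
    _ = a * ∫ ω in A, G ω ∂μ := by
        rw [integral_indicator (hm _ hAm), integral_const_mul, setIntegral_condExp hm hG hAm]
    _ ≤ a * c := mul_le_mul_of_nonneg_left (h A hAm) ha

/-- Two applications of the extremal principle above, first in f and then in g, reduce the claim to
indicators, where it is the definition of the mixing coefficient. -/
theorem IsMixingPair.integral_mul_sub_le {m₁ m₂ : MeasurableSpace Ω} {α : ℝ}
    (h : IsMixingPair μ m₁ m₂ α) (h₁ : m₁ ≤ m0) (h₂ : m₂ ≤ m0) {f g : Ω → ℝ} {a b : ℝ}
    (hf : Measurable[m₁] f) (hg : Measurable[m₂] g) (ha : 0 ≤ a) (hb : 0 ≤ b)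
    (hfa : ∀ ω, 0 ≤ f ω ∧ f ω ≤ a) (hgb : ∀ ω, 0 ≤ g ω ∧ g ω ≤ b) :
    ∫ ω, f ω * g ω ∂μ - (∫ ω, f ω ∂μ) * ∫ ω, g ω ∂μ ≤ α * a * b := by
  have hfi : Integrable f μ := integrable_of_measurable_of_abs_le (hf.mono h₁ le_rfl)
    fun ω => abs_le.2 ⟨by linarith [(hfa ω).1], (hfa ω).2⟩
  have hgi : Integrable g μ := integrable_of_measurable_of_abs_le (hg.mono h₂ le_rfl)
    fun ω => abs_le.2 ⟨by linarith [(hgb ω).1], (hgb ω).2⟩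
  have hfg : Integrable (fun ω => f ω * g ω) μ :=
    hgi.bdd_mul (c := a) (hf.mono h₁ le_rfl).aestronglyMeasurable
      (Filter.Eventually.of_forall fun ω => abs_le.2 ⟨by linarith [(hfa ω).1], (hfa ω).2⟩)
  have key : ∫ ω, f ω * (g ω - ∫ ω, g ω ∂μ) ∂μ ≤ a * (b * α) := by
    refine integral_mul_le_of_setIntegral_le h₁ hf hfa ha (hgi.sub (integrable_const _)) ?_
    intro A hA
    have hA0 := h₁ _ hA
    have hAi : Integrable (A.indicator fun _ => (1 : ℝ)) μ := (integrable_const _).indicator hA0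
    have e1 : ∫ ω in A, (g ω - ∫ ω, g ω ∂μ) ∂μ
        = ∫ ω, g ω * (A.indicator (fun _ => (1 : ℝ)) ω - μ.real A) ∂μ := by
      rw [integral_sub hgi.integrableOn (integrable_const _), setIntegral_const,
        ← integral_indicator hA0]
      have : ∀ ω, g ω * (A.indicator (fun _ => (1 : ℝ)) ω - μ.real A)
          = A.indicator g ω - μ.real A * g ω := by
        intro ω
        by_cases hω : ω ∈ A <;> simp [hω] <;> ring
      simp_rw [this]
      rw [integral_sub (hgi.indicator hA0) (hgi.const_mul _), integral_const_mul, smul_eq_mul]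
    rw [e1]
    refine integral_mul_le_of_setIntegral_le h₂ hg hgb hb (hAi.sub (integrable_const _)) ?_
    intro B hB
    have hB0 := h₂ _ hB
    rw [integral_sub hAi.integrableOn (integrable_const _), setIntegral_const,
      integral_indicator hA0, setIntegral_const, measureReal_restrict_apply hA0]
    have := (abs_le.1 (h A B hA hB)).2
    simp only [smul_eq_mul, mul_one]
    linarith
  have e2 : ∫ ω, f ω * (g ω - ∫ ω, g ω ∂μ) ∂μ
      = ∫ ω, f ω * g ω ∂μ - (∫ ω, f ω ∂μ) * ∫ ω, g ω ∂μ := by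
    simp_rw [mul_sub]
    rw [integral_sub hfg (hfi.mul_const _), integral_mul_const]
  rw [e2] at key
  linarith

theorem IsMixingPair.abs_integral_mul_sub_le {m₁ m₂ : MeasurableSpace Ω} {α : ℝ}
    (h : IsMixingPair μ m₁ m₂ α) (h₁ : m₁ ≤ m0) (h₂ : m₂ ≤ m0) {f g : Ω → ℝ} {a b : ℝ}
    (hf : Measurable[m₁] f) (hg : Measurable[m₂] g) (ha : 0 ≤ a) (hb : 0 ≤ b)
    (hfa : ∀ ω, 0 ≤ f ω ∧ f ω ≤ a) (hgb : ∀ ω, 0 ≤ g ω ∧ g ω ≤ b) :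
    |∫ ω, f ω * g ω ∂μ - (∫ ω, f ω ∂μ) * ∫ ω, g ω ∂μ| ≤ α * a * b := by
  refine abs_le.2 ⟨?_, h.integral_mul_sub_le h₁ h₂ hf hg ha hb hfa hgb⟩
  have hfi : Integrable f μ := integrable_of_measurable_of_abs_le (hf.mono h₁ le_rfl)
    fun ω => abs_le.2 ⟨by linarith [(hfa ω).1], (hfa ω).2⟩
  have hgi : Integrable g μ := integrable_of_measurable_of_abs_le (hg.mono h₂ le_rfl)
    fun ω => abs_le.2 ⟨by linarith [(hgb ω).1], (hgb ω).2⟩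
  have hfg : Integrable (fun ω => f ω * g ω) μ :=
    hgi.bdd_mul (c := a) (hf.mono h₁ le_rfl).aestronglyMeasurable
      (Filter.Eventually.of_forall fun ω => abs_le.2 ⟨by linarith [(hfa ω).1], (hfa ω).2⟩)
  -- The lower bound for f is the upper bound for a - f.
  have := h.integral_mul_sub_le h₁ h₂ (f := fun ω => a - f ω) (measurable_const.sub hf) hg ha hb
    (fun ω => ⟨by linarith [(hfa ω).2], by linarith [(hfa ω).1]⟩) hgb
  simp_rw [sub_mul] at this
  rw [integral_sub (hgi.const_mul _) hfg, integral_sub (integrable_const _) hfi,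
    integral_const_mul, integral_const] at this
  simp only [probReal_univ, smul_eq_mul, one_mul] at this
  linarith

/-- Truncation of a real number at the levels `-h` and `h`. -/
def clip (h y : ℝ) : ℝ := max (-h) (min h y)

theorem measurable_clip (h : ℝ) : Measurable (clip h) := by
  unfold clip; fun_prop

theorem abs_clip_le {h : ℝ} (hh : 0 ≤ h) (y : ℝ) : |clip h y| ≤ h := by
  unfold clip
  exact abs_le.2 ⟨le_max_left _ _, max_le (by linarith) (min_le_left _ _)⟩

theorem abs_clip_le_abs {h : ℝ} (hh : 0 ≤ h) (y : ℝ) : |clip h y| ≤ |y| := by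
  unfold clip
  rcases abs_cases y with ⟨h1, h2⟩ | ⟨h1, h2⟩ <;> rw [h1] <;> refine abs_le.2 ⟨?_, ?_⟩ <;>
    rcases max_cases (-h) (min h y) with ⟨h3, h4⟩ | ⟨h3, h4⟩ <;>
    rcases min_cases h y with ⟨h5, h6⟩ | ⟨h5, h6⟩ <;> linarith

/-- The part removed by truncation. -/
theorem abs_sub_clip_le {h : ℝ} (hh : 0 < h) (y : ℝ) (k : ℕ) :
    |y - clip h y| ≤ |y| ^ (k + 1) / h ^ k := by
  by_cases hy : |y| ≤ h
  · have : clip h y = y := by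
      unfold clip
      rw [min_eq_right (abs_le.1 hy).2, max_eq_right (abs_le.1 hy).1]
    rw [this, sub_self, abs_zero]
    positivity
  · push Not at hy
    have h1 : |y - clip h y| ≤ |y| := by
      unfold clip
      rcases abs_cases y with ⟨h1, h2⟩ | ⟨h1, h2⟩ <;> rw [h1] <;> refine abs_le.2 ⟨?_, ?_⟩ <;>
        rcases max_cases (-h) (min h y) with ⟨h3, h4⟩ | ⟨h3, h4⟩ <;>
        rcases min_cases h y with ⟨h5, h6⟩ | ⟨h5, h6⟩ <;> linarith
    refine h1.trans ?_
    rw [le_div_iff₀ (by positivity), pow_succ, mul_comm]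
    exact mul_le_mul_of_nonneg_right (pow_le_pow_left₀ hh.le hy.le k) (abs_nonneg y)

theorem memLp_two_of_four {Y : Ω → ℝ} (hY : MemLp Y 4 μ) : MemLp Y 2 μ :=
  hY.mono_exponent (by norm_num)

theorem integrable_pow_four {Y : Ω → ℝ} (hY : MemLp Y 4 μ) : Integrable (fun ω => Y ω ^ 4) μ := by
  have := hY.integrable_norm_pow (by norm_num)
  refine this.congr (Filter.Eventually.of_forall fun ω => ?_)
  exact Even.pow_abs (by decide) _

theorem memLp_four_of_integrable {Y : Ω → ℝ} (hm : AEStronglyMeasurable Y μ)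
    (hY : Integrable (fun ω => Y ω ^ 4) μ) : MemLp Y 4 μ := by
  have := (integrable_norm_rpow_iff (p := 4) hm (by norm_num) (by norm_num)).1
  apply this
  refine hY.congr (Filter.Eventually.of_forall fun ω => ?_)
  simp only [ENNReal.toReal_ofNat, Real.norm_eq_abs]
  have : |Y ω| ^ (4 : ℝ) = |Y ω| ^ 4 := by exact_mod_cast Real.rpow_natCast |Y ω| 4
  rw [this]
  exact (Even.pow_abs (by decide) _).symm

theorem sq_integral_le {Y : Ω → ℝ} (hY : MemLp Y 2 μ) :
    (∫ ω, Y ω ∂μ) ^ 2 ≤ ∫ ω, Y ω ^ 2 ∂μ := by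
  have h1 := variance_nonneg Y μ
  rw [variance_eq_sub hY] at h1
  simpa using h1

theorem memLp_sq {Y : Ω → ℝ} (hY : MemLp Y 4 μ) : MemLp (fun ω => Y ω ^ 2) 2 μ := by
  refine (memLp_two_iff_integrable_sq (hY.1.pow 2)).2 ?_
  refine (integrable_pow_four hY).congr (Filter.Eventually.of_forall fun ω => ?_)
  simp only [Pi.pow_apply]
  ring

theorem integral_pow_four_le {Y : Ω → ℝ} (hY : MemLp Y 4 μ) :
    (∫ ω, Y ω ∂μ) ^ 4 ≤ ∫ ω, Y ω ^ 4 ∂μ := by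
  have h1 := sq_integral_le (memLp_two_of_four hY)
  have h2 := sq_integral_le (memLp_sq hY)
  calc (∫ ω, Y ω ∂μ) ^ 4 = ((∫ ω, Y ω ∂μ) ^ 2) ^ 2 := by ring
    _ ≤ (∫ ω, Y ω ^ 2 ∂μ) ^ 2 := pow_le_pow_left₀ (sq_nonneg _) h1 2
    _ ≤ _ := h2.trans (le_of_eq (by congr 1; ext ω; ring))

theorem integral_sq_le_of_pow_four {Y : Ω → ℝ} {V : ℝ} (hV : 0 ≤ V) (hY : MemLp Y 4 μ)
    (h : ∫ ω, Y ω ^ 4 ∂μ ≤ V ^ 2) : ∫ ω, Y ω ^ 2 ∂μ ≤ V := by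
  have h2 := sq_integral_le (memLp_sq hY)
  refine le_of_sq_le_sq ?_ hV
  refine h2.trans (le_trans (le_of_eq (by congr 1; ext ω; ring)) h)

theorem abs_cube_mul_le (x y : ℝ) : |x| ^ 3 * |y| ≤ (3 * x ^ 4 + y ^ 4) / 4 := by
  have e1 : x ^ 4 = |x| ^ 4 := (Even.pow_abs (by decide) _).symm
  have e2 : y ^ 4 = |y| ^ 4 := (Even.pow_abs (by decide) _).symm
  rw [e1, e2]
  nlinarith [sq_nonneg (|x| ^ 2 - |x| * |y|), sq_nonneg (|x| ^ 2 - |y| ^ 2), sq_nonneg (|x| - |y|),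
    abs_nonneg x, abs_nonneg y]

/-- Young's inequality for |Y|³|W| bounds the expectation of the product. The product of
expectations is the same estimate with W replaced by the constant E W, whose fourth power is at most
E W⁴. -/
theorem abs_covariance_le_of_remainder {R Y W : Ω → ℝ} {V h : ℝ} (hh : 0 < h)
    (hY : MemLp Y 4 μ) (hW : MemLp W 4 μ) (hR : MemLp R 2 μ)
    (hYV : ∫ ω, Y ω ^ 4 ∂μ ≤ V ^ 2) (hWV : ∫ ω, W ω ^ 4 ∂μ ≤ V ^ 2)
    (hRY : ∀ ω, |R ω| ≤ |Y ω| ^ 3 / h ^ 2) :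
    |cov[R, W; μ]| ≤ 2 * V ^ 2 / h ^ 2 := by
  have hW2 := memLp_two_of_four hW
  rw [covariance_eq_sub hR hW2]
  have gen : ∀ U : Ω → ℝ, Integrable (fun ω => R ω * U ω) μ → MemLp U 4 μ →
      ∫ ω, U ω ^ 4 ∂μ ≤ V ^ 2 → |∫ ω, R ω * U ω ∂μ| ≤ V ^ 2 / h ^ 2 := by
    intro U hRU hU hUV
    calc |∫ ω, R ω * U ω ∂μ| ≤ ∫ ω, |R ω * U ω| ∂μ := abs_integral_le_integral_abs
      _ ≤ ∫ ω, (3 * Y ω ^ 4 + U ω ^ 4) / 4 / h ^ 2 ∂μ := by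
          refine integral_mono hRU.abs ?_ ?_
          · exact ((((integrable_pow_four hY).const_mul 3).add (integrable_pow_four hU)).div_const
              4).div_const _
          · intro ω
            simp only [abs_mul]
            calc |R ω| * |U ω| ≤ |Y ω| ^ 3 / h ^ 2 * |U ω| :=
                  mul_le_mul_of_nonneg_right (hRY ω) (abs_nonneg _)
              _ = |Y ω| ^ 3 * |U ω| / h ^ 2 := by ring
              _ ≤ _ := div_le_div_of_nonneg_right (abs_cube_mul_le _ _) (by positivity)
      _ = (3 * ∫ ω, Y ω ^ 4 ∂μ + ∫ ω, U ω ^ 4 ∂μ) / 4 / h ^ 2 := by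
          rw [integral_div, integral_div, integral_add ((integrable_pow_four hY).const_mul 3)
            (integrable_pow_four hU), integral_const_mul]
      _ ≤ V ^ 2 / h ^ 2 := div_le_div_of_nonneg_right (by linarith) (by positivity)
  have g1 := gen W (hR.integrable_mul hW2) hW hWV
  have g2 := gen (fun _ => ∫ ω, W ω ∂μ) ((hR.integrable (by norm_num)).mul_const _)
    (memLp_const _) (by simpa using (integral_pow_four_le hW).trans hWV)
  rw [integral_mul_const] at g2
  have : (∫ ω, (R * W) ω ∂μ) = ∫ ω, R ω * W ω ∂μ := rfl
  rw [this]
  calc |(∫ ω, R ω * W ω ∂μ) - (∫ ω, R ω ∂μ) * ∫ ω, W ω ∂μ| ≤ _ := abs_sub _ _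
    _ ≤ V ^ 2 / h ^ 2 + V ^ 2 / h ^ 2 := add_le_add g1 g2
    _ = _ := by ring

/-- Adding a to both variables leaves the covariance unchanged and puts them into [0, 2a], hence the
factor 4. -/
theorem IsMixingPair.abs_covariance_clip_le {m₁ m₂ : MeasurableSpace Ω} {α : ℝ}
    (h : IsMixingPair μ m₁ m₂ α) (h₁ : m₁ ≤ m0) (h₂ : m₂ ≤ m0) {f g : Ω → ℝ} {a : ℝ}
    (hf : Measurable[m₁] f) (hg : Measurable[m₂] g) (ha : 0 ≤ a)
    (hfa : ∀ ω, |f ω| ≤ a) (hga : ∀ ω, |g ω| ≤ a) :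
    |cov[f, g; μ]| ≤ 4 * α * a ^ 2 := by
  have hf' := hf.mono h₁ le_rfl
  have hg' := hg.mono h₂ le_rfl
  have hfL : MemLp f 2 μ := MemLp.of_bound hf'.aestronglyMeasurable a
    (Filter.Eventually.of_forall hfa)
  have hgL : MemLp g 2 μ := MemLp.of_bound hg'.aestronglyMeasurable a
    (Filter.Eventually.of_forall hga)
  have hfi := hfL.integrable (by norm_num : (1 : ENNReal) ≤ 2)
  have hgi := hgL.integrable (by norm_num : (1 : ENNReal) ≤ 2)
  have e : cov[f, g; μ] = cov[fun ω => f ω + a, fun ω => g ω + a; μ] := by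
    rw [covariance_add_const_left hfi, covariance_add_const_right hgi]
  rw [e, covariance_eq_sub (X := fun ω => f ω + a) (Y := fun ω => g ω + a)
    (hfL.add (memLp_const a)) (hgL.add (memLp_const a))]
  have := h.abs_integral_mul_sub_le h₁ h₂ (f := fun ω => f ω + a) (g := fun ω => g ω + a)
    (a := 2 * a) (b := 2 * a) (hf.add_const a) (hg.add_const a) (by linarith) (by linarith)
    (fun ω => ⟨by linarith [(abs_le.1 (hfa ω)).1], by linarith [(abs_le.1 (hfa ω)).2]⟩)
    (fun ω => ⟨by linarith [(abs_le.1 (hga ω)).1], by linarith [(abs_le.1 (hga ω)).2]⟩)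
  refine le_trans this (le_of_eq (by ring))

theorem memLp_clip {p : ENNReal} {Y : Ω → ℝ} {h : ℝ} (hh : 0 ≤ h) (hY : AEStronglyMeasurable Y μ) :
    MemLp (fun ω => clip h (Y ω)) p μ :=
  MemLp.of_bound ((measurable_clip h).comp_aemeasurable hY.aemeasurable).aestronglyMeasurable h
    (Filter.Eventually.of_forall fun ω => abs_clip_le hh _)

/-- A covariance inequality for strongly mixing variables with finite fourth moments. -/
theorem IsMixingPair.abs_covariance_le {m₁ m₂ : MeasurableSpace Ω} {α V : ℝ}
    (h : IsMixingPair μ m₁ m₂ α) (h₁ : m₁ ≤ m0) (h₂ : m₂ ≤ m0) (hα : 0 < α) (hV : 0 < V)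
    {Y W : Ω → ℝ} (hY : Measurable[m₁] Y) (hW : Measurable[m₂] W)
    (hY4 : MemLp Y 4 μ) (hW4 : MemLp W 4 μ)
    (hYV : ∫ ω, Y ω ^ 4 ∂μ ≤ V ^ 2) (hWV : ∫ ω, W ω ^ 4 ∂μ ≤ V ^ 2) :
    |cov[Y, W; μ]| ≤ 8 * Real.sqrt α * V := by
  -- This truncation level balances 4αa², from the truncated parts, against 2V²/a², from each of the
  -- two remainders: all become multiples of √α V.
  set a : ℝ := Real.sqrt (V / Real.sqrt α) with ha
  have hsα : 0 < Real.sqrt α := Real.sqrt_pos.2 hα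
  have ha0 : 0 < a := Real.sqrt_pos.2 (by positivity)
  have ha2 : a ^ 2 = V / Real.sqrt α := Real.sq_sqrt (by positivity)
  set Yc : Ω → ℝ := fun ω => clip a (Y ω)
  set Wc : Ω → ℝ := fun ω => clip a (W ω)
  have hYc : MemLp Yc 2 μ := memLp_clip ha0.le hY4.1
  have hWc : MemLp Wc 2 μ := memLp_clip ha0.le hW4.1
  have hY2 := memLp_two_of_four hY4
  have hW2 := memLp_two_of_four hW4
  have hYc4 : MemLp Yc 4 μ := memLp_clip ha0.le hY4.1
  have hYcV : ∫ ω, Yc ω ^ 4 ∂μ ≤ V ^ 2 := by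
    refine (integral_mono (integrable_pow_four hYc4) (integrable_pow_four hY4) fun ω => ?_).trans hYV
    simp only
    rw [← Even.pow_abs (by decide) (Yc ω), ← Even.pow_abs (by decide) (Y ω)]
    exact pow_le_pow_left₀ (abs_nonneg _) (abs_clip_le_abs ha0.le _) 4
  have c1 : |cov[Yc, Wc; μ]| ≤ 4 * α * a ^ 2 :=
    h.abs_covariance_clip_le h₁ h₂ ((measurable_clip a).comp hY) ((measurable_clip a).comp hW)
      ha0.le (fun ω => abs_clip_le ha0.le _) (fun ω => abs_clip_le ha0.le _)
  have c2 : |cov[Y - Yc, W; μ]| ≤ 2 * V ^ 2 / a ^ 2 :=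
    abs_covariance_le_of_remainder ha0 hY4 hW4 (hY2.sub hYc) hYV hWV
      (fun ω => abs_sub_clip_le ha0 _ 2)
  have c3 : |cov[W - Wc, Yc; μ]| ≤ 2 * V ^ 2 / a ^ 2 :=
    abs_covariance_le_of_remainder ha0 hW4 hYc4 (hW2.sub hWc) hWV hYcV
      (fun ω => abs_sub_clip_le ha0 _ 2)
  have e : cov[Y, W; μ] = cov[Yc, Wc; μ] + cov[Y - Yc, W; μ] + cov[W - Wc, Yc; μ] := by
    rw [covariance_sub_left hY2 hYc hW2, covariance_sub_left hW2 hWc hYc,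
      covariance_comm W Yc, covariance_comm Wc Yc]
    ring
  have r1 : 4 * α * a ^ 2 = 4 * Real.sqrt α * V := by
    rw [ha2]
    nth_rewrite 1 [← Real.mul_self_sqrt hα.le]
    field_simp
  have r2 : 2 * V ^ 2 / a ^ 2 = 2 * Real.sqrt α * V := by
    rw [ha2]; field_simp
  rw [e]
  calc _ ≤ |cov[Yc, Wc; μ]| + |cov[Y - Yc, W; μ]| + |cov[W - Wc, Yc; μ]| := abs_add_three _ _ _
    _ ≤ 4 * Real.sqrt α * V + 2 * Real.sqrt α * V + 2 * Real.sqrt α * V := by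
        rw [← r1, ← r2]; exact add_le_add_three c1 c2 c3
    _ = _ := by ring

end Covariance

/-! ### Variances of sums under geometric mixing -/

/-- `𝓕 t` and `𝓖 (t + n)` (the past and the future of a process) are mixing with coefficient
at most `K r⁻ⁿ`. -/
structure IsMixingFlow {Ω : Type*} {m0 : MeasurableSpace Ω} (μ : Measure Ω)
    (𝓕 𝓖 : ℤ → MeasurableSpace Ω) (K r : ℝ) : Prop where
  past_le : ∀ t, 𝓕 t ≤ m0
  future_le : ∀ t, 𝓖 t ≤ m0
  past_mono : Monotone 𝓕
  future_anti : Antitone 𝓖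
  const_pos : 0 < K
  one_lt : 1 < r
  mixing : ∀ (t : ℤ) (n : ℕ), 1 ≤ n → IsMixingPair μ (𝓕 t) (𝓖 (t + n)) (K * (r ^ n)⁻¹)

/-- The factor by which mixing inflates variances. -/
noncomputable def mixFactor (K r : ℝ) : ℝ := (1 + 1 / Real.log r) * (1 + Real.sqrt K)

/-- From log x ≥ 1 - 1/x at x = 1/√r one gets √r ≥ 1 + (log r)/2. The left side is the sum of the
geometric series by which covariances decay. -/
theorem inv_one_sub_inv_sqrt_le {r : ℝ} (hr : 1 < r) :
    (1 - (Real.sqrt r)⁻¹)⁻¹ ≤ 1 + 2 / Real.log r := by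
  have hl : 0 < Real.log r := Real.log_pos hr
  have hs : 1 < Real.sqrt r := by rw [Real.lt_sqrt (by norm_num)]; simpa using hr
  have h1 := Real.one_sub_inv_le_log_of_pos (inv_pos.2 (zero_lt_one.trans hs))
  rw [inv_inv, Real.log_inv, Real.log_sqrt (by linarith)] at h1
  have h2 : 1 + Real.log r / 2 ≤ Real.sqrt r := by linarith
  have h3 : (Real.sqrt r)⁻¹ ≤ (1 + Real.log r / 2)⁻¹ :=
    inv_anti₀ (by positivity) h2
  have h4 : 1 - (1 + Real.log r / 2)⁻¹ ≤ 1 - (Real.sqrt r)⁻¹ := by linarith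
  have h5 : 1 - (1 + Real.log r / 2)⁻¹ = (Real.log r / 2) / (1 + Real.log r / 2) := by
    field_simp; ring
  rw [h5] at h4
  calc _ ≤ ((Real.log r / 2) / (1 + Real.log r / 2))⁻¹ := inv_anti₀ (by positivity) h4
    _ = _ := by field_simp; ring

theorem sum_pow_le_of_injOn {ι : Type*} (s : Finset ι) {e : ι → ℕ}
    (he : Set.InjOn e s) {q : ℝ} (hq : 0 ≤ q) (hq1 : q < 1) :
    ∑ i ∈ s, q ^ e i ≤ (1 - q)⁻¹ := by
  rw [← tsum_geometric_of_lt_one hq hq1, ← Finset.sum_image (f := fun n => q ^ n) he]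
  exact (summable_geometric_of_lt_one hq hq1).sum_le_tsum _ fun _ _ => by positivity

theorem sum_pow_natAbs_le (I : Finset ℤ) (s : ℤ) {q : ℝ} (hq : 0 ≤ q) (hq1 : q < 1) :
    ∑ t ∈ I, q ^ ((s - t).natAbs - 1) ≤ 1 + 2 * (1 - q)⁻¹ := by
  have h0 : ∀ n : ℕ, (0:ℝ) ≤ q ^ n := fun n => pow_nonneg hq n
  have hsub : I ⊆ ({s} : Finset ℤ) ∪ (I.filter (· < s) ∪ I.filter (s < ·)) := by
    intro t ht
    rcases lt_trichotomy t s with h | h | h <;> simp [ht, h]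
  have b1 : ∑ t ∈ I.filter (· < s), q ^ ((s - t).natAbs - 1) ≤ (1 - q)⁻¹ := by
    refine sum_pow_le_of_injOn _ ?_ hq hq1
    intro a ha b hb h
    simp only [Finset.coe_filter, Set.mem_ofPred_eq] at ha hb h
    omega
  have b2 : ∑ t ∈ I.filter (s < ·), q ^ ((s - t).natAbs - 1) ≤ (1 - q)⁻¹ := by
    refine sum_pow_le_of_injOn _ ?_ hq hq1
    intro a ha b hb h
    simp only [Finset.coe_filter, Set.mem_ofPred_eq] at ha hb h
    omega
  have hun : ∀ A B : Finset ℤ, ∑ t ∈ A ∪ B, q ^ ((s - t).natAbs - 1)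
      ≤ ∑ t ∈ A, q ^ ((s - t).natAbs - 1) + ∑ t ∈ B, q ^ ((s - t).natAbs - 1) := by
    intro A B
    rw [← Finset.sum_union_inter]
    exact le_add_of_nonneg_right (Finset.sum_nonneg fun _ _ => h0 _)
  refine (Finset.sum_le_sum_of_subset_of_nonneg hsub fun _ _ _ => h0 _).trans ?_
  refine (hun _ _).trans ?_
  have := hun (I.filter (· < s)) (I.filter (s < ·))
  simp only [Finset.sum_singleton, sub_self, Int.natAbs_zero, zero_tsub, pow_zero]
  linarith

section Variance

variable {Ω : Type*} {m0 : MeasurableSpace Ω} {μ : Measure Ω} [IsProbabilityMeasure μ]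

theorem abs_covariance_le_of_sq {Y W : Ω → ℝ} {V : ℝ} (hY : MemLp Y 2 μ) (hW : MemLp W 2 μ)
    (hYV : ∫ ω, Y ω ^ 2 ∂μ ≤ V) (hWV : ∫ ω, W ω ^ 2 ∂μ ≤ V) : |cov[Y, W; μ]| ≤ V := by
  have v1 := (variance_le_expectation_sq (μ := μ) hY.1).trans hYV
  have v2 := (variance_le_expectation_sq (μ := μ) hW.1).trans hWV
  have h1 := variance_nonneg (Y - W) μ
  have h2 := variance_nonneg (Y + W) μ
  rw [variance_sub hY hW] at h1
  rw [variance_add hY hW] at h2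
  exact abs_le.2 ⟨by linarith, by linarith⟩

/-- Y t may depend on times t and t + 1, as products of neighbours do, so the gap between Y s and Y
t is |s - t| - 1. Taking the root of the mixing coefficient gives the ratio 1/√r. When |s - t| ≤ 1
the truncated exponent is 0 and the second moments alone suffice. -/
theorem IsMixingFlow.abs_covariance_le {𝓕 𝓖 : ℤ → MeasurableSpace Ω} {K r V : ℝ}
    (h : IsMixingFlow μ 𝓕 𝓖 K r) (hV : 0 < V) {Y : ℤ → Ω → ℝ}
    (hY𝓕 : ∀ t, Measurable[𝓕 (t + 1)] (Y t)) (hY𝓖 : ∀ t, Measurable[𝓖 t] (Y t))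
    (hY4 : ∀ t, MemLp (Y t) 4 μ) (hYV : ∀ t, ∫ ω, Y t ω ^ 4 ∂μ ≤ V ^ 2) (s t : ℤ) :
    |cov[Y s, Y t; μ]|
      ≤ 8 * V * (1 + Real.sqrt K) * (Real.sqrt r)⁻¹ ^ ((s - t).natAbs - 1) := by
  have hK := Real.sqrt_nonneg K
  have hr0 : 0 < r := by linarith [h.one_lt]
  by_cases hst : (s - t).natAbs ≤ 1
  · have : (s - t).natAbs - 1 = 0 := by omega
    rw [this, pow_zero, mul_one]
    refine (abs_covariance_le_of_sq (memLp_two_of_four (hY4 s)) (memLp_two_of_four (hY4 t))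
      (integral_sq_le_of_pow_four hV.le (hY4 s) (hYV s))
      (integral_sq_le_of_pow_four hV.le (hY4 t) (hYV t))).trans ?_
    nlinarith
  · push Not at hst
    have key : ∀ s t : ℤ, s < t → 1 < (s - t).natAbs → |cov[Y s, Y t; μ]|
        ≤ 8 * V * (1 + Real.sqrt K) * (Real.sqrt r)⁻¹ ^ ((s - t).natAbs - 1) := by
      intro s t hlt hst
      have hm := h.mixing (s + 1) ((s - t).natAbs - 1) (by omega)
      have e : s + 1 + (((s - t).natAbs - 1 : ℕ) : ℤ) = t := by omega
      rw [e] at hm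
      have := hm.abs_covariance_le (h.past_le _) (h.future_le _)
        (mul_pos h.const_pos (by positivity)) hV (hY𝓕 s) (hY𝓖 t) (hY4 s) (hY4 t) (hYV s) (hYV t)
      refine this.trans ?_
      rw [Real.sqrt_mul h.const_pos.le, Real.sqrt_inv]
      have e2 : Real.sqrt (r ^ ((s - t).natAbs - 1)) = Real.sqrt r ^ ((s - t).natAbs - 1) := by
        rw [Real.sqrt_eq_iff_mul_self_eq (by positivity) (by positivity), ← mul_pow,
          Real.mul_self_sqrt hr0.le]
      rw [e2, inv_pow]
      have : 0 ≤ V * (Real.sqrt r ^ ((s - t).natAbs - 1))⁻¹ := by positivity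
      nlinarith
    rcases lt_trichotomy s t with hlt | heq | hgt
    · exact key s t hlt hst
    · omega
    · have e : (s - t).natAbs = (t - s).natAbs := by omega
      rw [covariance_comm, e]
      exact key t s hgt (by omega)

theorem IsMixingFlow.variance_sum_le {𝓕 𝓖 : ℤ → MeasurableSpace Ω} {K r V : ℝ}
    (h : IsMixingFlow μ 𝓕 𝓖 K r) (hV : 0 < V) {Y : ℤ → Ω → ℝ}
    (hY𝓕 : ∀ t, Measurable[𝓕 (t + 1)] (Y t)) (hY𝓖 : ∀ t, Measurable[𝓖 t] (Y t))
    (hY4 : ∀ t, MemLp (Y t) 4 μ) (hYV : ∀ t, ∫ ω, Y t ω ^ 4 ∂μ ≤ V ^ 2) (I : Finset ℤ) :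
    Var[∑ t ∈ I, Y t; μ] ≤ I.card * (32 * V * mixFactor K r) := by
  have hK := Real.sqrt_nonneg K
  have hs : 1 < Real.sqrt r := by rw [Real.lt_sqrt (by norm_num)]; simpa using h.one_lt
  have hl : 0 < Real.log r := Real.log_pos h.one_lt
  rw [variance_sum' fun t _ => memLp_two_of_four (hY4 t), ← nsmul_eq_mul]
  refine Finset.sum_le_card_nsmul _ _ _ fun s _ => ?_
  calc ∑ t ∈ I, cov[Y s, Y t; μ]
      ≤ ∑ t ∈ I, 8 * V * (1 + Real.sqrt K) * (Real.sqrt r)⁻¹ ^ ((s - t).natAbs - 1) :=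
        Finset.sum_le_sum fun t _ =>
          (le_abs_self _).trans (h.abs_covariance_le hV hY𝓕 hY𝓖 hY4 hYV s t)
    _ ≤ 8 * V * (1 + Real.sqrt K) * (1 + 2 * (1 + 2 / Real.log r)) := by
        rw [← Finset.mul_sum]
        refine mul_le_mul_of_nonneg_left ?_ (by positivity)
        refine (sum_pow_natAbs_le I s (by positivity) (inv_lt_one_of_one_lt₀ hs)).trans ?_
        linarith [inv_one_sub_inv_sqrt_le h.one_lt]
    _ ≤ 8 * V * (1 + Real.sqrt K) * (4 * (1 + 1 / Real.log r)) := by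
        refine mul_le_mul_of_nonneg_left ?_ (by positivity)
        have : 2 / Real.log r = 2 * (1 / Real.log r) := by ring
        rw [this]; linarith
    _ = 32 * V * mixFactor K r := by unfold mixFactor; ring

end Variance

/-! ### Exponential inequalities for bounded variables under mixing -/

section Exponential

variable {Ω : Type*} {m0 : MeasurableSpace Ω} {μ : Measure Ω} [IsProbabilityMeasure μ]

theorem integral_exp_le_of_abs_le {U : Ω → ℝ} {l B v : ℝ} (hU : Measurable U) (hl : 0 ≤ l)
    (hlB : l * B ≤ 1) (hB : ∀ ω, |U ω| ≤ B) (hmean : ∫ ω, U ω ∂μ = 0)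
    (hvar : ∫ ω, U ω ^ 2 ∂μ ≤ v) : ∫ ω, Real.exp (l * U ω) ∂μ ≤ 1 + l ^ 2 * v := by
  have hUi : Integrable U μ := integrable_of_measurable_of_abs_le hU hB
  have hU2 : Integrable (fun ω => U ω ^ 2) μ :=
    integrable_of_measurable_of_abs_le (a := B ^ 2) (hU.pow_const 2) fun ω => by
      rw [abs_pow]; exact pow_le_pow_left₀ (abs_nonneg _) (hB ω) 2
  have hle : ∀ ω, |l * U ω| ≤ 1 := fun ω => by
    rw [abs_mul, abs_of_nonneg hl]
    exact (mul_le_mul_of_nonneg_left (hB ω) hl).trans hlB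
  calc ∫ ω, Real.exp (l * U ω) ∂μ ≤ ∫ ω, (1 + l * U ω + l ^ 2 * U ω ^ 2) ∂μ := by
        refine integral_mono ?_ ?_ fun ω => ?_
        · refine integrable_of_measurable_of_abs_le (a := Real.exp 1) (by fun_prop) fun ω => ?_
          rw [Real.abs_exp]
          exact Real.exp_le_exp.2 ((le_abs_self _).trans (hle ω))
        · exact ((integrable_const _).add (hUi.const_mul l)).add (hU2.const_mul _)
        · have := (abs_le.1 (Real.abs_exp_sub_one_sub_id_le (hle ω))).2
          simp only
          nlinarith
    _ = 1 + l ^ 2 * ∫ ω, U ω ^ 2 ∂μ := by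
        have h1 : Integrable (fun ω => 1 + l * U ω) μ := (integrable_const _).add (hUi.const_mul l)
        rw [integral_add h1 (hU2.const_mul _), integral_add (integrable_const _) (hUi.const_mul l), integral_const_mul,
          integral_const_mul, hmean]
        simp
    _ ≤ _ := by gcongr

open Classical in
/-- An exponential inequality for sums of bounded variables, successive ones of which are separated
by mixing gaps: the exponential of the partial sums is stopped when they exceed `s`. -/
theorem measureReal_sum_ge_le_of_mixing {U : ℕ → Ω → ℝ} {𝓐 𝓑 : ℕ → MeasurableSpace Ω}
    (h𝓐 : ∀ i, 𝓐 i ≤ m0) (h𝓑 : ∀ i, 𝓑 i ≤ m0) (hmono : Monotone 𝓐)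
    (hU𝓐 : ∀ i, Measurable[𝓐 (i + 1)] (U i)) (hU𝓑 : ∀ i, Measurable[𝓑 i] (U i)) {α : ℝ}
    (hα : ∀ i, IsMixingPair μ (𝓐 i) (𝓑 i) α) {B l s : ℝ} {v : ℕ → ℝ}
    (hB : ∀ i ω, |U i ω| ≤ B) (hmean : ∀ i, ∫ ω, U i ω ∂μ = 0)
    (hvar : ∀ i, ∫ ω, U i ω ^ 2 ∂μ ≤ v i) (hl : 0 ≤ l) (hlB : l * B ≤ 1) (hs : 0 < s) (k : ℕ) :
    μ.real {ω | s ≤ ∑ i ∈ Finset.range k, U i ω} ≤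
      Real.exp (l ^ 2 * ∑ i ∈ Finset.range k, v i)
        * (Real.exp (-(l * s)) + Real.exp 1 * k * α) := by
  have hU : ∀ i, Measurable (U i) := fun i => (hU𝓐 i).mono (h𝓐 _) le_rfl
  have hα0 : 0 ≤ α := by
    have := hα 0 ∅ ∅ (@MeasurableSet.empty _ (𝓐 0)) (@MeasurableSet.empty _ (𝓑 0))
    simpa using this
  have hv0 : ∀ i, 0 ≤ v i := fun i => le_trans (integral_nonneg fun ω => sq_nonneg _) (hvar i)
  set S : ℕ → Ω → ℝ := fun j ω => ∑ i ∈ Finset.range j, U i ω with hS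
  have hS𝓐 : ∀ j, Measurable[𝓐 j] (S j) := fun j => by
    refine Finset.measurable_fun_sum _ fun i hi => (hU𝓐 i).mono (hmono ?_) le_rfl
    have := Finset.mem_range.1 hi
    omega
  set D : ℕ → Set Ω := fun j => {ω | ∀ i ≤ j, S i ω < s} with hD
  have hD𝓐 : ∀ j, MeasurableSet[𝓐 j] (D j) := fun j => by
    have : D j = ⋂ i, ⋂ (_ : i ≤ j), S i ⁻¹' Set.Iio s := by
      ext ω; simp [hD]
    rw [this]
    exact MeasurableSet.iInter fun i => MeasurableSet.iInter fun hi =>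
      ((hS𝓐 i).mono (hmono hi) le_rfl) measurableSet_Iio
  have hDm : ∀ j, MeasurableSet (D j) := fun j => h𝓐 j _ (hD𝓐 j)
  have hSm : ∀ j, Measurable (S j) := fun j => (hS𝓐 j).mono (h𝓐 j) le_rfl
  -- With `b` below, g j + b j is the exponential of the partial sum, frozen at exp(l s) once a
  -- partial sum has reached s. Since g j ≤ exp(l s), each use of mixing costs only α exp(l s) e,
  -- however many summands there are, and Markov's inequality at the level exp(l s) cancels that
  -- factor.
  set g : ℕ → Ω → ℝ := fun j => (D j).indicator fun ω => Real.exp (l * S j ω) with hg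
  have hg𝓐 : ∀ j, Measurable[𝓐 j] (g j) := fun j =>
    Measurable.indicator (Real.measurable_exp.comp ((hS𝓐 j).const_mul l)) (hD𝓐 j)
  have hg0 : ∀ j ω, 0 ≤ g j ω ∧ g j ω ≤ Real.exp (l * s) := fun j ω => by
    simp only [hg, Set.indicator_apply]
    split_ifs with hω
    · exact ⟨(Real.exp_pos _).le, Real.exp_le_exp.2 (mul_le_mul_of_nonneg_left
        (hω j le_rfl).le hl)⟩
    · exact ⟨le_rfl, (Real.exp_pos _).le⟩
  set b : ℕ → Ω → ℝ := fun j => (D j)ᶜ.indicator fun _ => Real.exp (l * s) with hb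
  have hbi : ∀ j, Integrable (b j) μ := fun j => (integrable_const _).indicator (hDm j).compl
  have hb0 : ∀ j ω, 0 ≤ b j ω := fun j ω => Set.indicator_nonneg (fun _ _ => (Real.exp_pos _).le) _
  have hgi : ∀ j, Integrable (g j) μ := fun j =>
    integrable_of_measurable_of_abs_le ((hg𝓐 j).mono (h𝓐 j) le_rfl)
      fun ω => abs_le.2 ⟨by linarith [hg0 j ω, Real.exp_pos (l * s)], (hg0 j ω).2⟩
  have hle : ∀ i ω, l * U i ω ≤ 1 := fun i ω =>
    (mul_le_mul_of_nonneg_left ((le_abs_self _).trans (hB i ω)) hl).trans hlB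
  -- Pointwise, g (j+1) + b (j+1) ≤ g j · exp(l U j) + b j: if s is reached for the first time at j
  -- + 1, then exp(l s) ≤ exp(l S (j+1)). Mixing then separates g j from exp(l U j).
  have hstep : ∀ j, ∫ ω, g (j + 1) ω + b (j + 1) ω ∂μ
      ≤ (1 + l ^ 2 * v j) * ∫ ω, g j ω + b j ω ∂μ + α * Real.exp (l * s) * Real.exp 1 := by
    intro j
    have he𝓑 : Measurable[𝓑 j] fun ω => Real.exp (l * U j ω) :=
      Real.measurable_exp.comp ((hU𝓑 j).const_mul l)
    have hprod : Integrable (fun ω => g j ω * Real.exp (l * U j ω)) μ :=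
      integrable_of_measurable_of_abs_le (a := Real.exp (l * s) * Real.exp 1)
        (((hg𝓐 j).mono (h𝓐 j) le_rfl).mul (he𝓑.mono (h𝓑 j) le_rfl)) fun ω => by
          rw [abs_mul, abs_of_nonneg (hg0 j ω).1, Real.abs_exp]
          exact mul_le_mul (hg0 j ω).2 (Real.exp_le_exp.2 (hle j ω)) (Real.exp_pos _).le
            (Real.exp_pos _).le
    have h1 := (hα j).integral_mul_sub_le (h𝓐 j) (h𝓑 j) (hg𝓐 j) he𝓑 (Real.exp_pos (l * s)).le
      (Real.exp_pos 1).le (hg0 j) fun ω => ⟨(Real.exp_pos _).le, Real.exp_le_exp.2 (hle j ω)⟩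
    have h2 := integral_exp_le_of_abs_le (hU j) hl hlB (hB j) (hmean j) (hvar j)
    have h3 : ∫ ω, g (j + 1) ω + b (j + 1) ω ∂μ
        ≤ ∫ ω, g j ω * Real.exp (l * U j ω) + b j ω ∂μ := by
      refine integral_mono ((hgi _).add (hbi _)) (hprod.add (hbi _)) fun ω => ?_
      have hSsucc : S (j + 1) ω = S j ω + U j ω := Finset.sum_range_succ _ _
      simp only [hg, hb, Set.indicator_apply, Set.mem_compl_iff]
      by_cases h4 : ω ∈ D j
      · by_cases h5 : ω ∈ D (j + 1)
        · simp only [h4, h5, if_true, not_true, if_false, add_zero]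
          rw [← Real.exp_add, hSsucc]
          exact le_of_eq (by ring_nf)
        · simp only [h4, h5, if_true, not_true, not_false_eq_true, if_false, add_zero, zero_add]
          rw [← Real.exp_add]
          refine Real.exp_le_exp.2 ?_
          have h6 : s ≤ S (j + 1) ω := by
            by_contra h7
            refine h5 fun i hi => ?_
            rcases Nat.lt_or_ge j i with h8 | h8
            · have : i = j + 1 := by omega
              rw [this]; exact not_le.1 h7
            · exact h4 i h8
          rw [← mul_add, ← hSsucc]
          exact mul_le_mul_of_nonneg_left h6 hl
      · have h5 : ω ∉ D (j + 1) := fun h6 => h4 fun i hi => h6 i (by omega)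
        simp [h4, h5]
    rw [integral_add hprod (hbi _)] at h3
    have hge : 0 ≤ ∫ ω, g j ω ∂μ := integral_nonneg fun ω => (hg0 j ω).1
    have hbe : 0 ≤ ∫ ω, b j ω ∂μ := integral_nonneg (hb0 j)
    have hsplit : ∫ ω, g j ω + b j ω ∂μ = ∫ ω, g j ω ∂μ + ∫ ω, b j ω ∂μ :=
      integral_add (hgi _) (hbi _)
    rw [hsplit]
    have h7 := mul_le_mul_of_nonneg_left h2 hge
    have h8 : 0 ≤ l ^ 2 * v j * ∫ ω, b j ω ∂μ := by have := hv0 j; positivity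
    nlinarith
  have hΨ : ∀ k : ℕ, ∫ ω, g k ω + b k ω ∂μ ≤ Real.exp (l ^ 2 * ∑ i ∈ Finset.range k, v i)
      * (1 + k * (α * Real.exp (l * s) * Real.exp 1)) := by
    intro k
    induction k with
    | zero =>
      have : ∀ ω, g 0 ω + b 0 ω = 1 := fun ω => by
        have : ω ∈ D 0 := fun i hi => by
          have : i = 0 := by omega
          simpa [this, hS] using hs
        simp [hg, hb, this, hS]
      simp [this]
    | succ k ih =>
      set c : ℝ := α * Real.exp (l * s) * Real.exp 1 with hc
      have hc0 : 0 ≤ c := by positivity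
      have hsum0 : 0 ≤ ∑ i ∈ Finset.range k, v i := Finset.sum_nonneg fun i _ => hv0 i
      have h1 : 1 + l ^ 2 * v k ≤ Real.exp (l ^ 2 * v k) := by
        rw [add_comm]; exact Real.add_one_le_exp _
      have h2 : 1 ≤ Real.exp (l ^ 2 * ∑ i ∈ Finset.range (k + 1), v i) :=
        Real.one_le_exp (mul_nonneg (sq_nonneg _) (Finset.sum_nonneg fun i _ => hv0 i))
      have h3 : 0 ≤ ∫ ω, g k ω + b k ω ∂μ :=
        integral_nonneg fun ω => add_nonneg (hg0 k ω).1 (hb0 k ω)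
      calc _ ≤ (1 + l ^ 2 * v k) * ∫ ω, g k ω + b k ω ∂μ + c := hstep k
        _ ≤ Real.exp (l ^ 2 * v k) * (Real.exp (l ^ 2 * ∑ i ∈ Finset.range k, v i)
              * (1 + k * c)) + c :=
            add_le_add_left (mul_le_mul h1 ih h3 (Real.exp_pos _).le) _
        _ = Real.exp (l ^ 2 * ∑ i ∈ Finset.range (k + 1), v i) * (1 + k * c) + c := by
            rw [← mul_assoc, ← Real.exp_add, Finset.sum_range_succ]
            ring_nf
        _ ≤ _ := by push_cast; nlinarith
  have hfin : Real.exp (l * s) * μ.real {ω | s ≤ S k ω} ≤ ∫ ω, g k ω + b k ω ∂μ := by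
    have hm : MeasurableSet {ω | s ≤ S k ω} := measurableSet_le measurable_const (hSm k)
    calc Real.exp (l * s) * μ.real {ω | s ≤ S k ω}
        = ∫ ω, ({ω | s ≤ S k ω}).indicator (fun _ => Real.exp (l * s)) ω ∂μ := by
          rw [integral_indicator hm, setIntegral_const, smul_eq_mul, mul_comm]
      _ ≤ _ := by
          refine integral_mono ((integrable_const _).indicator hm) ((hgi _).add (hbi _)) fun ω => ?_
          by_cases hω : s ≤ S k ω
          · have : ω ∉ D k := fun h => absurd (h k le_rfl) (not_lt.2 hω)
            simp [hg, hb, this, hω]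
          · rw [Set.indicator_of_notMem (by simpa using hω)]
            exact add_nonneg (hg0 k ω).1 (hb0 k ω)
  have h9 := hfin.trans (hΨ k)
  have hes := Real.exp_pos (l * s)
  rw [Real.exp_neg]
  rw [← mul_le_mul_iff_right₀ hes]
  refine h9.trans (le_of_eq ?_)
  field_simp

end Exponential

/-! ### Splitting a time interval into blocks of even and odd number -/

section Blocks

variable {Ω : Type*} {m0 : MeasurableSpace Ω} {μ : Measure Ω} [IsProbabilityMeasure μ]

/-- The elements of `I` in the block with number `q`, where the blocks start at `p` and have
length `b`. -/
def timeBlock (I : Finset ℤ) (p : ℤ) (b : ℕ) (q : ℕ) : Finset ℤ :=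
  I.filter fun t => ((t - p) / (b : ℤ)).toNat = q

theorem mem_timeBlock {I : Finset ℤ} {p : ℤ} {b n q : ℕ} (hb : 1 ≤ b)
    (hI : I ⊆ Finset.Ico p (p + n)) {t : ℤ} (ht : t ∈ timeBlock I p b q) :
    p + q * b ≤ t ∧ t < p + q * b + b := by
  obtain ⟨h1, h2⟩ := Finset.mem_filter.1 ht
  have h3 := Finset.mem_Ico.1 (hI h1)
  have hb0 : (0 : ℤ) < b := by omega
  have h4 : 0 ≤ (t - p) / (b : ℤ) := Int.ediv_nonneg (by omega) hb0.le
  have h5 : (t - p) / (b : ℤ) = q := by omega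
  have h6 := Int.emod_add_mul_ediv (t - p) b
  have h7 := Int.emod_nonneg (t - p) hb0.ne'
  have h8 := Int.emod_lt_of_pos (t - p) hb0
  rw [h5] at h6
  constructor <;> nlinarith

theorem card_timeBlock_le {I : Finset ℤ} {p : ℤ} {b n q : ℕ} (hb : 1 ≤ b)
    (hI : I ⊆ Finset.Ico p (p + n)) : (timeBlock I p b q).card ≤ b := by
  have : timeBlock I p b q ⊆ Finset.Ico (p + q * b) (p + q * b + b) := fun t ht =>
    Finset.mem_Ico.2 (mem_timeBlock hb hI ht)
  simpa using Finset.card_le_card this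

theorem sum_range_two_mul {M : Type*} [AddCommMonoid M] (f : ℕ → M) (k : ℕ) :
    ∑ q ∈ Finset.range (2 * k), f q
      = ∑ i ∈ Finset.range k, f (2 * i + 0) + ∑ i ∈ Finset.range k, f (2 * i + 1) := by
  induction k with
  | zero => simp
  | succ k ih =>
    rw [Nat.mul_succ, Finset.sum_range_succ, Finset.sum_range_succ, ih, Finset.sum_range_succ,
      Finset.sum_range_succ]
    simp only [add_zero]
    abel

/-- Block numbers do not exceed n/b, so n/b + 1 blocks of each parity suffice. The form `2 * i + 0`
lets one lemma in `2 * i + c` serve both parities. -/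
theorem sum_eq_sum_timeBlock {M : Type*} [AddCommMonoid M] {I : Finset ℤ} {p : ℤ} {b n : ℕ}
    (hb : 1 ≤ b) (hI : I ⊆ Finset.Ico p (p + n)) (f : ℤ → M) :
    ∑ t ∈ I, f t = ∑ i ∈ Finset.range (n / b + 1), ∑ t ∈ timeBlock I p b (2 * i + 0), f t
      + ∑ i ∈ Finset.range (n / b + 1), ∑ t ∈ timeBlock I p b (2 * i + 1), f t := by
  rw [← sum_range_two_mul (fun q => ∑ t ∈ timeBlock I p b q, f t)]
  refine (Finset.sum_fiberwise_of_maps_to (fun t ht => ?_) f).symm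
  have h3 := Finset.mem_Ico.1 (hI ht)
  rw [Finset.mem_range]
  have h4 : (t - p) / (b : ℤ) ≤ (n : ℤ) / b :=
    Int.ediv_le_ediv (by omega) (by omega)
  have h5 : ((n / b : ℕ) : ℤ) = (n : ℤ) / b := by push_cast; rfl
  have h6 : 0 ≤ (n : ℤ) / b := h5 ▸ Int.natCast_nonneg _
  omega

theorem IsMixingFlow.measureReal_half_sum_ge_le {𝓕 𝓖 : ℤ → MeasurableSpace Ω} {K r M σ l s : ℝ}
    (h : IsMixingFlow μ 𝓕 𝓖 K r) {Y : ℤ → Ω → ℝ}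
    (hY𝓕 : ∀ t, Measurable[𝓕 (t + 1)] (Y t)) (hY𝓖 : ∀ t, Measurable[𝓖 t] (Y t))
    (hM : ∀ t ω, |Y t ω| ≤ M) (hmean : ∀ t, ∫ ω, Y t ω ∂μ = 0)
    (hvar : ∀ J : Finset ℤ, Var[∑ t ∈ J, Y t; μ] ≤ J.card * σ) (hσ : 0 ≤ σ)
    {I : Finset ℤ} {p : ℤ} {n b : ℕ} (hb : 1 ≤ b) (hI : I ⊆ Finset.Ico p (p + n))
    (hl : 0 ≤ l) (hlM : l * (b * M) ≤ 1) (hs : 0 < s) (c k : ℕ) :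
    μ.real {ω | s ≤ ∑ i ∈ Finset.range k, ∑ t ∈ timeBlock I p b (2 * i + c), Y t ω} ≤
      Real.exp (l ^ 2 * (I.card * σ))
        * (Real.exp (-(l * s)) + Real.exp 1 * k * (K * (r ^ b)⁻¹)) := by
  have hYm : ∀ t, Measurable (Y t) := fun t => (hY𝓕 t).mono (h.past_le _) le_rfl
  have hYi : ∀ t, Integrable (Y t) μ := fun t => integrable_of_measurable_of_abs_le (hYm t) (hM t)
  have hM0 : 0 ≤ M := by
    obtain ⟨ω⟩ : Nonempty Ω := nonempty_of_isProbabilityMeasure μ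
    exact (abs_nonneg _).trans (hM 0 ω)
  have key := measureReal_sum_ge_le_of_mixing (μ := μ)
    (U := fun i ω => ∑ t ∈ timeBlock I p b (2 * i + c), Y t ω)
    -- This is the end of the preceding block of the same parity. The skipped block in between
    -- supplies the mixing gap b.
    (𝓐 := fun i => 𝓕 (p + (2 * i + c : ℕ) * b - b))
    (𝓑 := fun i => 𝓖 (p + (2 * i + c : ℕ) * b)) (α := K * (r ^ b)⁻¹) (B := b * M) (l := l) (s := s)
    (v := fun i => (timeBlock I p b (2 * i + c)).card * σ)
    (fun i => h.past_le _) (fun i => h.future_le _) ?_ ?_ ?_ ?_ ?_ ?_ ?_ hl hlM hs k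
  · refine key.trans ?_
    refine mul_le_mul_of_nonneg_right ?_ ?_
    · refine Real.exp_le_exp.2 (mul_le_mul_of_nonneg_left ?_ (sq_nonneg _))
      rw [← Finset.sum_mul]
      refine mul_le_mul_of_nonneg_right ?_ hσ
      rw [← Nat.cast_sum, Nat.cast_le]
      have hd : Set.PairwiseDisjoint (↑(Finset.range k)) fun i => timeBlock I p b (2 * i + c) := by
        intro i _ j _ hij
        refine Finset.disjoint_left.2 fun t h1 h2 => hij ?_
        have h3 := (Finset.mem_filter.1 h1).2
        have h4 := (Finset.mem_filter.1 h2).2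
        omega
      rw [← Finset.card_biUnion fun i hi j hj hij => hd hi hj hij]
      refine Finset.card_le_card fun t ht => ?_
      obtain ⟨i, _, hi⟩ := Finset.mem_biUnion.1 ht
      exact (Finset.mem_filter.1 hi).1
    · have := h.const_pos
      have := h.one_lt
      positivity
  · intro i j hij
    refine h.past_mono ?_
    have : (2 * i + c) * b ≤ (2 * j + c) * b := Nat.mul_le_mul_right _ (by omega)
    have : (((2 * i + c) * b : ℕ) : ℤ) ≤ ((2 * j + c) * b : ℕ) := by exact_mod_cast this
    push_cast at this ⊢
    linarith
  · intro i
    refine Finset.measurable_fun_sum _ fun t ht => (hY𝓕 t).mono (h.past_mono ?_) le_rfl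
    have := (mem_timeBlock hb hI ht).2
    push_cast at this ⊢
    linarith
  · intro i
    refine Finset.measurable_fun_sum _ fun t ht => (hY𝓖 t).mono (h.future_anti ?_) le_rfl
    exact (mem_timeBlock hb hI ht).1
  · intro i
    have := h.mixing (p + (2 * i + c : ℕ) * b - b) b hb
    rwa [sub_add_cancel] at this
  · intro i ω
    calc |∑ t ∈ timeBlock I p b (2 * i + c), Y t ω|
        ≤ ∑ t ∈ timeBlock I p b (2 * i + c), |Y t ω| := Finset.abs_sum_le_sum_abs _ _
      _ ≤ (timeBlock I p b (2 * i + c)).card • M := Finset.sum_le_card_nsmul _ _ _ fun t _ => hM t ω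
      _ ≤ b * M := by
          rw [nsmul_eq_mul]
          refine mul_le_mul_of_nonneg_right ?_ hM0
          exact_mod_cast card_timeBlock_le hb hI
  · intro i
    rw [integral_finsetSum _ fun t _ => hYi t]
    exact Finset.sum_eq_zero fun t _ => hmean t
  · intro i
    refine le_trans (le_of_eq ?_) (hvar _)
    rw [variance_of_integral_eq_zero]
    · exact integral_congr_ae (Filter.Eventually.of_forall fun ω => by simp [Finset.sum_apply])
    · exact (Finset.aemeasurable_sum _ fun t _ => (hYm t).aemeasurable)
    · simp only [Finset.sum_apply]
      rw [integral_finsetSum _ fun t _ => hYi t]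
      exact Finset.sum_eq_zero fun t _ => hmean t

/-- An exponential inequality for sums of bounded variables under geometric mixing, with a free
block length `b`. -/
theorem IsMixingFlow.measureReal_sum_ge_le {𝓕 𝓖 : ℤ → MeasurableSpace Ω} {K r M σ l s : ℝ}
    (h : IsMixingFlow μ 𝓕 𝓖 K r) {Y : ℤ → Ω → ℝ}
    (hY𝓕 : ∀ t, Measurable[𝓕 (t + 1)] (Y t)) (hY𝓖 : ∀ t, Measurable[𝓖 t] (Y t))
    (hM : ∀ t ω, |Y t ω| ≤ M) (hmean : ∀ t, ∫ ω, Y t ω ∂μ = 0)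
    (hvar : ∀ J : Finset ℤ, Var[∑ t ∈ J, Y t; μ] ≤ J.card * σ) (hσ : 0 ≤ σ)
    {I : Finset ℤ} {p : ℤ} {n b : ℕ} (hb : 1 ≤ b) (hI : I ⊆ Finset.Ico p (p + n))
    (hl : 0 ≤ l) (hlM : l * (b * M) ≤ 1) (hs : 0 < s) :
    μ.real {ω | s ≤ ∑ t ∈ I, Y t ω} ≤
      2 * (Real.exp (l ^ 2 * (n * σ))
        * (Real.exp (-(l * (s / 2))) + Real.exp 1 * (n / b + 1) * (K * (r ^ b)⁻¹))) := by
  have hcard : (I.card : ℝ) ≤ n := by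
    have := Finset.card_le_card hI
    rw [Int.card_Ico] at this
    have : I.card ≤ n := by omega
    exact_mod_cast this
  have half : ∀ c : ℕ, μ.real {ω | s / 2 ≤ ∑ i ∈ Finset.range (n / b + 1),
      ∑ t ∈ timeBlock I p b (2 * i + c), Y t ω} ≤ Real.exp (l ^ 2 * (n * σ))
        * (Real.exp (-(l * (s / 2))) + Real.exp 1 * (n / b + 1) * (K * (r ^ b)⁻¹)) := by
    intro c
    refine (h.measureReal_half_sum_ge_le hY𝓕 hY𝓖 hM hmean hvar hσ hb hI hl hlM (half_pos hs) c
      (n / b + 1)).trans ?_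
    have h1 := h.const_pos
    have h2 := h.one_lt
    have h3 : ((n / b + 1 : ℕ) : ℝ) ≤ (n : ℝ) / b + 1 := by
      push_cast
      have : ((n / b : ℕ) : ℝ) ≤ (n : ℝ) / b := Nat.cast_div_le
      linarith
    gcongr
  have hsub : {ω | s ≤ ∑ t ∈ I, Y t ω} ⊆
      {ω | s / 2 ≤ ∑ i ∈ Finset.range (n / b + 1), ∑ t ∈ timeBlock I p b (2 * i + 0), Y t ω} ∪
      {ω | s / 2 ≤ ∑ i ∈ Finset.range (n / b + 1), ∑ t ∈ timeBlock I p b (2 * i + 1), Y t ω} := by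
    intro ω hω
    simp only [Set.mem_union, Set.mem_ofPred_eq] at hω ⊢
    rw [sum_eq_sum_timeBlock hb hI] at hω
    by_contra hcon
    push Not at hcon
    linarith [hcon.1, hcon.2]
  calc _ ≤ _ := measureReal_mono hsub
    _ ≤ _ := measureReal_union_le _ _
    _ ≤ _ := add_le_add (half 0) (half 1)
    _ = _ := by ring

end Blocks

/-! ### Concentration of sums of variables with Bernstein-type moments -/

section Concentration

variable {Ω : Type*} {m0 : MeasurableSpace Ω} {μ : Measure Ω} [IsProbabilityMeasure μ]

theorem sub_clip_pow_four_le {h : ℝ} (hh : 0 < h) (y : ℝ) (j : ℕ) :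
    (y - clip h y) ^ 4 ≤ |y| ^ (4 + j) / h ^ j := by
  rw [← Even.pow_abs (by decide) (y - clip h y)]
  by_cases hy : |y| ≤ h
  · have : clip h y = y := by
      unfold clip
      rw [min_eq_right (abs_le.1 hy).2, max_eq_right (abs_le.1 hy).1]
    rw [this, sub_self, abs_zero, zero_pow (by norm_num)]
    positivity
  · push Not at hy
    have h1 : |y - clip h y| ≤ |y| := by simpa using abs_sub_clip_le hh y 0
    rw [le_div_iff₀ (by positivity), pow_add]
    exact mul_le_mul (pow_le_pow_left₀ (abs_nonneg _) h1 4) (pow_le_pow_left₀ hh.le hy.le j)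
      (by positivity) (by positivity)

/-- Moments bounded by `Θ ^ q * ((2 q)!) ^ d`, as for products of two variables that satisfy a
Bernstein-type condition. -/
def HasBernsteinMoments {Ω : Type*} {m0 : MeasurableSpace Ω} (μ : Measure Ω) (Z : Ω → ℝ)
    (Θ d : ℝ) : Prop :=
  ∀ q : ℕ, 1 ≤ q → Integrable (fun ω => |Z ω| ^ q) μ ∧
    ∫ ω, |Z ω| ^ q ∂μ ≤ Θ ^ q * ((2 * q).factorial : ℝ) ^ d

theorem HasBernsteinMoments.memLp_four {Z : Ω → ℝ} {Θ d : ℝ} (hZ : Measurable Z)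
    (h : HasBernsteinMoments μ Z Θ d) : MemLp Z 4 μ :=
  memLp_four_of_integrable hZ.aestronglyMeasurable
    ((h 4 (by norm_num)).1.congr (Filter.Eventually.of_forall fun _ => Even.pow_abs (by decide) _))

theorem HasBernsteinMoments.integral_pow_four_le {Z : Ω → ℝ} {Θ d : ℝ} (hd : 0 ≤ d)
    (h : HasBernsteinMoments μ Z Θ d) :
    ∫ ω, Z ω ^ 4 ∂μ ≤ (Θ ^ 2 * (256 : ℝ) ^ d) ^ 2 := by
  have h1 := (h 4 (by norm_num)).2
  have h2 : ∫ ω, Z ω ^ 4 ∂μ = ∫ ω, |Z ω| ^ 4 ∂μ := by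
    congr 1; ext ω; exact (Even.pow_abs (by decide) _).symm
  rw [h2]
  refine h1.trans ?_
  rw [mul_pow, ← pow_mul]
  refine mul_le_mul_of_nonneg_left ?_ (by positivity)
  rw [← Real.rpow_natCast, ← Real.rpow_mul (by norm_num), mul_comm d, Real.rpow_mul (by norm_num)]
  refine Real.rpow_le_rpow (by positivity) ?_ hd
  -- Here 8! = 40320 ≤ 256².
  norm_num [Nat.factorial]

/-- The remainder vanishes below the truncation level, so j additional powers of |Z| may be traded
for (Θb)^j. The order j is left free in order to grow with the exponent A. -/
theorem HasBernsteinMoments.integral_remainder_le {Z : Ω → ℝ} {Θ d b : ℝ} (hZ : Measurable Z)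
    (hΘ : 0 < Θ) (hb : 0 < b) (h : HasBernsteinMoments μ Z Θ d) (j : ℕ) :
    ∫ ω, (Z ω - clip (Θ * b) (Z ω)) ^ 4 ∂μ
      ≤ Θ ^ 4 * (((2 * (4 + j)).factorial : ℝ) ^ d / b ^ j) := by
  have hΘb : 0 < Θ * b := by positivity
  have h1 := h (4 + j) (by omega)
  have hL : MemLp (fun ω => Z ω - clip (Θ * b) (Z ω)) 4 μ :=
    (h.memLp_four hZ).sub (memLp_clip hΘb.le hZ.aestronglyMeasurable)
  calc _ ≤ ∫ ω, |Z ω| ^ (4 + j) / (Θ * b) ^ j ∂μ :=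
        integral_mono (integrable_pow_four hL) (h1.1.div_const _)
          fun ω => sub_clip_pow_four_le hΘb _ j
    _ = (∫ ω, |Z ω| ^ (4 + j) ∂μ) / (Θ * b) ^ j := integral_div _ _
    _ ≤ (Θ ^ (4 + j) * ((2 * (4 + j)).factorial : ℝ) ^ d) / (Θ * b) ^ j :=
        div_le_div_of_nonneg_right h1.2 (by positivity)
    _ = _ := by rw [mul_pow, pow_add]; field_simp

/-- Truncation at Θb splits the level s into 3s/4 for the bounded parts, where the exponential
inequality gives 3s/8 to each parity, and s/4 for the remainders, where Chebyshev's inequality is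
enough. -/
theorem IsMixingFlow.measureReal_sum_ge_le_of_moments {𝓕 𝓖 : ℤ → MeasurableSpace Ω}
    {K r Θ d b l s W : ℝ} (h : IsMixingFlow μ 𝓕 𝓖 K r) {Z : ℤ → Ω → ℝ}
    (hZ𝓕 : ∀ t, Measurable[𝓕 (t + 1)] (Z t)) (hZ𝓖 : ∀ t, Measurable[𝓖 t] (Z t))
    (hΘ : 0 < Θ) (hd : 0 ≤ d) (hZ : ∀ t, HasBernsteinMoments μ (Z t) Θ d)
    {I : Finset ℤ} {p : ℤ} {n w j : ℕ} (hw : 1 ≤ w) (hI : I ⊆ Finset.Ico p (p + n))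
    (hb : 0 < b) (hW : 0 < W) (hbW : ((2 * (4 + j)).factorial : ℝ) ^ d / b ^ j ≤ W ^ 2)
    (hl : 0 ≤ l) (hlw : l * (w * (2 * (Θ * b))) ≤ 1) (hs : 0 < s) :
    μ.real {ω | s ≤ ∑ t ∈ I, (Z t ω - ∫ ω, Z t ω ∂μ)} ≤
      2 * (Real.exp (l ^ 2 * (n * (32 * (Θ ^ 2 * (256 : ℝ) ^ d) * mixFactor K r)))
        * (Real.exp (-(l * (3 / 8 * s))) + Real.exp 1 * (n / w + 1) * (K * (r ^ w)⁻¹)))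
      + n * (32 * (Θ ^ 2 * W) * mixFactor K r) / (s / 4) ^ 2 := by
  have hM : 0 < Θ * b := by positivity
  have hZm : ∀ t, Measurable (Z t) := fun t => (hZ𝓕 t).mono (h.past_le _) le_rfl
  have hZ4 : ∀ t, MemLp (Z t) 4 μ := fun t => (hZ t).memLp_four (hZm t)
  have hmf : 0 ≤ mixFactor K r := by
    have := Real.log_pos h.one_lt
    unfold mixFactor; positivity
  have hcard : (I.card : ℝ) ≤ n := by
    have := Finset.card_le_card hI
    rw [Int.card_Ico] at this
    have : I.card ≤ n := by omega
    exact_mod_cast this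
  set Zc : ℤ → Ω → ℝ := fun t ω => clip (Θ * b) (Z t ω) with hZc
  set R : ℤ → Ω → ℝ := fun t ω => Z t ω - clip (Θ * b) (Z t ω) with hR
  have hZcm : ∀ t, Measurable (Zc t) := fun t => (measurable_clip _).comp (hZm t)
  have hZc4 : ∀ t, MemLp (Zc t) 4 μ := fun t => memLp_clip hM.le (hZm t).aestronglyMeasurable
  have hR4 : ∀ t, MemLp (R t) 4 μ := fun t => (hZ4 t).sub (hZc4 t)
  have hZci : ∀ t, Integrable (Zc t) μ := fun t => (hZc4 t).integrable (by norm_num)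
  have hRi : ∀ t, Integrable (R t) μ := fun t => (hR4 t).integrable (by norm_num)
  have hZi : ∀ t, Integrable (Z t) μ := fun t => (hZ4 t).integrable (by norm_num)
  -- the truncated variables
  have hcov1 : ∀ J : Finset ℤ, Var[∑ t ∈ J, Zc t; μ]
      ≤ J.card * (32 * (Θ ^ 2 * (256 : ℝ) ^ d) * mixFactor K r) :=
    h.variance_sum_le (by positivity) (fun t => (measurable_clip _).comp (hZ𝓕 t))
      (fun t => (measurable_clip _).comp (hZ𝓖 t)) hZc4 fun t => by
        refine (integral_mono (integrable_pow_four (hZc4 t)) (integrable_pow_four (hZ4 t))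
          fun ω => ?_).trans ((hZ t).integral_pow_four_le hd)
        simp only
        rw [← Even.pow_abs (by decide) (Zc t ω), ← Even.pow_abs (by decide) (Z t ω)]
        exact pow_le_pow_left₀ (abs_nonneg _) (abs_clip_le_abs hM.le _) 4
  have hvar1 : ∀ J : Finset ℤ, Var[∑ t ∈ J, (fun ω => Zc t ω - ∫ ω, Zc t ω ∂μ); μ]
      ≤ J.card * (32 * (Θ ^ 2 * (256 : ℝ) ^ d) * mixFactor K r) := fun J => by
    refine le_trans (le_of_eq ?_) (hcov1 J)
    have : (∑ t ∈ J, (fun ω => Zc t ω - ∫ ω, Zc t ω ∂μ))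
        = fun ω => (∑ t ∈ J, Zc t) ω - ∑ t ∈ J, ∫ ω, Zc t ω ∂μ := by
      ext ω; simp [Finset.sum_apply, Finset.sum_sub_distrib]
    rw [this, variance_sub_const
      (Finset.aestronglyMeasurable_sum _ fun t _ => (hZcm t).aestronglyMeasurable)]
  have hb1 := h.measureReal_sum_ge_le (Y := fun t ω => Zc t ω - ∫ ω, Zc t ω ∂μ) (M := 2 * (Θ * b))
    (fun t => ((measurable_clip _).comp (hZ𝓕 t)).sub_const _)
    (fun t => ((measurable_clip _).comp (hZ𝓖 t)).sub_const _)
    (fun t ω => by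
      have h1 : |∫ ω, Zc t ω ∂μ| ≤ Θ * b := by
        have := norm_integral_le_of_norm_le_const (μ := μ) (f := Zc t) (C := Θ * b)
          (Filter.Eventually.of_forall fun ω => abs_clip_le hM.le _)
        simpa using this
      have h2 : |Zc t ω| ≤ Θ * b := abs_clip_le hM.le _
      calc _ ≤ |Zc t ω| + |∫ ω, Zc t ω ∂μ| := abs_sub _ _
        _ ≤ _ := by linarith)
    (fun t => by simp [integral_sub (hZci t) (integrable_const _)]) hvar1 (by positivity) hw hI hl
    hlw (s := 3 / 4 * s) (by linarith)
  -- the remainders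
  have hvar2 : Var[∑ t ∈ I, R t; μ] ≤ n * (32 * (Θ ^ 2 * W) * mixFactor K r) := by
    refine (h.variance_sum_le (V := Θ ^ 2 * W) (by positivity)
      (fun t => (hZ𝓕 t).sub ((measurable_clip _).comp (hZ𝓕 t)))
      (fun t => (hZ𝓖 t).sub ((measurable_clip _).comp (hZ𝓖 t))) hR4 (fun t => ?_) I).trans ?_
    · refine ((hZ t).integral_remainder_le (hZm t) hΘ hb j).trans ?_
      rw [mul_pow, ← pow_mul]
      exact mul_le_mul_of_nonneg_left hbW (by positivity)
    · exact mul_le_mul_of_nonneg_right hcard (by positivity)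
  have hb2 : μ.real {ω | s / 4 ≤ |(∑ t ∈ I, R t) ω - ∫ ω, (∑ t ∈ I, R t) ω ∂μ|}
      ≤ n * (32 * (Θ ^ 2 * W) * mixFactor K r) / (s / 4) ^ 2 := by
    have h2 : MemLp (∑ t ∈ I, R t) 2 μ := memLp_finsetSum' _ fun t _ => memLp_two_of_four (hR4 t)
    have h3 := meas_ge_le_variance_div_sq h2 (c := s / 4) (by linarith)
    refine (ENNReal.toReal_mono ENNReal.ofReal_ne_top h3).trans ?_
    rw [ENNReal.toReal_ofReal (div_nonneg (variance_nonneg _ _) (sq_nonneg _))]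
    exact div_le_div_of_nonneg_right hvar2 (sq_nonneg _)
  have hsub : {ω | s ≤ ∑ t ∈ I, (Z t ω - ∫ ω, Z t ω ∂μ)} ⊆
      {ω | 3 / 4 * s ≤ ∑ t ∈ I, (Zc t ω - ∫ ω, Zc t ω ∂μ)} ∪
      {ω | s / 4 ≤ |(∑ t ∈ I, R t) ω - ∫ ω, (∑ t ∈ I, R t) ω ∂μ|} := by
    intro ω hω
    simp only [Set.mem_union, Set.mem_ofPred_eq] at hω ⊢
    by_contra hcon
    push Not at hcon
    obtain ⟨h1, h2⟩ := hcon
    have e1 : ∀ t, Z t ω - ∫ ω, Z t ω ∂μ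
        = (Zc t ω - ∫ ω, Zc t ω ∂μ) + (R t ω - ∫ ω, R t ω ∂μ) := fun t => by
      have : ∫ ω, R t ω ∂μ = ∫ ω, Z t ω ∂μ - ∫ ω, Zc t ω ∂μ := integral_sub (hZi t) (hZci t)
      have h3 : R t ω = Z t ω - Zc t ω := rfl
      rw [this, h3]; ring
    have e2 : (∑ t ∈ I, R t) ω - ∫ ω, (∑ t ∈ I, R t) ω ∂μ
        = ∑ t ∈ I, (R t ω - ∫ ω, R t ω ∂μ) := by
      simp only [Finset.sum_apply]
      rw [integral_finsetSum _ fun t _ => hRi t]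
      exact (Finset.sum_sub_distrib _ _).symm
    rw [e2] at h2
    simp_rw [e1] at hω
    rw [Finset.sum_add_distrib] at hω
    linarith [le_abs_self (∑ t ∈ I, (R t ω - ∫ ω, R t ω ∂μ))]
  have e8 : 3 / 4 * s / 2 = 3 / 8 * s := by ring
  rw [e8] at hb1
  exact (measureReal_mono hsub).trans ((measureReal_union_le _ _).trans (add_le_add hb1 hb2))

end Concentration

/-! ### Inequalities behind the choice of block length and truncation level -/

/-- The block length contains a logarithm of the sample size, which would otherwise weaken the final
bound. A weighted geometric mean of the two lower bounds for y, with weights 1 - ψ and ψ = 1/(2 +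
2d), reproduces the power 1 + 2d of A and leaves a small positive power of G, and that power
dominates log G. -/
theorem rpow_mul_log_le {d A u G y : ℝ} (hd : 1 / 2 ≤ d) (hA : 0 < A) (hu : 0 < u) (hG : 1 ≤ G)
    (h1 : 200 * u * ((32 : ℝ) ^ d * A ^ (2 + 2 * d)) ≤ y)
    (h2 : 200 * u * ((16 : ℝ) ^ d * Real.sqrt G) ≤ y) :
    (25 : ℝ) ^ d * A ^ (1 + 2 * d) * u * (2 * Real.log G) ≤ 7 / 5 * y := by
  set ψ : ℝ := 1 / (2 + 2 * d) with hψ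
  have hψ0 : 0 < ψ := by positivity
  have hψ1 : ψ ≤ 1 := by rw [hψ, div_le_one (by linarith)]; linarith
  have hdψ : d * ψ ≤ 1 := by rw [hψ, mul_one_div, div_le_one (by linarith)]; linarith
  have hG0 : 0 < G := by linarith
  have hsG : 0 < Real.sqrt G := Real.sqrt_pos.2 hG0
  have hP : 0 < 200 * u := by positivity
  have hy : 0 < y := lt_of_lt_of_le (by positivity) h1
  have e1 : ((32 : ℝ) ^ d * A ^ (2 + 2 * d)) ^ (1 - ψ)
      = (32 : ℝ) ^ (d * (1 - ψ)) * A ^ (1 + 2 * d) := by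
    rw [Real.mul_rpow (by positivity) (by positivity), ← Real.rpow_mul (by norm_num),
      ← Real.rpow_mul hA.le]
    congr 2
    rw [hψ]; field_simp; ring
  have e2 : ((16 : ℝ) ^ d * Real.sqrt G) ^ ψ = (16 : ℝ) ^ (d * ψ) * G ^ (ψ / 2) := by
    rw [Real.mul_rpow (by positivity) (by positivity), ← Real.rpow_mul (by norm_num),
      Real.sqrt_eq_rpow, ← Real.rpow_mul hG0.le]
    congr 2
    ring
  have e3 : (32 : ℝ) ^ d / 2 ≤ (32 : ℝ) ^ (d * (1 - ψ)) * (16 : ℝ) ^ (d * ψ) := by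
    have e4 : (32 : ℝ) ^ d = (32 : ℝ) ^ (d * (1 - ψ)) * ((16 : ℝ) ^ (d * ψ) * 2 ^ (d * ψ)) := by
      rw [← Real.mul_rpow (by norm_num) (by norm_num)]
      norm_num only
      rw [← Real.rpow_add (by norm_num)]
      congr 1; ring
    have e5 : (2 : ℝ) ^ (d * ψ) ≤ 2 := by
      simpa using Real.rpow_le_rpow_of_exponent_le (by norm_num : (1 : ℝ) ≤ 2) hdψ
    rw [e4, ← mul_assoc]
    have : 0 ≤ (32 : ℝ) ^ (d * (1 - ψ)) * (16 : ℝ) ^ (d * ψ) := by positivity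
    nlinarith
  have hAy : 100 * u * (32 : ℝ) ^ d * A ^ (1 + 2 * d) * G ^ (ψ / 2) ≤ y := by
    calc 100 * u * (32 : ℝ) ^ d * A ^ (1 + 2 * d) * G ^ (ψ / 2)
        = 200 * u * ((32 : ℝ) ^ d / 2) * A ^ (1 + 2 * d) * G ^ (ψ / 2) := by ring
      _ ≤ 200 * u * ((32 : ℝ) ^ (d * (1 - ψ)) * (16 : ℝ) ^ (d * ψ)) * A ^ (1 + 2 * d)
          * G ^ (ψ / 2) := by gcongr
      _ = ((200 * u) ^ (1 - ψ) * (200 * u) ^ ψ) * (((32 : ℝ) ^ d * A ^ (2 + 2 * d)) ^ (1 - ψ)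
          * ((16 : ℝ) ^ d * Real.sqrt G) ^ ψ) := by
          rw [e1, e2, ← Real.rpow_add hP]
          simp only [sub_add_cancel, Real.rpow_one]
          ring
      _ = (200 * u * ((32 : ℝ) ^ d * A ^ (2 + 2 * d))) ^ (1 - ψ)
          * (200 * u * ((16 : ℝ) ^ d * Real.sqrt G)) ^ ψ := by
          rw [Real.mul_rpow hP.le (by positivity), Real.mul_rpow hP.le (by positivity)]
          ring
      _ ≤ y ^ (1 - ψ) * y ^ ψ := by
          refine mul_le_mul (Real.rpow_le_rpow (by positivity) h1 (by linarith))
            (Real.rpow_le_rpow (by positivity) h2 hψ0.le) (by positivity) (by positivity)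
      _ = y := by rw [← Real.rpow_add hy]; simp
  have hlog : Real.log G ≤ (4 + 4 * d) * G ^ (ψ / 2) := by
    refine (Real.log_le_rpow_div hG0.le (half_pos hψ0)).trans (le_of_eq ?_)
    rw [hψ]; field_simp; ring
  have hexp : (25 : ℝ) ^ d * (8 + 8 * d) ≤ 140 * (32 : ℝ) ^ d := by
    have e4 : (32 : ℝ) ^ d = (25 : ℝ) ^ d * (32 / 25) ^ d := by
      rw [← Real.mul_rpow (by norm_num) (by norm_num)]; norm_num
    have e5 : 1 + d * (7 / 32) ≤ (32 / 25 : ℝ) ^ d := by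
      rw [Real.rpow_def_of_pos (by norm_num)]
      have h3 := Real.one_sub_inv_le_log_of_pos (by norm_num : (0 : ℝ) < 32 / 25)
      have h4 := Real.add_one_le_exp (Real.log (32 / 25) * d)
      norm_num at h3
      nlinarith
    rw [e4]
    have : 0 < (25 : ℝ) ^ d := by positivity
    nlinarith
  have hX : 0 ≤ A ^ (1 + 2 * d) * u * G ^ (ψ / 2) := by positivity
  calc (25 : ℝ) ^ d * A ^ (1 + 2 * d) * u * (2 * Real.log G)
      ≤ (25 : ℝ) ^ d * A ^ (1 + 2 * d) * u * (2 * ((4 + 4 * d) * G ^ (ψ / 2))) := by gcongr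
    _ = ((25 : ℝ) ^ d * (8 + 8 * d)) * (A ^ (1 + 2 * d) * u * G ^ (ψ / 2)) := by ring
    _ ≤ (140 * (32 : ℝ) ^ d) * (A ^ (1 + 2 * d) * u * G ^ (ψ / 2)) :=
        mul_le_mul_of_nonneg_right hexp hX
    _ = 7 / 5 * (100 * u * (32 : ℝ) ^ d * A ^ (1 + 2 * d) * G ^ (ψ / 2)) := by ring
    _ ≤ 7 / 5 * y := by gcongr

/-- As (8 + 2j)! ≤ 8! (8 + 2j)^{2j}, a truncation level of 8 (8 + 2j)^{2d} absorbs the factorial and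
leaves 8⁻ʲ, which is at most exp(-2A) because e² ≤ 8 and j ≥ A. -/
theorem factorial_rpow_div_le {d A : ℝ} (hd : 0 ≤ d) {j : ℕ} (hj : A ≤ j) :
    ((2 * (4 + j)).factorial : ℝ) ^ d / (8 * ((8 + 2 * j : ℕ) : ℝ) ^ (2 * d)) ^ j
      ≤ ((256 : ℝ) ^ d * Real.exp (-A)) ^ 2 := by
  set Q : ℝ := ((8 + 2 * j : ℕ) : ℝ) with hQ
  have hQ0 : 0 < Q := by rw [hQ]; positivity
  have h1 : ((2 * (4 + j)).factorial : ℝ) ≤ 256 ^ 2 * Q ^ (2 * j) := by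
    have e : 2 * (4 + j) = 8 + 2 * j := by ring
    rw [e, ← Nat.factorial_mul_ascFactorial]
    push_cast
    have h2 : (((8 + 1).ascFactorial (2 * j) : ℕ) : ℝ) ≤ Q ^ (2 * j) := by
      rw [hQ]; exact_mod_cast Nat.ascFactorial_le_pow_add 8 (2 * j)
    have h3 : ((Nat.factorial 8 : ℕ) : ℝ) ≤ 256 ^ 2 := by norm_num [Nat.factorial]
    exact mul_le_mul h3 h2 (by positivity) (by positivity)
  have h2 : ((2 * (4 + j)).factorial : ℝ) ^ d ≤ ((256 : ℝ) ^ d) ^ 2 * (Q ^ (2 * d)) ^ j := by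
    refine (Real.rpow_le_rpow (by positivity) h1 hd).trans (le_of_eq ?_)
    rw [Real.mul_rpow (by positivity) (by positivity)]
    congr 1
    · rw [← Real.rpow_natCast, ← Real.rpow_natCast, ← Real.rpow_mul (by norm_num),
        ← Real.rpow_mul (by norm_num), mul_comm]
    · rw [← Real.rpow_natCast, ← Real.rpow_natCast, ← Real.rpow_mul hQ0.le,
        ← Real.rpow_mul hQ0.le]
      congr 1
      push_cast; ring
  have h3 : Real.exp (2 * A) ≤ 8 ^ j := by
    have h4 : Real.exp 1 ≤ 2.7182818286 := Real.exp_one_lt_d9.le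
    have h5 : Real.exp 2 ≤ 8 := by
      have : Real.exp 2 = Real.exp 1 ^ 2 := by rw [← Real.exp_nat_mul]; norm_num
      rw [this]
      nlinarith [Real.exp_pos 1]
    calc Real.exp (2 * A) ≤ Real.exp (j * 2) := Real.exp_le_exp.2 (by linarith)
      _ = Real.exp 2 ^ j := Real.exp_nat_mul _ _
      _ ≤ 8 ^ j := pow_le_pow_left₀ (Real.exp_pos _).le h5 j
  rw [div_le_iff₀ (by positivity)]
  refine h2.trans ?_
  have h6 : 1 ≤ Real.exp (-A) ^ 2 * 8 ^ j := by
    calc (1 : ℝ) = Real.exp (-A) ^ 2 * Real.exp (2 * A) := by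
          rw [← Real.exp_nat_mul, ← Real.exp_add]; simp
      _ ≤ _ := by gcongr
  rw [mul_pow, mul_pow]
  have h7 : 0 ≤ ((256 : ℝ) ^ d) ^ 2 * (Q ^ (2 * d)) ^ j := by positivity
  nlinarith

section Concentration

variable {Ω : Type*} {m0 : MeasurableSpace Ω} {μ : Measure Ω} [IsProbabilityMeasure μ]

set_option maxHeartbeats 800000 in
/-- Concentration of sums of at most `n` geometrically mixing variables with Bernstein-type
moments. -/
theorem IsMixingFlow.measureReal_sum_ge_le_exp {𝓕 𝓖 : ℤ → MeasurableSpace Ω}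
    {K r Θ d A η : ℝ} (h : IsMixingFlow μ 𝓕 𝓖 K r) {Z : ℤ → Ω → ℝ}
    (hZ𝓕 : ∀ t, Measurable[𝓕 (t + 1)] (Z t)) (hZ𝓖 : ∀ t, Measurable[𝓖 t] (Z t))
    (hΘ : 0 < Θ) (hd : 1 / 2 ≤ d) (hZ : ∀ t, HasBernsteinMoments μ (Z t) Θ d)
    {I : Finset ℤ} {p : ℤ} {n : ℕ} (hI : I ⊆ Finset.Ico p (p + n))
    (hA : 10 / 3 ≤ A) (hη : 0 < η) (hηΘ : η ≤ Θ)
    (hvar : 2 * A * (16000 * (256 : ℝ) ^ d * Θ ^ 2 * mixFactor K r) ≤ n * η ^ 2)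
    (htail : 260 * (8 : ℝ) ^ d * Θ * (1 + 1 / Real.log r) * (2 * A) ^ (2 + 2 * d) ≤ n * η) :
    μ.real {ω | 500 * (n * η) ≤ ∑ t ∈ I, (Z t ω - ∫ ω, Z t ω ∂μ)} ≤ Real.exp (-A) := by
  have hlog : 0 < Real.log r := Real.log_pos h.one_lt
  have hK := h.const_pos
  have hr0 : 0 < r := by linarith [h.one_lt]
  have hA0 : 0 < A := by linarith
  set L : ℝ := 1 / Real.log r with hL
  have hL0 : 0 < L := by positivity
  set k : ℝ := 1 + Real.sqrt K with hk
  have hk1 : 1 ≤ k := by rw [hk]; linarith [Real.sqrt_nonneg K]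
  have hmf : mixFactor K r = (1 + L) * k := rfl
  have hD1 : 1 ≤ (256 : ℝ) ^ d := Real.one_le_rpow (by norm_num) (by linarith)
  set X : ℝ := Θ ^ 2 * (256 : ℝ) ^ d * mixFactor K r with hX
  have hX0 : 0 < X := by rw [hX, hmf]; positivity
  set y : ℝ := n * η with hy
  have htail0 : 0 < 260 * (8 : ℝ) ^ d * Θ * (1 + L) * (2 * A) ^ (2 + 2 * d) := by positivity
  have hy0 : 0 < y := htail0.trans_le htail
  have hn0 : 0 < (n : ℝ) := by
    rcases (Nat.cast_nonneg n : (0 : ℝ) ≤ n).eq_or_lt with h0 | h0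
    · rw [hy, ← h0, zero_mul] at hy0
      exact absurd hy0 (lt_irrefl _)
    · exact h0
  have hvarX : 32000 * (A * X) ≤ n * η ^ 2 := by
    refine le_trans (le_of_eq ?_) hvar
    rw [hX]; ring
  have hyX : n * (32000 * (A * X)) ≤ y ^ 2 := by
    have := mul_le_mul_of_nonneg_left hvarX hn0.le
    refine this.trans (le_of_eq ?_)
    rw [hy]; ring
  -- The variance condition and η ≤ Θ force the sample size to exceed the mixing time L.
  have hLn : L ≤ n := by
    have h1 : n * η ^ 2 ≤ n * Θ ^ 2 := by gcongr
    have h2 : L * Θ ^ 2 ≤ n * Θ ^ 2 := by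
      refine le_trans ?_ (hvarX.trans h1)
      have h3 : L ≤ (256 : ℝ) ^ d * ((1 + L) * k) := by
        have : 1 * (L * 1) ≤ (256 : ℝ) ^ d * ((1 + L) * k) := by gcongr; linarith
        linarith
      have h4 : L * Θ ^ 2 ≤ X := by
        rw [hX, hmf]
        calc L * Θ ^ 2 ≤ ((256 : ℝ) ^ d * ((1 + L) * k)) * Θ ^ 2 := by gcongr
          _ = _ := by ring
      have h5 : 10 / 3 * X ≤ A * X := by gcongr
      linarith
    exact le_of_mul_le_mul_right h2 (by positivity)
  set G : ℝ := (1 + n / L) * k with hG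
  have hnL : 0 ≤ n / L := by positivity
  have hG1 : 1 ≤ G := by
    exact one_le_mul_of_one_le_of_one_le (by linarith) hk1
  have htail' : 1040 * ((32 : ℝ) ^ d * Θ * (1 + L) * A ^ (2 + 2 * d)) ≤ y := by
    refine le_trans (le_of_eq ?_) htail
    have e1 : (2 * A) ^ (2 + 2 * d) = 4 * (4 : ℝ) ^ d * A ^ (2 + 2 * d) := by
      rw [Real.mul_rpow (by norm_num) hA0.le, Real.rpow_add (by norm_num),
        Real.rpow_mul (by norm_num)]
      norm_num
    have e2 : (32 : ℝ) ^ d = (8 : ℝ) ^ d * (4 : ℝ) ^ d := by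
      rw [← Real.mul_rpow (by norm_num) (by norm_num)]; norm_num
    rw [e1, e2]; ring
  -- The tail condition supplies the first lower bound for y required by the interpolation, the
  -- variance condition the second.
  have hlogG : (25 : ℝ) ^ d * A ^ (1 + 2 * d) * (Θ * L) * (2 * Real.log G) ≤ 7 / 5 * y := by
    refine rpow_mul_log_le hd hA0 (by positivity) hG1 ?_ ?_
    · refine le_trans ?_ htail'
      have h1 : 0 < (32 : ℝ) ^ d * Θ * A ^ (2 + 2 * d) := by positivity
      have h2 : 0 < (32 : ℝ) ^ d * Θ * A ^ (2 + 2 * d) * L := by positivity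
      linarith
    · refine le_of_sq_le_sq (le_trans ?_ hyX) hy0.le
      have e1 : (200 * (Θ * L) * ((16 : ℝ) ^ d * Real.sqrt G)) ^ 2
          = 40000 * (Θ ^ 2 * (256 : ℝ) ^ d * ((L ^ 2 + n * L) * k)) := by
        have : ((16 : ℝ) ^ d) ^ 2 = (256 : ℝ) ^ d := by
          rw [sq, ← Real.mul_rpow (by norm_num) (by norm_num)]; norm_num
        rw [mul_pow, mul_pow, mul_pow, mul_pow, this, Real.sq_sqrt (by linarith), hG]
        field_simp
        ring
      rw [e1]
      have h2 : (L ^ 2 + n * L) * k ≤ 2 * (n * ((1 + L) * k)) := by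
        have h5 : L * L ≤ n * L := by gcongr
        have h6 : L ^ 2 + n * L ≤ 2 * (n * (1 + L)) := by linarith
        calc _ ≤ 2 * (n * (1 + L)) * k := by gcongr
          _ = _ := by ring
      have h3 : Θ ^ 2 * (256 : ℝ) ^ d * ((L ^ 2 + n * L) * k) ≤ 2 * (n * X) := by
        calc _ ≤ Θ ^ 2 * (256 : ℝ) ^ d * (2 * (n * ((1 + L) * k))) := by gcongr
          _ = _ := by rw [hX, hmf]; ring
      have h4 : 10 / 3 * (n * X) ≤ A * (n * X) := by gcongr
      have h5 : 0 < n * X := by positivity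
      linarith
  -- Moments of order 4 + j with j ≥ A make the fourth moments of the remainders smaller by a factor
  -- exp(-2A), hence their variances by exp(-A).
  set j : ℕ := ⌈A⌉₊ with hj
  have hjA : A ≤ j := Nat.le_ceil A
  set Q : ℝ := ((8 + 2 * j : ℕ) : ℝ) ^ (2 * d) with hQ
  have hQ0 : 0 < Q := by rw [hQ]; positivity
  have hQA : Q ≤ (25 : ℝ) ^ d * A ^ (2 * d) := by
    -- Rounding gives 8 + 2j ≤ 10 + 2A, and this is at most 5A exactly when A ≥ 10/3.
    have h1 : ((8 + 2 * j : ℕ) : ℝ) ≤ 5 * A := by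
      have := Nat.ceil_lt_add_one hA0.le
      push_cast
      linarith
    refine (Real.rpow_le_rpow (by positivity) h1 (by linarith)).trans (le_of_eq ?_)
    rw [Real.mul_rpow (by norm_num) hA0.le, Real.rpow_mul (by norm_num)]
    norm_num
  have hAQ : A * Q ≤ (25 : ℝ) ^ d * A ^ (1 + 2 * d) := by
    rw [Real.rpow_add hA0, Real.rpow_one]
    calc A * Q ≤ A * ((25 : ℝ) ^ d * A ^ (2 * d)) := by gcongr
      _ = _ := by ring
  -- Blocks of length at least L g satisfy r^w ≥ exp(4A) (1 + n/L) k². As K ≤ k², the mixing errors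
  -- of all blocks together are then at most e · exp(-4A).
  set g : ℝ := 4 * A + Real.log (1 + n / L) + 2 * Real.log k with hg
  have hg1 : 1 ≤ g := by
    have h1 := Real.log_nonneg (show 1 ≤ 1 + n / L by linarith)
    have h2 := Real.log_nonneg hk1
    rw [hg]; linarith
  have hgG : g ≤ 4 * A + 2 * Real.log G := by
    have h1 := Real.log_nonneg (show 1 ≤ 1 + n / L by linarith)
    rw [hg, hG, Real.log_mul (by positivity) (by positivity)]
    linarith
  set w : ℕ := ⌈L * g⌉₊ with hw
  have hwg : L * g ≤ w := Nat.le_ceil _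
  have hw1 : 1 ≤ w := Nat.one_le_ceil_iff.2 (by positivity)
  have hwU : (w : ℝ) ≤ 4 * A * (1 + L) + L * (2 * Real.log G) := by
    have h1 := Nat.ceil_lt_add_one (show 0 ≤ L * g by positivity)
    have h2 : L * g ≤ L * (4 * A + 2 * Real.log G) := by gcongr
    linarith
  have hblock : 512 * (A * Q * Θ * w) ≤ 1500 * y := by
    have h1 : A * Q * Θ * w ≤ (25 : ℝ) ^ d * A ^ (1 + 2 * d) * Θ
        * (4 * A * (1 + L) + L * (2 * Real.log G)) := by gcongr
    have h2 : (25 : ℝ) ^ d * A ^ (1 + 2 * d) * Θ * (4 * A * (1 + L))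
        ≤ 4 * ((32 : ℝ) ^ d * Θ * (1 + L) * A ^ (2 + 2 * d)) := by
      have e : A ^ (2 + 2 * d) = A ^ (1 + 2 * d) * A := by
        rw [← Real.rpow_add_one hA0.ne']; congr 1; ring
      rw [e]
      have h3 : (25 : ℝ) ^ d ≤ (32 : ℝ) ^ d :=
        Real.rpow_le_rpow (by norm_num) (by norm_num) (by linarith)
      calc (25 : ℝ) ^ d * A ^ (1 + 2 * d) * Θ * (4 * A * (1 + L))
          ≤ (32 : ℝ) ^ d * A ^ (1 + 2 * d) * Θ * (4 * A * (1 + L)) := by gcongr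
        _ = _ := by ring
    have h4 : (25 : ℝ) ^ d * A ^ (1 + 2 * d) * Θ * (4 * A * (1 + L) + L * (2 * Real.log G))
        = (25 : ℝ) ^ d * A ^ (1 + 2 * d) * Θ * (4 * A * (1 + L))
          + (25 : ℝ) ^ d * A ^ (1 + 2 * d) * (Θ * L) * (2 * Real.log G) := by ring
    rw [h4] at h1
    linarith
  -- With this l, the linear term l · (3/8) · 500y equals 4A, the quadratic term is at most A
  -- (`b1`), and l times the bound for a block sum is at most 1 (`hblock`).
  set l : ℝ := 32 * A / (1500 * y) with hl
  have hl0 : 0 ≤ l := by rw [hl]; positivity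
  have hmain := h.measureReal_sum_ge_le_of_moments hZ𝓕 hZ𝓖 hΘ (by linarith) hZ (b := 8 * Q)
    (l := l) (s := 500 * y) (W := (256 : ℝ) ^ d * Real.exp (-A)) (j := j) hw1 hI (by positivity)
    (by positivity) (factorial_rpow_div_le (by linarith) hjA) hl0 ?_ (by positivity)
  swap
  · rw [hl, div_mul_eq_mul_div, div_le_one (by positivity)]
    refine le_trans (le_of_eq ?_) hblock
    ring
  refine hmain.trans ?_
  have b1 : l ^ 2 * (n * (32 * (Θ ^ 2 * (256 : ℝ) ^ d) * mixFactor K r)) ≤ A := by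
    have e : l ^ 2 * (n * (32 * (Θ ^ 2 * (256 : ℝ) ^ d) * mixFactor K r))
        = (1024 * A ^ 2 * (32 * (n * X))) / (2250000 * y ^ 2) := by
      rw [hl, hX, div_pow, div_mul_eq_mul_div]
      congr 1 <;> ring
    rw [e, div_le_iff₀ (by positivity)]
    have h2 : A * (n * (32000 * (A * X))) ≤ A * y ^ 2 := by gcongr
    have h3 : 0 < A ^ 2 * (n * X) := by positivity
    linarith
  have b2 : l * (3 / 8 * (500 * y)) = 4 * A := by
    rw [hl]; field_simp; ring
  have b3 : Real.exp 1 * (n / w + 1) * (K * (r ^ w)⁻¹) ≤ Real.exp 1 * Real.exp (-(4 * A)) := by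
    rw [mul_assoc]
    refine mul_le_mul_of_nonneg_left ?_ (Real.exp_pos 1).le
    have h1 : g ≤ w * Real.log r := by
      have : L * g * Real.log r ≤ w * Real.log r := by gcongr
      refine le_trans (le_of_eq ?_) this
      rw [hL]; field_simp
    have h2 : Real.exp (4 * A) * (1 + n / L) * k ^ 2 ≤ r ^ w := by
      have e1 : r ^ w = Real.exp (w * Real.log r) := by
        rw [Real.exp_nat_mul, Real.exp_log hr0]
      rw [e1]
      refine le_trans (le_of_eq ?_) (Real.exp_le_exp.2 h1)
      have e2 : (2 : ℝ) * Real.log k = Real.log (k ^ 2) := by rw [Real.log_pow]; norm_num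
      rw [hg, e2, Real.exp_add, Real.exp_add, Real.exp_log (by positivity),
        Real.exp_log (by positivity)]
    have h3 : (n : ℝ) / w + 1 ≤ 1 + n / L := by
      have : (n : ℝ) / w ≤ n / L := by
        refine div_le_div_of_nonneg_left hn0.le hL0 (le_trans ?_ hwg)
        exact le_mul_of_one_le_right hL0.le hg1
      linarith
    have h4 : K ≤ k ^ 2 := by
      rw [hk, add_sq, Real.sq_sqrt hK.le]; linarith [Real.sqrt_nonneg K]
    rw [Real.exp_neg, ← mul_assoc, ← div_eq_mul_inv, div_le_iff₀ (by positivity),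
      inv_mul_eq_div, le_div_iff₀ (Real.exp_pos _)]
    refine le_trans ?_ h2
    calc (n / w + 1) * K * Real.exp (4 * A) ≤ (1 + n / L) * k ^ 2 * Real.exp (4 * A) := by gcongr
      _ = _ := by ring
  have b4 : n * (32 * (Θ ^ 2 * ((256 : ℝ) ^ d * Real.exp (-A))) * mixFactor K r)
      / (500 * y / 4) ^ 2 ≤ Real.exp (-A) / 4 := by
    have e : n * (32 * (Θ ^ 2 * ((256 : ℝ) ^ d * Real.exp (-A))) * mixFactor K r)
        = 32 * (n * X) * Real.exp (-A) := by rw [hX]; ring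
    rw [e, div_le_iff₀ (by positivity)]
    have h1 : 0 < n * X := by positivity
    have h4 : 10 / 3 * (n * X) ≤ A * (n * X) := by gcongr
    have h2 : 128 * (n * X) ≤ 15625 * y ^ 2 := by linarith
    have h3 := mul_le_mul_of_nonneg_right h2 (Real.exp_pos (-A)).le
    linarith
  -- For A ≥ 10/3 one has exp(2A) ≥ 4(1 + e). The two parities and the Chebyshev term then each
  -- contribute at most exp(-A)/4.
  have b5 : Real.exp A * (Real.exp (-(4 * A)) + Real.exp 1 * Real.exp (-(4 * A)))
      ≤ Real.exp (-A) / 4 := by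
    have e : Real.exp A * (Real.exp (-(4 * A)) + Real.exp 1 * Real.exp (-(4 * A)))
        = (1 + Real.exp 1) * Real.exp (-A) / Real.exp (2 * A) := by
      rw [eq_div_iff (Real.exp_pos _).ne']
      have : Real.exp A * Real.exp (-(4 * A)) * Real.exp (2 * A) = Real.exp (-A) := by
        rw [← Real.exp_add, ← Real.exp_add]; ring_nf
      calc _ = (1 + Real.exp 1) * (Real.exp A * Real.exp (-(4 * A)) * Real.exp (2 * A)) := by ring
        _ = _ := by rw [this]
    rw [e, div_le_iff₀ (Real.exp_pos _)]
    have h1 := Real.quadratic_le_exp_of_nonneg (show 0 ≤ 2 * A by linarith)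
    have h2 : Real.exp 1 ≤ 2.7182818286 := Real.exp_one_lt_d9.le
    have h4 : (10 / 3) ^ 2 ≤ A ^ 2 := by gcongr
    have h3 : 4 * (1 + Real.exp 1) ≤ Real.exp (2 * A) := by linarith
    have := mul_le_mul_of_nonneg_right h3 (Real.exp_pos (-A)).le
    linarith
  have b6 := Real.exp_le_exp.2 b1
  have b7 : Real.exp (l ^ 2 * (n * (32 * (Θ ^ 2 * (256 : ℝ) ^ d) * mixFactor K r)))
        * (Real.exp (-(l * (3 / 8 * (500 * y)))) + Real.exp 1 * (n / w + 1) * (K * (r ^ w)⁻¹))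
      ≤ Real.exp (-A) / 4 := by
    rw [b2]
    refine le_trans ?_ b5
    gcongr
  have := Real.exp_pos (-A)
  linarith

end Concentration

/-! ### Local covariances -/

section Spectral

variable {f : ℝ → ℝ → ℝ}

theorem LocStat.IsLocalSpectralDensity.intervalIntegrable (h : IsLocalSpectralDensity f) (u a b : ℝ) :
    IntervalIntegrable (f u) volume a b :=
  ⟨((h.locallyIntegrable u).integrableOn_isCompact isCompact_Icc).mono_set Set.Ioc_subset_Icc_self,
    ((h.locallyIntegrable u).integrableOn_isCompact isCompact_Icc).mono_set Set.Ioc_subset_Icc_self⟩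

theorem LocStat.IsLocalSpectralDensity.localCov_eq (h : IsLocalSpectralDensity f) (k : ℤ) (u : ℝ) :
    localCov f k u = ∫ l in (-Real.pi)..Real.pi, Real.cos (k * l) * f u l := by
  have hi : IntervalIntegrable
      (fun l : ℝ => Complex.exp (Complex.I * (k : ℂ) * (l : ℂ)) * ((f u l : ℝ) : ℂ)) volume
      (-Real.pi) Real.pi := by
    have h1 : IntervalIntegrable (fun l : ℝ => ((f u l : ℝ) : ℂ)) volume (-Real.pi) Real.pi :=
      ⟨(h.intervalIntegrable u _ _).1.ofReal, (h.intervalIntegrable u _ _).2.ofReal⟩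
    exact h1.continuousOn_mul (by fun_prop)
  unfold localCov localCovC
  have := Complex.reCLM.intervalIntegral_comp_comm hi
  simp only [Complex.reCLM_apply] at this
  rw [← this]
  congr 1
  ext l
  have e : Complex.I * (k : ℂ) * (l : ℂ) = ((k * l : ℝ) : ℂ) * Complex.I := by push_cast; ring
  rw [Complex.re_mul_ofReal, e, Complex.exp_ofReal_mul_I_re]

theorem LocStat.IsLocalSpectralDensity.localCov_zero (h : IsLocalSpectralDensity f) (u : ℝ) :
    localCov f 0 u = ∫ l in (-Real.pi)..Real.pi, f u l := by
  rw [h.localCov_eq]; simp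

theorem LocStat.IsLocalSpectralDensity.intervalIntegrable_cos_mul (h : IsLocalSpectralDensity f)
    (k : ℤ) (u a b : ℝ) : IntervalIntegrable (fun l => Real.cos (k * l) * f u l) volume a b :=
  (h.intervalIntegrable u a b).continuousOn_mul (by fun_prop)

theorem LocStat.IsLocalSpectralDensity.abs_localCov_le (h : IsLocalSpectralDensity f) (k : ℤ)
    (u : ℝ) : |localCov f k u| ≤ localCov f 0 u := by
  have hpi : -Real.pi ≤ Real.pi := by linarith [Real.pi_pos]
  rw [h.localCov_eq, h.localCov_zero]
  refine (intervalIntegral.abs_integral_le_integral_abs hpi).trans ?_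
  refine intervalIntegral.integral_mono_on hpi (h.intervalIntegrable_cos_mul k u _ _).abs
    (h.intervalIntegrable u _ _) fun l _ => ?_
  rw [abs_mul, abs_of_nonneg (h.nonneg u l)]
  exact mul_le_of_le_one_left (h.nonneg u l) (Real.abs_cos_le_one _)

theorem LocStat.IsLocalSpectralDensity.le_localCov_zero (h : IsLocalSpectralDensity f) {mf Mf : ℝ}
    (hb : SpectralBounds f mf Mf) (u : ℝ) : 2 * Real.pi * mf ≤ localCov f 0 u := by
  have hpi : -Real.pi ≤ Real.pi := by linarith [Real.pi_pos]
  rw [h.localCov_zero]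
  calc 2 * Real.pi * mf = ∫ _ in (-Real.pi)..Real.pi, mf := by
        rw [intervalIntegral.integral_const, smul_eq_mul]; ring
    _ ≤ _ := intervalIntegral.integral_mono_on hpi intervalIntegrable_const
        (h.intervalIntegrable u _ _) fun l _ => by
          have := (hb.2 u l).1
          rwa [abs_of_nonneg (h.nonneg u l)] at this

theorem LocStat.IsLocalSpectralDensity.localCov_zero_le (h : IsLocalSpectralDensity f) {mf Mf : ℝ}
    (hb : SpectralBounds f mf Mf) (u : ℝ) : localCov f 0 u ≤ 2 * Real.pi * Mf := by
  have hpi : -Real.pi ≤ Real.pi := by linarith [Real.pi_pos]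
  rw [h.localCov_zero]
  calc _ ≤ ∫ _ in (-Real.pi)..Real.pi, Mf := intervalIntegral.integral_mono_on hpi
        (h.intervalIntegrable u _ _) intervalIntegrable_const fun l _ => by
          have := (hb.2 u l).2
          rwa [abs_of_nonneg (h.nonneg u l)] at this
    _ = _ := by rw [intervalIntegral.integral_const, smul_eq_mul]; ring

theorem LocStat.SpectralDerivBound.abs_sub_le {Mf' : ℝ} (hd : SpectralDerivBound f Mf') (l u v : ℝ) :
    |f u l - f v l| ≤ Mf' * |u - v| := by
  have h1 : Differentiable ℝ fun u => f u l := (hd.2 l).1.differentiable (by norm_num)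
  have := Convex.norm_image_sub_le_of_norm_deriv_le (f := fun u => f u l) (C := Mf') (s := Set.univ)
    (x := v) (y := u) (fun x _ => h1 x) (fun x _ => (hd.2 l).2 x) convex_univ trivial trivial
  simpa using this

theorem LocStat.IsLocalSpectralDensity.abs_localCov_sub_le (h : IsLocalSpectralDensity f) {Mf' : ℝ}
    (hd : SpectralDerivBound f Mf') (k : ℤ) (u v : ℝ) :
    |localCov f k u - localCov f k v| ≤ 2 * Real.pi * Mf' * |u - v| := by
  have hpi : -Real.pi ≤ Real.pi := by linarith [Real.pi_pos]
  rw [h.localCov_eq, h.localCov_eq, ← intervalIntegral.integral_sub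
    (h.intervalIntegrable_cos_mul k u _ _) (h.intervalIntegrable_cos_mul k v _ _)]
  have := intervalIntegral.norm_integral_le_of_norm_le_const (a := -Real.pi) (b := Real.pi)
    (C := Mf' * |u - v|) (f := fun l => Real.cos (k * l) * f u l - Real.cos (k * l) * f v l)
    fun l _ => by
      rw [← mul_sub, Real.norm_eq_abs, abs_mul]
      exact (mul_le_of_le_one_left (abs_nonneg _) (Real.abs_cos_le_one _)).trans
        (hd.abs_sub_le l u v)
  rw [Real.norm_eq_abs] at this
  refine this.trans (le_of_eq ?_)
  rw [sub_neg_eq_add, abs_of_pos (show 0 < Real.pi + Real.pi by linarith [Real.pi_pos])]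
  ring

theorem LocStat.IsLocalSpectralDensity.continuous_localCov (h : IsLocalSpectralDensity f) {Mf' : ℝ}
    (hd : SpectralDerivBound f Mf') (k : ℤ) : Continuous (localCov f k) := by
  have hK : 0 ≤ 2 * Real.pi * Mf' := by have := hd.1; positivity
  have : LipschitzWith ⟨2 * Real.pi * Mf', hK⟩ (localCov f k) :=
    LipschitzWith.of_dist_le_mul fun u v => by
      rw [Real.dist_eq, Real.dist_eq]
      exact h.abs_localCov_sub_le hd k u v
  exact this.continuous

theorem LocStat.IsLocalSpectralDensity.intervalIntegrable_localCov (h : IsLocalSpectralDensity f)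
    {Mf' : ℝ} (hd : SpectralDerivBound f Mf') (k : ℤ) (D u : ℝ) :
    IntervalIntegrable (fun x => localCov f k (u + D * (x - 1))) volume 0 1 :=
  ((h.continuous_localCov hd k).comp (by fun_prop)).intervalIntegrable _ _

theorem LocStat.IsLocalSpectralDensity.abs_avgCov_le (h : IsLocalSpectralDensity f) {Mf' : ℝ}
    (hd : SpectralDerivBound f Mf') (k : ℤ) (D u : ℝ) : |avgCov f k D u| ≤ avgCov f 0 D u := by
  unfold avgCov
  refine (intervalIntegral.abs_integral_le_integral_abs zero_le_one).trans ?_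
  exact intervalIntegral.integral_mono_on zero_le_one (h.intervalIntegrable_localCov hd k D u).abs
    (h.intervalIntegrable_localCov hd 0 D u) fun x _ => h.abs_localCov_le k _

theorem LocStat.IsLocalSpectralDensity.le_avgCov_zero (h : IsLocalSpectralDensity f) {mf Mf Mf' : ℝ}
    (hb : SpectralBounds f mf Mf) (hd : SpectralDerivBound f Mf') (D u : ℝ) :
    2 * Real.pi * mf ≤ avgCov f 0 D u := by
  unfold avgCov
  calc 2 * Real.pi * mf = ∫ _ in (0 : ℝ)..1, 2 * Real.pi * mf := by
        rw [intervalIntegral.integral_const, smul_eq_mul]; ring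
    _ ≤ _ := intervalIntegral.integral_mono_on zero_le_one intervalIntegrable_const
        (h.intervalIntegrable_localCov hd 0 D u) fun x _ => h.le_localCov_zero hb _

theorem abs_div_le_one_of_abs_le {a b : ℝ} (h : |a| ≤ b) : |a / b| ≤ 1 := by
  have hb : 0 ≤ b := (abs_nonneg a).trans h
  rw [abs_div, abs_of_nonneg hb]
  exact div_le_one_of_le₀ h hb

/-- A real supremum bounds its terms only if the family is bounded above; here |γ₁| ≤ γ₀ provides
the bound 1. -/
theorem LocStat.IsLocalSpectralDensity.abs_le_rhoSup (h : IsLocalSpectralDensity f) {T m : ℕ} {u : ℝ}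
    (hu : u ∈ validationTimes T m) : |localCov f 1 u / localCov f 0 u| ≤ rhoSup f T m :=
  le_ciSup (f := fun u : validationTimes T m => |localCov f 1 u / localCov f 0 u|)
    ⟨1, by rintro _ ⟨v, rfl⟩; exact abs_div_le_one_of_abs_le (h.abs_localCov_le 1 _)⟩ ⟨u, hu⟩

theorem rhoSup_nonneg (f : ℝ → ℝ → ℝ) (T m : ℕ) : 0 ≤ rhoSup f T m :=
  Real.iSup_nonneg fun _ => abs_nonneg _

theorem DSup_nonneg (f : ℝ → ℝ → ℝ) (T m : ℕ) : 0 ≤ DSup f T m :=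
  Real.iSup_nonneg fun _ => abs_nonneg _

theorem LocStat.IsLocalSpectralDensity.abs_avg_sub_le_two (h : IsLocalSpectralDensity f) {Mf' : ℝ}
    (hd : SpectralDerivBound f Mf') (D u : ℝ) :
    |avgCov f 1 D u / avgCov f 0 D u - localCov f 1 u / localCov f 0 u| ≤ 2 := by
  have h1 := abs_div_le_one_of_abs_le (h.abs_avgCov_le hd 1 D u)
  have h2 := abs_div_le_one_of_abs_le (h.abs_localCov_le 1 u)
  exact (abs_sub _ _).trans (by linarith)

theorem LocStat.IsLocalSpectralDensity.abs_le_DSup (h : IsLocalSpectralDensity f) {Mf' : ℝ}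
    (hd : SpectralDerivBound f Mf') {T m : ℕ} {u : ℝ} (hu : u ∈ validationTimes T m) :
    |avgCov f 1 (((T : ℝ) - (m : ℝ)) / (T : ℝ)) u / avgCov f 0 (((T : ℝ) - (m : ℝ)) / (T : ℝ)) u
      - localCov f 1 u / localCov f 0 u| ≤ DSup f T m :=
  le_ciSup (f := fun u : validationTimes T m =>
    |avgCov f 1 (((T : ℝ) - (m : ℝ)) / (T : ℝ)) u / avgCov f 0 (((T : ℝ) - (m : ℝ)) / (T : ℝ)) u
      - localCov f 1 u / localCov f 0 u|)
    ⟨2, by rintro _ ⟨v, rfl⟩; exact h.abs_avg_sub_le_two hd _ _⟩ ⟨u, hu⟩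

theorem LocStat.IsLocalSpectralDensity.DSup_le_two (h : IsLocalSpectralDensity f) {Mf' : ℝ}
    (hd : SpectralDerivBound f Mf') (T m : ℕ) : DSup f T m ≤ 2 :=
  Real.iSup_le (fun _ => h.abs_avg_sub_le_two hd _ _) (by norm_num)

end Spectral

/-! ### Concentration of weighted sums of products -/

section Products

variable {Ω : Type*} {m0 : MeasurableSpace Ω} {μ : Measure Ω} [IsProbabilityMeasure μ]
  {X : ℕ → ℤ → Ω → ℝ}

theorem measurable_sigmaOf {T : ℕ} {S : Set ℤ} {s : ℤ} (hs : s ∈ S) :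
    Measurable[sigmaOf X T S] (X T s) := by
  have h1 : MeasurableSpace.comap (X T s) inferInstance ≤ sigmaOf X T S :=
    le_iSup₂_of_le s hs le_rfl
  exact (comap_measurable (X T s)).mono h1 le_rfl

theorem LocStat.IsGeometricallyMixing.isMixingFlow {K r : ℝ} (h : IsGeometricallyMixing μ X K r)
    {T : ℕ} (hT : 1 ≤ T) (hX : ∀ t, Measurable (X T t)) :
    IsMixingFlow μ (fun t => sigmaOf X T (Set.Iic t)) (fun t => sigmaOf X T (Set.Ici t)) K r where
  past_le t := iSup₂_le fun s _ => (hX s).comap_le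
  future_le t := iSup₂_le fun s _ => (hX s).comap_le
  past_mono s t hst := iSup₂_le fun u hu => le_iSup₂_of_le u (le_trans hu hst) le_rfl
  future_anti s t hst := iSup₂_le fun u hu => le_iSup₂_of_le u (le_trans hst hu) le_rfl
  const_pos := h.1
  one_lt := h.2.1
  mixing t n hn A B hA hB := by
    refine le_trans ?_ (h.2.2 n hn)
    unfold alphaMixing
    refine le_csSup ⟨1, ?_⟩ ⟨T, t, A, B, hT, hA, hB, rfl⟩
    rintro _ ⟨_, _, A, B, _, _, _, rfl⟩
    have h1 : μ.real (A ∩ B) ≤ 1 := measureReal_le_one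
    have h2 : μ.real A ≤ 1 := measureReal_le_one
    have h3 : μ.real B ≤ 1 := measureReal_le_one
    have h4 : 0 ≤ μ.real (A ∩ B) := measureReal_nonneg
    have h5 : 0 ≤ μ.real A := measureReal_nonneg
    have h6 : 0 ≤ μ.real B := measureReal_nonneg
    have h7 : μ.real A * μ.real B ≤ 1 := mul_le_one₀ h2 h6 h3
    have h8 : 0 ≤ μ.real A * μ.real B := mul_nonneg h5 h6
    exact abs_le.2 ⟨by linarith, by linarith⟩

theorem abs_mul_pow_le (a b : ℝ) (q : ℕ) :
    |a * b| ^ q ≤ (|a| ^ (2 * q) + |b| ^ (2 * q)) / 2 := by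
  rw [abs_mul, mul_pow, mul_comm 2 q, pow_mul, pow_mul]
  nlinarith [sq_nonneg (|a| ^ q - |b| ^ q)]

theorem hasBernsteinMoments_zero {Θ d : ℝ} (hΘ : 0 ≤ Θ) :
    HasBernsteinMoments μ (fun _ => (0 : ℝ)) Θ d := by
  intro q hq
  have : q ≠ 0 := by omega
  simp only [abs_zero, zero_pow this, integral_zero]
  exact ⟨integrable_zero _ _ _, by positivity⟩

/-- |YW|^q is at most the mean of Y^{2q} and W^{2q}. The Bernstein condition of order 2q then gives
c^{2q-2} times a variance, which is at most Θ^{q-1} Θ. -/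
theorem hasBernsteinMoments_mul {Y W : Ω → ℝ} {c d Θ w : ℝ} (hc : c ^ 2 ≤ Θ) (hw : |w| ≤ 1)
    (hY : Measurable Y) (hW : Measurable W)
    (hYm : ∀ k : ℕ, 2 ≤ k → Integrable (fun ω => |Y ω| ^ k) μ ∧
      ∫ ω, |Y ω| ^ k ∂μ ≤ c ^ (k - 2) * ((k.factorial : ℝ) ^ d) * variance Y μ)
    (hWm : ∀ k : ℕ, 2 ≤ k → Integrable (fun ω => |W ω| ^ k) μ ∧
      ∫ ω, |W ω| ^ k ∂μ ≤ c ^ (k - 2) * ((k.factorial : ℝ) ^ d) * variance W μ)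
    (hYv : variance Y μ ≤ Θ) (hWv : variance W μ ≤ Θ) :
    HasBernsteinMoments μ (fun ω => w * (Y ω * W ω)) Θ d := by
  intro q hq
  have h1 := hYm (2 * q) (by omega)
  have h2 := hWm (2 * q) (by omega)
  have hle : ∀ ω, |w * (Y ω * W ω)| ^ q ≤ (|Y ω| ^ (2 * q) + |W ω| ^ (2 * q)) / 2 := fun ω => by
    refine le_trans (pow_le_pow_left₀ (abs_nonneg _) ?_ q) (abs_mul_pow_le _ _ q)
    rw [abs_mul]
    exact mul_le_of_le_one_left (abs_nonneg _) hw
  have hdom : Integrable (fun ω => (|Y ω| ^ (2 * q) + |W ω| ^ (2 * q)) / 2) μ :=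
    (h1.1.add h2.1).div_const 2
  have hint : Integrable (fun ω => |w * (Y ω * W ω)| ^ q) μ := by
    refine hdom.mono' ?_ (Filter.Eventually.of_forall fun ω => ?_)
    · exact (((hY.mul hW).const_mul w).abs.pow_const q).aestronglyMeasurable
    · rw [Real.norm_eq_abs, abs_of_nonneg (by positivity)]
      exact hle ω
  refine ⟨hint, (integral_mono hint hdom hle).trans ?_⟩
  rw [integral_div, integral_add h1.1 h2.1]
  have hΘ0 : 0 ≤ Θ := (sq_nonneg c).trans hc
  have key : ∀ v : ℝ, v ≤ Θ → c ^ (2 * q - 2) * (((2 * q).factorial : ℝ) ^ d) * v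
      ≤ Θ ^ q * ((2 * q).factorial : ℝ) ^ d := by
    intro v hv
    have e : c ^ (2 * q - 2) = (c ^ 2) ^ (q - 1) := by
      rw [← pow_mul]; congr 1; omega
    have e2 : Θ ^ q = Θ ^ (q - 1) * Θ := by
      rw [← pow_succ]; congr 1; omega
    have h3 : 0 ≤ (c ^ 2) ^ (q - 1) * ((2 * q).factorial : ℝ) ^ d := by positivity
    rw [e, e2]
    calc _ ≤ (c ^ 2) ^ (q - 1) * ((2 * q).factorial : ℝ) ^ d * Θ := by gcongr
      _ ≤ Θ ^ (q - 1) * ((2 * q).factorial : ℝ) ^ d * Θ := by gcongr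
      _ = _ := by ring
  linarith [h1.2.trans (key _ hYv), h2.2.trans (key _ hWv)]

/-- Two-sided concentration of weighted sums of products `X t * X (t + k)`, `k = 0, 1`. -/
theorem measureReal_abs_sum_mul_ge_le {K r c d Θ A η : ℝ} {T m : ℕ} (hT : 1 ≤ T)
    (hX : ∀ t, Measurable (X T t)) (hmix : IsGeometricallyMixing μ X K r)
    (hmom : BernsteinCondition μ X m c d) (hΘ : 0 < Θ) (hc : c ^ 2 ≤ Θ)
    (hσ : ∀ t : ℤ, 1 ≤ t → t ≤ (T : ℤ) + m → variance (X T t) μ ≤ Θ)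
    {I : Finset ℤ} {p k : ℤ} {n : ℕ} (hI : I ⊆ Finset.Ico p (p + n))
    (hk0 : 0 ≤ k) (hk1 : k ≤ 1) (hI1 : ∀ t ∈ I, 1 ≤ t ∧ t + k ≤ (T : ℤ) + m)
    {w : ℤ → ℝ} (hw : ∀ t ∈ I, |w t| ≤ 1)
    (hA : 10 / 3 ≤ A) (hη : 0 < η) (hηΘ : η ≤ Θ)
    (hvar : 2 * A * (16000 * (256 : ℝ) ^ d * Θ ^ 2 * mixFactor K r) ≤ n * η ^ 2)
    (htail : 260 * (8 : ℝ) ^ d * Θ * (1 + 1 / Real.log r) * (2 * A) ^ (2 + 2 * d) ≤ n * η) :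
    μ.real {ω | 500 * (n * η) ≤
      |∑ t ∈ I, w t * (X T t ω * X T (t + k) ω - ∫ ω, X T t ω * X T (t + k) ω ∂μ)|}
      ≤ 2 * Real.exp (-A) := by
  have hflow := hmix.isMixingFlow hT hX
  have hd := hmom.2.1
  have one_sided : ∀ v : ℤ → ℝ, (∀ t ∈ I, |v t| ≤ 1) →
      μ.real {ω | 500 * (n * η) ≤
        ∑ t ∈ I, v t * (X T t ω * X T (t + k) ω - ∫ ω, X T t ω * X T (t + k) ω ∂μ)}
        ≤ Real.exp (-A) := by
    intro v hv
    -- The moment condition is available only for 1 ≤ t ≤ T + m, while the concentration inequality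
    -- asks for it at all t. Zero weights outside I reconcile the two.
    set v' : ℤ → ℝ := fun t => if t ∈ I then v t else 0 with hv'
    have hm1 : ∀ t, Measurable[sigmaOf X T (Set.Iic (t + 1))]
        fun ω => v' t * (X T t ω * X T (t + k) ω) := fun t =>
      ((measurable_sigmaOf (by simp)).mul
        (measurable_sigmaOf (by simp only [Set.mem_Iic]; omega))).const_mul _
    have hm2 : ∀ t, Measurable[sigmaOf X T (Set.Ici t)]
        fun ω => v' t * (X T t ω * X T (t + k) ω) := fun t =>
      ((measurable_sigmaOf (by simp)).mul
        (measurable_sigmaOf (by simp only [Set.mem_Ici]; omega))).const_mul _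
    have hZ : ∀ t, HasBernsteinMoments μ (fun ω => v' t * (X T t ω * X T (t + k) ω)) Θ d := by
      intro t
      by_cases ht : t ∈ I
      · have h1 := hI1 t ht
        simp only [hv', if_pos ht]
        exact hasBernsteinMoments_mul hc (hv t ht) (hX _) (hX _)
          (fun q hq => hmom.2.2 T hT t h1.1 (by omega) q hq)
          (fun q hq => hmom.2.2 T hT (t + k) (by omega) h1.2 q hq)
          (hσ t h1.1 (by omega)) (hσ (t + k) (by omega) h1.2)
      · simp only [hv', if_neg ht, zero_mul]
        exact hasBernsteinMoments_zero hΘ.le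
    have := hflow.measureReal_sum_ge_le_exp hm1 hm2 hΘ hd hZ hI hA hη hηΘ hvar htail
    refine le_trans (le_of_eq ?_) this
    congr 1
    ext ω
    simp only [Set.mem_ofPred_eq]
    have e : ∀ t ∈ I, v t * (X T t ω * X T (t + k) ω - ∫ ω, X T t ω * X T (t + k) ω ∂μ)
        = v' t * (X T t ω * X T (t + k) ω) - ∫ ω, v' t * (X T t ω * X T (t + k) ω) ∂μ := by
      intro t ht
      rw [integral_const_mul]
      simp only [hv', if_pos ht]
      ring
    rw [Finset.sum_congr rfl e]
  have h1 := one_sided w hw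
  have h2 := one_sided (fun t => -w t) fun t ht => by rw [abs_neg]; exact hw t ht
  have hsub : {ω | 500 * (n * η) ≤
      |∑ t ∈ I, w t * (X T t ω * X T (t + k) ω - ∫ ω, X T t ω * X T (t + k) ω ∂μ)|} ⊆
      {ω | 500 * (n * η) ≤
        ∑ t ∈ I, w t * (X T t ω * X T (t + k) ω - ∫ ω, X T t ω * X T (t + k) ω ∂μ)} ∪
      {ω | 500 * (n * η) ≤
        ∑ t ∈ I, -w t * (X T t ω * X T (t + k) ω - ∫ ω, X T t ω * X T (t + k) ω ∂μ)} := by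
    intro ω hω
    simp only [Set.mem_union, Set.mem_ofPred_eq, neg_mul, Finset.sum_neg_distrib] at hω ⊢
    exact le_abs.1 hω
  calc _ ≤ _ := measureReal_mono hsub
    _ ≤ _ := measureReal_union_le _ _
    _ ≤ _ := add_le_add h1 h2
    _ = _ := by ring

end Products

/-! ### Forecasts of order one and their prediction errors, for a fixed path -/

/-- The ratio of the averages of `e₁` (over `N - 1` times) and `e₀` (over `N` times) that defines
the Yule-Walker estimator of order one. -/
noncomputable def arRatio (e₀ e₁ : ℤ → ℝ) (N t : ℤ) : ℝ :=
  ((1 / ((N : ℝ) - 1)) * ∑ l ∈ Finset.Ico (t - N + 1) t, e₁ l) /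
    ((1 / (N : ℝ)) * ∑ l ∈ Finset.Ico (t - N + 1) (t + 1), e₀ l)

theorem acvHat_zero (x : ℤ → ℝ) (N t : ℤ) :
    acvHat x 0 N t = (1 / (N : ℝ)) * ∑ l ∈ Finset.Ico (t - N + 1) (t + 1), x l * x l := by
  unfold acvHat
  simp only [abs_zero, sub_zero, Int.cast_zero, add_zero]
  congr 1

theorem acvHat_one (x : ℤ → ℝ) (N t : ℤ) :
    acvHat x 1 N t = (1 / ((N : ℝ) - 1)) * ∑ l ∈ Finset.Ico (t - N + 1) t, x l * x (l + 1) := by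
  unfold acvHat
  simp only [abs_one, Int.cast_one]
  congr 1
  refine Finset.sum_nbij' (fun l => l - 1) (fun l => l + 1) ?_ ?_ ?_ ?_ ?_
  · intro l hl
    simp only [Finset.mem_Icc, Finset.mem_Ico] at hl ⊢
    omega
  · intro l hl
    simp only [Finset.mem_Icc, Finset.mem_Ico] at hl ⊢
    omega
  · intro l _; ring
  · intro l _; ring
  · intro l _; simp

/-- For order one the Yule-Walker matrix is 1×1. The identity also holds when its entry is zero,
since the matrix inverse and the quotient both become 0. -/
theorem forecast_one_eq (x : ℤ → ℝ) (N t : ℤ) :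
    forecast 1 x N t = arRatio (fun l => x l * x l) (fun l => x l * x (l + 1)) N t * x t := by
  unfold forecast ywHat arRatio
  rw [← acvHat_zero, ← acvHat_one]
  have e : (Matrix.of fun i j : Fin 1 => acvHat x ((i : ℤ) - (j : ℤ)) N t)⁻¹
      = Matrix.of fun _ _ : Fin 1 => (acvHat x 0 N t)⁻¹ := by
    rw [Matrix.inv_def, Matrix.det_fin_one, Matrix.adjugate_fin_one]
    ext i j
    fin_cases i; fin_cases j
    simp
  rw [e]
  simp only [Matrix.mulVec, dotProduct, Finset.univ_unique, Finset.sum_singleton, Matrix.of_apply,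
    Fin.default_eq_zero, Fin.val_zero, Nat.cast_zero, zero_add, sub_zero]
  rw [inv_mul_eq_div]

/-- Each e₀ l is met at most twice, each time with weight one half. -/
theorem abs_sum_Ico_le {e₀ e₁ : ℤ → ℝ} (h0 : ∀ l, 0 ≤ e₀ l)
    (h1 : ∀ l, |e₁ l| ≤ (e₀ l + e₀ (l + 1)) / 2) (a b : ℤ) :
    |∑ l ∈ Finset.Ico a b, e₁ l| ≤ ∑ l ∈ Finset.Ico a (b + 1), e₀ l := by
  have s1 : ∑ l ∈ Finset.Ico a b, e₀ l ≤ ∑ l ∈ Finset.Ico a (b + 1), e₀ l :=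
    Finset.sum_le_sum_of_subset_of_nonneg (Finset.Ico_subset_Ico_right (by omega))
      fun _ _ _ => h0 _
  have s2 : ∑ l ∈ Finset.Ico a b, e₀ (l + 1) ≤ ∑ l ∈ Finset.Ico a (b + 1), e₀ l := by
    rw [← Finset.sum_image (f := e₀) (g := fun l => l + 1)
      (fun _ _ _ _ h => by simpa using h)]
    refine Finset.sum_le_sum_of_subset_of_nonneg (fun l hl => ?_) fun _ _ _ => h0 _
    obtain ⟨k, hk, rfl⟩ := Finset.mem_image.1 hl
    simp only [Finset.mem_Ico] at hk ⊢
    omega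
  calc |∑ l ∈ Finset.Ico a b, e₁ l| ≤ ∑ l ∈ Finset.Ico a b, |e₁ l| :=
        Finset.abs_sum_le_sum_abs _ _
    _ ≤ ∑ l ∈ Finset.Ico a b, (e₀ l + e₀ (l + 1)) / 2 := Finset.sum_le_sum fun l _ => h1 l
    _ = (∑ l ∈ Finset.Ico a b, e₀ l + ∑ l ∈ Finset.Ico a b, e₀ (l + 1)) / 2 := by
        rw [← Finset.sum_div, Finset.sum_add_distrib]
    _ ≤ _ := by linarith

theorem abs_numerator_le {e₀ e₁ : ℤ → ℝ} (h0 : ∀ l, 0 ≤ e₀ l)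
    (h1 : ∀ l, |e₁ l| ≤ (e₀ l + e₀ (l + 1)) / 2) {N : ℤ} (hN : 2 ≤ N) (t : ℤ) :
    |(1 / ((N : ℝ) - 1)) * ∑ l ∈ Finset.Ico (t - N + 1) t, e₁ l|
      ≤ 2 * ((1 / (N : ℝ)) * ∑ l ∈ Finset.Ico (t - N + 1) (t + 1), e₀ l) := by
  have hN' : (2 : ℝ) ≤ N := by exact_mod_cast hN
  have hN1 : 0 < (N : ℝ) - 1 := by linarith
  have hs := abs_sum_Ico_le h0 h1 (t - N + 1) t
  have hs0 : 0 ≤ ∑ l ∈ Finset.Ico (t - N + 1) (t + 1), e₀ l := Finset.sum_nonneg fun l _ => h0 l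
  rw [abs_mul, abs_of_pos (by positivity), ← mul_assoc]
  refine mul_le_mul ?_ hs (abs_nonneg _) (by positivity)
  rw [mul_one_div, div_le_div_iff₀ hN1 (by linarith)]
  linarith

/-- The 2 bounds N/(N - 1), the mismatch of the two normalisations. The domination of e₁ by e₀ holds
both for the products along a path and for their expectations, so the bound applies to the estimator
and to its deterministic counterpart. -/
theorem abs_arRatio_le_two {e₀ e₁ : ℤ → ℝ} (h0 : ∀ l, 0 ≤ e₀ l)
    (h1 : ∀ l, |e₁ l| ≤ (e₀ l + e₀ (l + 1)) / 2) {N : ℤ} (hN : 2 ≤ N) (t : ℤ) :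
    |arRatio e₀ e₁ N t| ≤ 2 := by
  have hN' : (2 : ℝ) ≤ N := by exact_mod_cast hN
  have hd : 0 ≤ (1 / (N : ℝ)) * ∑ l ∈ Finset.Ico (t - N + 1) (t + 1), e₀ l :=
    mul_nonneg (by positivity) (Finset.sum_nonneg fun l _ => h0 l)
  unfold arRatio
  rw [abs_div, abs_of_nonneg hd]
  exact div_le_of_le_mul₀ hd (by norm_num) (abs_numerator_le h0 h1 hN t)

theorem abs_mul_self_le (x : ℤ → ℝ) (l : ℤ) :
    |x l * x (l + 1)| ≤ (x l * x l + x (l + 1) * x (l + 1)) / 2 := by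
  rw [abs_le]
  constructor <;> nlinarith [sq_nonneg (x l - x (l + 1)), sq_nonneg (x l + x (l + 1))]

/-- Stability of the quotient of two numbers, one of which is at most twice the other. -/
theorem abs_div_sub_div_le {a b a' b' x g : ℝ} (hab : |a| ≤ 2 * b) (hg : 0 < g) (hb' : g ≤ b')
    (ha : |a - a'| ≤ x) (hb : |b - b'| ≤ x) : |a / b - a' / b'| ≤ 3 * x / g := by
  have hb0 : 0 ≤ b := by linarith [abs_nonneg a]
  have hb'0 : 0 < b' := by linarith
  have hx : 0 ≤ x := (abs_nonneg _).trans ha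
  have hq : |a / b| ≤ 2 := by
    rw [abs_div, abs_of_nonneg hb0]
    exact div_le_of_le_mul₀ hb0 (by norm_num) hab
  -- If b = 0 then a = 0 as well. So no lower bound is needed for b, the random denominator, but
  -- only for b'.
  have hqb : a / b * b = a := by
    rcases hb0.eq_or_lt with h | h
    · have : a = 0 := by
        rw [← h] at hab
        exact abs_nonpos_iff.1 (by simpa using hab)
      simp [this]
    · field_simp
  have e : a / b - a' / b' = ((a - a') - a / b * (b - b')) / b' := by
    rw [mul_sub, hqb, eq_div_iff hb'0.ne', sub_mul, div_mul_cancel₀ a' hb'0.ne']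
    ring
  rw [e, abs_div, abs_of_pos hb'0]
  have h1 : |(a - a') - a / b * (b - b')| ≤ 3 * x := by
    calc _ ≤ |a - a'| + |a / b * (b - b')| := abs_sub _ _
      _ ≤ x + 2 * x := by
          rw [abs_mul]
          exact add_le_add ha (mul_le_mul hq hb (abs_nonneg _) (by norm_num))
      _ = _ := by ring
  calc _ ≤ 3 * x / b' := div_le_div_of_nonneg_right h1 hb'0.le
    _ ≤ _ := div_le_div_of_nonneg_left (by linarith) hg hb'

theorem abs_one_div_mul_sum_sub_le {e e' : ℤ → ℝ} {I : Finset ℤ} {M x : ℝ} (hM : 0 < M)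
    (h : |∑ l ∈ I, (e l - e' l)| ≤ M * x) :
    |1 / M * ∑ l ∈ I, e l - 1 / M * ∑ l ∈ I, e' l| ≤ x := by
  rw [← mul_sub, ← Finset.sum_sub_distrib, abs_mul, abs_of_pos (by positivity),
    one_div_mul_eq_div, div_le_iff₀ hM]
  linarith

theorem abs_arRatio_sub_le {e₀ e₁ e₀' e₁' : ℤ → ℝ} (h0 : ∀ l, 0 ≤ e₀ l)
    (h1 : ∀ l, |e₁ l| ≤ (e₀ l + e₀ (l + 1)) / 2) {N : ℤ} (hN : 2 ≤ N) {t : ℤ} {x g : ℝ}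
    (hg : 0 < g) (hgl : ∀ l ∈ Finset.Ico (t - N + 1) (t + 1), g ≤ e₀' l)
    (hx0 : |∑ l ∈ Finset.Ico (t - N + 1) (t + 1), (e₀ l - e₀' l)| ≤ N * x)
    (hx1 : |∑ l ∈ Finset.Ico (t - N + 1) t, (e₁ l - e₁' l)| ≤ ((N : ℝ) - 1) * x) :
    |arRatio e₀ e₁ N t - arRatio e₀' e₁' N t| ≤ 3 * x / g := by
  have hN' : (2 : ℝ) ≤ N := by exact_mod_cast hN
  have hN0 : 0 < (N : ℝ) := by linarith
  have hN1 : 0 < (N : ℝ) - 1 := by linarith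
  unfold arRatio
  refine abs_div_sub_div_le (abs_numerator_le h0 h1 hN t) hg ?_
    (abs_one_div_mul_sum_sub_le hN1 hx1) (abs_one_div_mul_sum_sub_le hN0 hx0)
  have hcard := Finset.card_nsmul_le_sum _ _ _ hgl
  rw [Int.card_Ico, nsmul_eq_mul] at hcard
  have e : ((t + 1 - (t - N + 1)).toNat : ℝ) = N := by
    have : ((t + 1 - (t - N + 1)).toNat : ℤ) = N := by omega
    exact_mod_cast this
  rw [e] at hcard
  rw [one_div_mul_eq_div, le_div_iff₀ hN0]
  linarith

/-- Here a is the random coefficient and b its deterministic counterpart. Once a is replaced by b,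
at the cost κ, the squared error is a linear combination of centred sums of products. The weights
b/2 and b²/4 are scaled to have modulus at most 1, which gives 9 = 1 + 4 + 4. -/
theorem abs_sum_sq_sub_le {x a b e₀ e₁ : ℤ → ℝ} {J : Finset ℤ} {m : ℕ} (hJ : J.card = m)
    {κ x₁ Bd : ℝ} (ha : ∀ t ∈ J, |a t| ≤ 2) (hb : ∀ t ∈ J, |b t| ≤ 2)
    (hκ : ∀ t ∈ J, |a t - b t| ≤ κ)
    (he1 : ∀ t ∈ J, e₀ (t + 1) ≤ Bd) (he0 : ∀ t ∈ J, e₀ t ≤ Bd) (hκ0 : 0 ≤ κ)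
    (h1 : |∑ t ∈ J, (x (t + 1) * x (t + 1) - e₀ (t + 1))| ≤ m * x₁)
    (h2 : |∑ t ∈ J, (x t * x t - e₀ t)| ≤ m * x₁)
    (h3 : |∑ t ∈ J, b t / 2 * (x t * x (t + 1) - e₁ t)| ≤ m * x₁)
    (h4 : |∑ t ∈ J, b t ^ 2 / 4 * (x t * x t - e₀ t)| ≤ m * x₁) :
    |∑ t ∈ J, (x (t + 1) - a t * x t) ^ 2
      - ∑ t ∈ J, (e₀ (t + 1) - 2 * b t * e₁ t + b t ^ 2 * e₀ t)|
      ≤ m * (9 * x₁ + 6 * κ * (Bd + x₁)) := by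
  have e1 : ∑ t ∈ J, (x (t + 1) - a t * x t) ^ 2
      - ∑ t ∈ J, (e₀ (t + 1) - 2 * b t * e₁ t + b t ^ 2 * e₀ t)
      = ∑ t ∈ J, ((x (t + 1) - a t * x t) ^ 2 - (x (t + 1) - b t * x t) ^ 2)
        + ∑ t ∈ J, (x (t + 1) * x (t + 1) - e₀ (t + 1))
        - 4 * ∑ t ∈ J, b t / 2 * (x t * x (t + 1) - e₁ t)
        + 4 * ∑ t ∈ J, b t ^ 2 / 4 * (x t * x t - e₀ t) := by
    rw [Finset.mul_sum, Finset.mul_sum, ← Finset.sum_sub_distrib, ← Finset.sum_add_distrib,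
      ← Finset.sum_sub_distrib, ← Finset.sum_add_distrib]
    exact Finset.sum_congr rfl fun t _ => by ring
  have h5 : |∑ t ∈ J, ((x (t + 1) - a t * x t) ^ 2 - (x (t + 1) - b t * x t) ^ 2)|
      ≤ κ * (6 * (m * (Bd + x₁))) := by
    refine (Finset.abs_sum_le_sum_abs _ _).trans ?_
    calc ∑ t ∈ J, |(x (t + 1) - a t * x t) ^ 2 - (x (t + 1) - b t * x t) ^ 2|
        ≤ ∑ t ∈ J, κ * (x (t + 1) * x (t + 1) + 5 * (x t * x t)) := by
          refine Finset.sum_le_sum fun t ht => ?_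
          have e2 : (x (t + 1) - a t * x t) ^ 2 - (x (t + 1) - b t * x t) ^ 2
              = (a t - b t) * ((a t + b t) * (x t * x t) - 2 * (x t * x (t + 1))) := by ring
          rw [e2, abs_mul]
          refine mul_le_mul (hκ t ht) ?_ (abs_nonneg _) hκ0
          have h6 := abs_mul_self_le x t
          have h7 : |(a t + b t) * (x t * x t)| ≤ 4 * (x t * x t) := by
            rw [abs_mul, abs_of_nonneg (mul_self_nonneg (x t))]
            refine mul_le_mul_of_nonneg_right ?_ (mul_self_nonneg _)
            exact (abs_add_le _ _).trans (by linarith [ha t ht, hb t ht])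
          have h8 : |2 * (x t * x (t + 1))| = 2 * |x t * x (t + 1)| := by
            rw [abs_mul]; norm_num
          calc _ ≤ |(a t + b t) * (x t * x t)| + |2 * (x t * x (t + 1))| := abs_sub _ _
            _ ≤ _ := by rw [h8]; linarith
      _ = κ * (∑ t ∈ J, x (t + 1) * x (t + 1) + 5 * ∑ t ∈ J, x t * x t) := by
          rw [← Finset.mul_sum, Finset.sum_add_distrib, Finset.mul_sum J _ (5 : ℝ)]
      _ ≤ κ * (6 * (m * (Bd + x₁))) := by
          refine mul_le_mul_of_nonneg_left ?_ hκ0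
          have h9 := (abs_le.1 h1).2
          have h10 := (abs_le.1 h2).2
          rw [Finset.sum_sub_distrib] at h9 h10
          have h11 := Finset.sum_le_card_nsmul _ _ _ he1
          have h12 := Finset.sum_le_card_nsmul _ _ _ he0
          rw [hJ, nsmul_eq_mul] at h11 h12
          linarith
  rw [e1]
  rw [abs_le] at h1 h3 h4 h5 ⊢
  constructor <;> linarith [h1.1, h1.2, h3.1, h3.2, h4.1, h4.2, h5.1, h5.2]

/-- Completing the square in b shows g₁/g₀ to be the optimal coefficient. This form exposes the loss
(b - g₁/g₀)². -/
theorem abs_quadratic_sub_le {e e' e₁ b g₀ g₁ τ : ℝ} (hb : |b| ≤ 2) (hg₀ : 0 < g₀)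
    (h1 : |e' - g₀| ≤ τ) (h2 : |e₁ - g₁| ≤ τ) (h3 : |e - g₀| ≤ τ) :
    |(e' - 2 * b * e₁ + b ^ 2 * e) - g₀ * (1 - (g₁ / g₀) ^ 2 + (b - g₁ / g₀) ^ 2)| ≤ 9 * τ := by
  have e2 : g₀ * (1 - (g₁ / g₀) ^ 2 + (b - g₁ / g₀) ^ 2) = g₀ - 2 * b * g₁ + b ^ 2 * g₀ := by
    field_simp; ring
  have e3 : (e' - 2 * b * e₁ + b ^ 2 * e) - (g₀ - 2 * b * g₁ + b ^ 2 * g₀)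
      = (e' - g₀) - 2 * (b * (e₁ - g₁)) + b ^ 2 * (e - g₀) := by ring
  have hτ : 0 ≤ τ := (abs_nonneg _).trans h1
  have h4 : |b * (e₁ - g₁)| ≤ 2 * τ := by
    rw [abs_mul]; exact mul_le_mul hb h2 (abs_nonneg _) (by norm_num)
  have h5 : |b ^ 2 * (e - g₀)| ≤ 4 * τ := by
    rw [abs_mul, abs_pow]
    refine mul_le_mul ?_ h3 (abs_nonneg _) (by norm_num)
    nlinarith [abs_nonneg b]
  rw [e2, e3]
  rw [abs_le] at h1 h4 h5 ⊢
  constructor <;> linarith [h1.1, h1.2, h4.1, h4.2, h5.1, h5.2]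

/-- Half of δ(1 - ρ²) pays for the stationary loss D². The other half, multiplied by g ≥ 2π mf, is
the gap left for the errors ζ and Err. -/
theorem sum_lt_of_gap {J : Finset ℤ} {m : ℕ} (hJ : J.card = m) (hm : 1 ≤ m) {g a bs bl : ℤ → ℝ}
    {Qs Ql Err δ ρ D ζ mf Mf : ℝ}
    (hg : ∀ t ∈ J, 2 * Real.pi * mf ≤ g t) (hg' : ∀ t ∈ J, g t ≤ 2 * Real.pi * Mf) (hmf : 0 < mf)
    (ha : ∀ t ∈ J, |a t| ≤ ρ) (hρ : ρ < 1) (hbs : ∀ t ∈ J, |bs t - a t| ≤ D + ζ)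
    (hbs2 : ∀ t ∈ J, |bs t| ≤ 2) (hD : 0 ≤ D) (hD2 : D ≤ 2) (hζ : 0 ≤ ζ) (hδ : 0 ≤ δ)
    (hDδ : 2 * D ^ 2 ≤ δ * (1 - ρ ^ 2))
    (hs : |Qs - ∑ t ∈ J, g t * (1 - a t ^ 2 + (bs t - a t) ^ 2)| ≤ m * Err)
    (hl : |Ql - ∑ t ∈ J, g t * (1 - a t ^ 2 + (bl t - a t) ^ 2)| ≤ m * Err)
    (hgap : 10 * Real.pi * Mf * ζ + (2 + δ) * Err < δ * Real.pi * mf * (1 - ρ ^ 2)) :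
    Qs < (1 + δ) * Ql := by
  have hpt : ∀ t ∈ J, δ * Real.pi * mf * (1 - ρ ^ 2) - 10 * Real.pi * Mf * ζ
      ≤ (1 + δ) * (g t * (1 - a t ^ 2 + (bl t - a t) ^ 2))
        - g t * (1 - a t ^ 2 + (bs t - a t) ^ 2) := by
    intro t ht
    have hpi := Real.pi_pos
    have hg0 : 0 < g t := lt_of_lt_of_le (by positivity) (hg t ht)
    have h1 : a t ^ 2 ≤ ρ ^ 2 := by
      rw [← sq_abs (a t)]; exact pow_le_pow_left₀ (abs_nonneg _) (ha t ht) 2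
    -- The difference of squares is (|bs - a| - D)(|bs - a| + D), with second factor at most 3 + 2.
    have h2 : (bs t - a t) ^ 2 ≤ D ^ 2 + 5 * ζ := by
      rw [← sq_abs]
      have h3 : |bs t - a t| ≤ 3 := (abs_sub _ _).trans (by linarith [hbs2 t ht, ha t ht])
      have h4 := hbs t ht
      have h5 := abs_nonneg (bs t - a t)
      rcases le_total |bs t - a t| D with h6 | h6 <;> nlinarith
    have h7 : δ * (1 - ρ ^ 2) / 2 - 5 * ζ
        ≤ δ * (1 - a t ^ 2) + (1 + δ) * (bl t - a t) ^ 2 - (bs t - a t) ^ 2 := by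
      have : 0 ≤ (1 + δ) * (bl t - a t) ^ 2 := by positivity
      nlinarith
    have h8 : 0 ≤ δ * (1 - ρ ^ 2) := (by positivity : 0 ≤ 2 * D ^ 2).trans hDδ
    calc δ * Real.pi * mf * (1 - ρ ^ 2) - 10 * Real.pi * Mf * ζ
        = 2 * Real.pi * mf * (δ * (1 - ρ ^ 2) / 2) - 2 * Real.pi * Mf * (5 * ζ) := by ring
      _ ≤ g t * (δ * (1 - ρ ^ 2) / 2) - g t * (5 * ζ) := by
          have h9 := mul_le_mul_of_nonneg_right (hg t ht) (half_pos (zero_lt_two' ℝ)).le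
          have h10 : 2 * Real.pi * mf * (δ * (1 - ρ ^ 2) / 2) ≤ g t * (δ * (1 - ρ ^ 2) / 2) :=
            mul_le_mul_of_nonneg_right (hg t ht) (by linarith)
          have h11 : g t * (5 * ζ) ≤ 2 * Real.pi * Mf * (5 * ζ) :=
            mul_le_mul_of_nonneg_right (hg' t ht) (by linarith)
          linarith
      _ = g t * (δ * (1 - ρ ^ 2) / 2 - 5 * ζ) := by ring
      _ ≤ g t * (δ * (1 - a t ^ 2) + (1 + δ) * (bl t - a t) ^ 2 - (bs t - a t) ^ 2) :=
          mul_le_mul_of_nonneg_left h7 hg0.le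
      _ = _ := by ring
  have hsum := Finset.card_nsmul_le_sum _ _ _ hpt
  rw [hJ, nsmul_eq_mul, Finset.sum_sub_distrib, ← Finset.mul_sum] at hsum
  have hs' := (abs_le.1 hs).2
  have hl' := mul_le_mul_of_nonneg_left (abs_le.1 hl).1 (by linarith : 0 ≤ 1 + δ)
  have hm0 : (0 : ℝ) < m := by exact_mod_cast hm
  have hgap' := mul_lt_mul_of_pos_left hgap hm0
  linarith

/-! ### The expected stationary estimator and the averaged covariances -/

theorem abs_average_sub_integral_le {G : ℝ → ℝ} {v : ℕ → ℝ} {n : ℕ} {β : ℝ} (hn : 1 ≤ n)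
    (hG : ∀ a b, IntervalIntegrable G volume a b)
    (h : ∀ i < n, ∀ x ∈ Set.Icc ((i : ℝ) / n) ((i + 1 : ℕ) / n), |v i - G x| ≤ β) :
    |1 / (n : ℝ) * ∑ i ∈ Finset.range n, v i - ∫ x in (0 : ℝ)..1, G x| ≤ β := by
  have hn0 : (0 : ℝ) < n := by exact_mod_cast hn
  have hsplit : ∫ x in (0 : ℝ)..1, G x
      = ∑ i ∈ Finset.range n, ∫ x in ((i : ℝ) / n)..(((i + 1 : ℕ) : ℝ) / n), G x := by
    have := intervalIntegral.sum_integral_adjacent_intervals (a := fun i : ℕ => (i : ℝ) / n)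
      (n := n) (f := G) (μ := volume) fun _ _ => hG _ _
    simp only [Nat.cast_zero, zero_div, div_self hn0.ne'] at this
    exact this.symm
  have hpiece : ∀ i ∈ Finset.range n,
      |v i / n - ∫ x in ((i : ℝ) / n)..(((i + 1 : ℕ) : ℝ) / n), G x| ≤ β / n := by
    intro i hi
    have hle : (i : ℝ) / n ≤ ((i + 1 : ℕ) : ℝ) / n := by gcongr; simp
    have hlen : ((i + 1 : ℕ) : ℝ) / n - (i : ℝ) / n = 1 / n := by push_cast; ring
    have e : v i / n = ∫ _ in ((i : ℝ) / n)..(((i + 1 : ℕ) : ℝ) / n), v i := by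
      rw [intervalIntegral.integral_const, hlen, smul_eq_mul]; ring
    rw [e, ← intervalIntegral.integral_sub intervalIntegrable_const (hG _ _)]
    have := intervalIntegral.norm_integral_le_of_norm_le_const (a := (i : ℝ) / n)
      (b := ((i + 1 : ℕ) : ℝ) / n) (C := β) (f := fun x => v i - G x) fun x hx => by
        rw [Set.uIoc_of_le hle] at hx
        exact h i (Finset.mem_range.1 hi) x ⟨hx.1.le, hx.2⟩
    rw [hlen, abs_of_pos (by positivity)] at this
    refine this.trans (le_of_eq (by ring))
  rw [hsplit, Finset.mul_sum, ← Finset.sum_sub_distrib]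
  calc _ ≤ ∑ i ∈ Finset.range n, β / n := by
        refine (Finset.abs_sum_le_sum_abs _ _).trans (Finset.sum_le_sum fun i hi => ?_)
        have := hpiece i hi
        rwa [one_div_mul_eq_div]
    _ = β := by rw [Finset.sum_const, Finset.card_range, nsmul_eq_mul]; field_simp

theorem sum_Ico_one_eq_sum_range (e : ℤ → ℝ) (n : ℕ) :
    ∑ l ∈ Finset.Ico (1 : ℤ) (n + 1), e l = ∑ i ∈ Finset.range n, e (i + 1) := by
  refine Finset.sum_nbij' (fun l => (l - 1).toNat) (fun i => (i : ℤ) + 1) ?_ ?_ ?_ ?_ ?_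
  · intro l hl
    simp only [Finset.mem_Ico, Finset.mem_range] at hl ⊢
    omega
  · intro i hi
    simp only [Finset.mem_Ico, Finset.mem_range] at hi ⊢
    omega
  · intro l hl
    simp only [Finset.mem_Ico] at hl
    omega
  · intro i _; simp
  · intro l hl
    simp only [Finset.mem_Ico] at hl
    congr 1
    omega

section Average

variable {f : ℝ → ℝ → ℝ} {mf Mf Mf' C : ℝ} {T m : ℕ}

/-- A Riemann sum: the l-th term is compared with the integrand on the l-th piece of [0, 1]. Local
time is taken at `min t T` because `validationTimes` ends at 1 while test times go beyond T. The
sample size, `min t T` and T - m differ by O(m), which the constant 4 covers. The offset c is the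
lag, for which t - c terms are available. -/
theorem abs_average_sub_avgCov_le (h : IsLocalSpectralDensity f) (hd : SpectralDerivBound f Mf')
    (hT : 1 ≤ T) (hmT : m ≤ T) {k : ℤ} {e : ℤ → ℝ} {c : ℤ} (hc : 0 ≤ c) (hc1 : c ≤ 1)
    (he : ∀ l : ℤ, |e l - localCov f k ((l + c : ℤ) / (T : ℝ))| ≤ C / T) {n : ℕ} (hn : 1 ≤ n)
    {t : ℤ} (hnt : (n : ℤ) + c = t) (ht : (T : ℤ) - m ≤ t) (ht' : t + 1 ≤ (T : ℤ) + m) :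
    |1 / (n : ℝ) * ∑ l ∈ Finset.Ico (1 : ℤ) (n + 1), e l
      - avgCov f k (((T : ℝ) - (m : ℝ)) / (T : ℝ)) ((min t T : ℤ) / (T : ℝ))|
      ≤ C / T + 2 * Real.pi * Mf' * (4 * m / T) := by
  have hT0 : (0 : ℝ) < T := by exact_mod_cast hT
  rw [sum_Ico_one_eq_sum_range]
  refine abs_average_sub_integral_le (v := fun i => e (i + 1)) hn (fun a b =>
    ((h.continuous_localCov hd k).comp (by fun_prop)).intervalIntegrable _ _) fun i hi x hx => ?_
  have h1 := he (i + 1)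
  have h2 := h.abs_localCov_sub_le hd k (((i : ℤ) + 1 + c : ℤ) / (T : ℝ))
    ((min t T : ℤ) / (T : ℝ) + ((T : ℝ) - (m : ℝ)) / (T : ℝ) * (x - 1))
  refine (abs_sub_le _ _ _).trans (add_le_add h1 (h2.trans ?_))
  have hM := hd.1
  refine mul_le_mul_of_nonneg_left ?_ (by positivity)
  have hn0 : (0 : ℝ) < n := by exact_mod_cast hn
  have hx1 : (i : ℝ) ≤ n * x := by
    have := (div_le_iff₀ hn0).1 hx.1
    linarith
  have hx2 : n * x ≤ i + 1 := by
    have := (le_div_iff₀ hn0).1 hx.2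
    push_cast at this
    linarith
  have hi' : (i : ℝ) + 1 ≤ n := by exact_mod_cast hi
  have hx0 : 0 ≤ x := le_trans (by positivity) hx.1
  have hx3 : x ≤ 1 := by
    by_contra hcon
    push Not at hcon
    nlinarith
  have e1 : (((i : ℤ) + 1 + c : ℤ) : ℝ) / (T : ℝ)
      - ((min t T : ℤ) / (T : ℝ) + ((T : ℝ) - (m : ℝ)) / (T : ℝ) * (x - 1))
      = ((i : ℝ) + 1 + c - (min t T : ℤ) - (T - m) * (x - 1)) / T := by
    push_cast
    field_simp
    ring
  rw [e1, abs_div, abs_of_pos hT0]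
  refine div_le_div_of_nonneg_right ?_ hT0.le
  have hm1 : (1 : ℝ) ≤ m := by
    have : 1 ≤ m := by omega
    exact_mod_cast this
  have hc0' : (0 : ℝ) ≤ c := by exact_mod_cast hc
  have hc1' : (c : ℝ) ≤ 1 := by exact_mod_cast hc1
  have hmin1 : (T : ℝ) - m ≤ (min t T : ℤ) := by
    have : (T : ℤ) - m ≤ min t T := le_min ht (by omega)
    exact_mod_cast this
  have hmin2 : ((min t T : ℤ) : ℝ) ≤ T := by
    have : min t T ≤ (T : ℤ) := min_le_right _ _
    exact_mod_cast this
  have hnt' : (n : ℝ) + c = t := by exact_mod_cast hnt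
  have ht1 : (T : ℝ) - m ≤ t := by exact_mod_cast ht
  have ht2 : (t : ℝ) + 1 ≤ T + m := by exact_mod_cast ht'
  have h5 : ((n : ℝ) - (T - m)) * x ≤ 2 * m := by
    rcases le_total 0 ((n : ℝ) - (T - m)) with h6 | h6
    · nlinarith
    · nlinarith
  have h7 : -1 ≤ ((n : ℝ) - (T - m)) * x := by
    have : -1 ≤ (n : ℝ) - (T - m) := by linarith
    nlinarith
  rw [abs_le]
  constructor <;> linarith

theorem abs_arRatio_sub_avgCov_le (h : IsLocalSpectralDensity f) (hb : SpectralBounds f mf Mf)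
    (hd : SpectralDerivBound f Mf') (hT : 1 ≤ T) (hmT : m ≤ T) {e₀ e₁ : ℤ → ℝ}
    (h0 : ∀ l, 0 ≤ e₀ l) (h1 : ∀ l, |e₁ l| ≤ (e₀ l + e₀ (l + 1)) / 2)
    (he0 : ∀ l : ℤ, |e₀ l - localCov f 0 (l / (T : ℝ))| ≤ C / T)
    (he1 : ∀ l : ℤ, |e₁ l - localCov f 1 ((l + 1 : ℤ) / (T : ℝ))| ≤ C / T)
    {t : ℤ} (ht2 : 2 ≤ t) (ht : (T : ℤ) - m ≤ t) (ht' : t + 1 ≤ (T : ℤ) + m) :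
    |arRatio e₀ e₁ t t - avgCov f 1 (((T : ℝ) - (m : ℝ)) / (T : ℝ)) ((min t T : ℤ) / (T : ℝ))
        / avgCov f 0 (((T : ℝ) - (m : ℝ)) / (T : ℝ)) ((min t T : ℤ) / (T : ℝ))|
      ≤ 3 * (C / T + 2 * Real.pi * Mf' * (4 * m / T)) / (2 * Real.pi * mf) := by
  have hmf := hb.1
  obtain ⟨n, hn⟩ : ∃ n : ℕ, (n : ℤ) + 1 = t := ⟨(t - 1).toNat, by omega⟩
  unfold arRatio
  refine abs_div_sub_div_le (abs_numerator_le h0 h1 ht2 t) (by have := Real.pi_pos; positivity)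
    (h.le_avgCov_zero hb hd _ _) ?_ ?_
  · have := abs_average_sub_avgCov_le h hd hT hmT (k := 1) (c := 1) (by norm_num) le_rfl he1
      (n := n) (by omega) hn ht ht'
    have e1 : (t : ℝ) - 1 = n := by rw [← hn]; push_cast; ring
    have e2 : t - t + 1 = 1 := by ring
    rw [hn] at this
    rwa [e1, e2]
  · have := abs_average_sub_avgCov_le h hd hT hmT (k := 0) (c := 0) le_rfl (by norm_num)
      (e := e₀) (by simpa using he0)
      (n := n + 1) (by omega) (t := t) (by push_cast; omega) ht ht'
    have e1 : (t : ℝ) = (n + 1 : ℕ) := by rw [← hn]; push_cast; ring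
    have e2 : t - t + 1 = 1 := by ring
    have e3 : t + 1 = ((n + 1 : ℕ) : ℤ) + 1 := by push_cast; omega
    rwa [e1, e2, e3]

end Average

/-! ### The comparison of the two forecasts on a good event -/

section Comparison

variable {f : ℝ → ℝ → ℝ} {mf Mf Mf' C : ℝ} {T m : ℕ}

theorem abs_sub_localCov_min_le (h : IsLocalSpectralDensity f) (hd : SpectralDerivBound f Mf')
    (hT : 1 ≤ T) (hm : 1 ≤ m) {k s t : ℤ} {v : ℝ}
    (hv : |v - localCov f k (s / (T : ℝ))| ≤ C / T) (hst : t ≤ s) (hst' : s ≤ t + 1)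
    (ht' : t + 1 ≤ (T : ℤ) + m) :
    |v - localCov f k ((min t T : ℤ) / (T : ℝ))| ≤ C / T + 2 * Real.pi * Mf' * (m / T) := by
  have hT0 : (0 : ℝ) < T := by exact_mod_cast hT
  have hM := hd.1
  refine (abs_sub_le _ _ _).trans (add_le_add hv ((h.abs_localCov_sub_le hd k _ _).trans ?_))
  refine mul_le_mul_of_nonneg_left ?_ (by have := Real.pi_pos; positivity)
  rw [← sub_div, abs_div, abs_of_pos hT0]
  refine div_le_div_of_nonneg_right ?_ hT0.le
  have h1 : |s - min t T| ≤ (m : ℤ) := by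
    rw [abs_le]
    constructor <;> omega
  exact_mod_cast h1

/-- Two approximations are added: products and estimated coefficients are replaced by their
deterministic versions (x₁ and x₂), then expectations by local covariances at the common time `min t
T` (the terms in C and Mf'). -/
theorem abs_sum_forecast_sub_le (h : IsLocalSpectralDensity f) (hb : SpectralBounds f mf Mf)
    (hd : SpectralDerivBound f Mf') (hT : 1 ≤ T) (hm : 1 ≤ m) {x e₀ e₁ : ℤ → ℝ}
    (h0 : ∀ l, 0 ≤ e₀ l) (h1 : ∀ l, |e₁ l| ≤ (e₀ l + e₀ (l + 1)) / 2)
    (hlow : ∀ l, 6 * mf ≤ e₀ l) (hup : ∀ l, e₀ l ≤ 3 * Real.pi * Mf)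
    (he0 : ∀ l : ℤ, |e₀ l - localCov f 0 (l / (T : ℝ))| ≤ C / T)
    (he1 : ∀ l : ℤ, |e₁ l - localCov f 1 ((l + 1 : ℤ) / (T : ℝ))| ≤ C / T)
    {a : ℤ} (ha' : a ≤ T) {M : ℤ → ℤ} {x₁ x₂ : ℝ} (hx₂ : 0 ≤ x₂)
    (hM : ∀ t ∈ Finset.Ico a (a + m), 2 ≤ M t)
    (hg1 : |∑ t ∈ Finset.Ico a (a + m), (x (t + 1) * x (t + 1) - e₀ (t + 1))| ≤ m * x₁)
    (hg2 : |∑ t ∈ Finset.Ico a (a + m), (x t * x t - e₀ t)| ≤ m * x₁)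
    (hg3 : |∑ t ∈ Finset.Ico a (a + m), arRatio e₀ e₁ (M t) t / 2 * (x t * x (t + 1) - e₁ t)|
      ≤ m * x₁)
    (hg4 : |∑ t ∈ Finset.Ico a (a + m), arRatio e₀ e₁ (M t) t ^ 2 / 4 * (x t * x t - e₀ t)|
      ≤ m * x₁)
    (hg5 : ∀ t ∈ Finset.Ico a (a + m),
      |∑ l ∈ Finset.Ico (t - M t + 1) (t + 1), (x l * x l - e₀ l)| ≤ M t * x₂)
    (hg6 : ∀ t ∈ Finset.Ico a (a + m),
      |∑ l ∈ Finset.Ico (t - M t + 1) t, (x l * x (l + 1) - e₁ l)| ≤ ((M t : ℝ) - 1) * x₂) :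
    |∑ t ∈ Finset.Ico a (a + m), (x (t + 1) - forecast 1 x (M t) t) ^ 2
      - ∑ t ∈ Finset.Ico a (a + m), localCov f 0 ((min t T : ℤ) / (T : ℝ))
        * (1 - (localCov f 1 ((min t T : ℤ) / (T : ℝ)) / localCov f 0 ((min t T : ℤ) / (T : ℝ))) ^ 2
          + (arRatio e₀ e₁ (M t) t
            - localCov f 1 ((min t T : ℤ) / (T : ℝ)) / localCov f 0 ((min t T : ℤ) / (T : ℝ))) ^ 2)|
      ≤ m * (9 * x₁ + 6 * (3 * x₂ / (6 * mf)) * (3 * Real.pi * Mf + x₁)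
          + 9 * (C / T + 2 * Real.pi * Mf' * (m / T))) := by
  have hmf := hb.1
  have hJ : (Finset.Ico a (a + m)).card = m := by simp
  have hxx0 : ∀ l, 0 ≤ (fun l => x l * x l) l := fun l => mul_self_nonneg _
  have p1 := abs_sum_sq_sub_le (x := x) (e₀ := e₀) (e₁ := e₁) hJ
    (a := fun t => arRatio (fun l => x l * x l) (fun l => x l * x (l + 1)) (M t) t)
    (b := fun t => arRatio e₀ e₁ (M t) t) (κ := 3 * x₂ / (6 * mf)) (x₁ := x₁)
    (Bd := 3 * Real.pi * Mf)
    (fun t ht => abs_arRatio_le_two hxx0 (abs_mul_self_le x) (hM t ht) t)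
    (fun t ht => abs_arRatio_le_two h0 h1 (hM t ht) t)
    (fun t ht => abs_arRatio_sub_le hxx0 (abs_mul_self_le x) (hM t ht) (by positivity)
      (fun l _ => hlow l) (hg5 t ht) (hg6 t ht))
    (fun t _ => hup _) (fun t _ => hup _) (by positivity) hg1 hg2 hg3 hg4
  simp only [← forecast_one_eq] at p1
  have p2 : |∑ t ∈ Finset.Ico a (a + m), (e₀ (t + 1) - 2 * arRatio e₀ e₁ (M t) t * e₁ t
        + arRatio e₀ e₁ (M t) t ^ 2 * e₀ t)
      - ∑ t ∈ Finset.Ico a (a + m), localCov f 0 ((min t T : ℤ) / (T : ℝ))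
        * (1 - (localCov f 1 ((min t T : ℤ) / (T : ℝ)) / localCov f 0 ((min t T : ℤ) / (T : ℝ))) ^ 2
          + (arRatio e₀ e₁ (M t) t
            - localCov f 1 ((min t T : ℤ) / (T : ℝ)) / localCov f 0 ((min t T : ℤ) / (T : ℝ))) ^ 2)|
      ≤ m * (9 * (C / T + 2 * Real.pi * Mf' * (m / T))) := by
    rw [← Finset.sum_sub_distrib]
    refine (Finset.abs_sum_le_sum_abs _ _).trans ?_
    refine (Finset.sum_le_card_nsmul _ _ (9 * (C / T + 2 * Real.pi * Mf' * (m / T)))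
      fun t ht => ?_).trans ?_
    · have ht1 := Finset.mem_Ico.1 ht
      refine abs_quadratic_sub_le (abs_arRatio_le_two h0 h1 (hM t ht) t)
        (lt_of_lt_of_le (by have := Real.pi_pos; positivity) (h.le_localCov_zero hb _)) ?_ ?_ ?_
      · exact abs_sub_localCov_min_le h hd hT hm (he0 (t + 1)) (by omega) le_rfl (by omega)
      · exact abs_sub_localCov_min_le h hd hT hm (he1 t) (by omega) le_rfl (by omega)
      · exact abs_sub_localCov_min_le h hd hT hm (he0 t) le_rfl (by omega) (by omega)
    · rw [hJ, nsmul_eq_mul]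
  refine (abs_sub_le _ _ _).trans ((add_le_add p1 p2).trans (le_of_eq ?_))
  ring

/-- On the event where all sums of products are close to their expectations, the stationary forecasts
are not much worse than the locally stationary ones. -/
theorem sum_sq_forecast_lt (h : IsLocalSpectralDensity f) (hb : SpectralBounds f mf Mf)
    (hd : SpectralDerivBound f Mf') (hT : 1 ≤ T) (hm : 1 ≤ m) {x e₀ e₁ : ℤ → ℝ}
    (h0 : ∀ l, 0 ≤ e₀ l) (h1 : ∀ l, |e₁ l| ≤ (e₀ l + e₀ (l + 1)) / 2)
    (hlow : ∀ l, 6 * mf ≤ e₀ l) (hup : ∀ l, e₀ l ≤ 3 * Real.pi * Mf)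
    (he0 : ∀ l : ℤ, |e₀ l - localCov f 0 (l / (T : ℝ))| ≤ C / T)
    (he1 : ∀ l : ℤ, |e₁ l - localCov f 1 ((l + 1 : ℤ) / (T : ℝ))| ≤ C / T) (hC : 0 ≤ C)
    {a : ℤ} (ha : (T : ℤ) - m ≤ a) (ha' : a ≤ T) {N : ℕ} (hN : 2 ≤ N) (hNT : N + m + 1 ≤ T)
    {x₁ x₂ δ : ℝ} (hx₂ : 0 ≤ x₂)
    (hg1 : |∑ t ∈ Finset.Ico a (a + m), (x (t + 1) * x (t + 1) - e₀ (t + 1))| ≤ m * x₁)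
    (hg2 : |∑ t ∈ Finset.Ico a (a + m), (x t * x t - e₀ t)| ≤ m * x₁)
    (hg : ∀ M : ℤ → ℤ, (M = fun t => t) ∨ (M = fun _ => (N : ℤ)) →
      |∑ t ∈ Finset.Ico a (a + m), arRatio e₀ e₁ (M t) t / 2 * (x t * x (t + 1) - e₁ t)|
        ≤ m * x₁ ∧
      |∑ t ∈ Finset.Ico a (a + m), arRatio e₀ e₁ (M t) t ^ 2 / 4 * (x t * x t - e₀ t)|
        ≤ m * x₁ ∧
      ∀ t ∈ Finset.Ico a (a + m),
        |∑ l ∈ Finset.Ico (t - M t + 1) (t + 1), (x l * x l - e₀ l)| ≤ M t * x₂ ∧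
        |∑ l ∈ Finset.Ico (t - M t + 1) t, (x l * x (l + 1) - e₁ l)| ≤ ((M t : ℝ) - 1) * x₂)
    (hρ : rhoSup f T m < 1) (hδ : 2 * DSup f T m ^ 2 / (1 - rhoSup f T m ^ 2) ≤ δ)
    (hgap : 10 * Real.pi * Mf
        * (3 * (C / T + 2 * Real.pi * Mf' * (4 * m / T)) / (2 * Real.pi * mf))
      + (2 + δ) * (9 * x₁ + 6 * (3 * x₂ / (6 * mf)) * (3 * Real.pi * Mf + x₁)
          + 9 * (C / T + 2 * Real.pi * Mf' * (m / T)))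
      < δ * Real.pi * mf * (1 - rhoSup f T m ^ 2)) :
    ∑ t ∈ Finset.Ico a (a + m), (x (t + 1) - forecastS x t) ^ 2
      < (1 + δ) * ∑ t ∈ Finset.Ico a (a + m), (x (t + 1) - forecastLS x N t) ^ 2 := by
  have hT0 : (0 : ℝ) < T := by exact_mod_cast hT
  have hpi := Real.pi_pos
  have hmf := hb.1
  have hMf' := hd.1
  have hval : ∀ t ∈ Finset.Ico a (a + m), ((min t T : ℤ) : ℝ) / T ∈ validationTimes T m := by
    intro t ht
    have ht1 := Finset.mem_Ico.1 ht
    constructor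
    · refine div_le_div_of_nonneg_right ?_ hT0.le
      have : (T : ℤ) - m ≤ min t T := le_min (by omega) (by omega)
      exact_mod_cast this
    · rw [div_le_one hT0]
      have : min t T ≤ (T : ℤ) := min_le_right _ _
      exact_mod_cast this
  have hρ0 := rhoSup_nonneg f T m
  have hρ2 : 0 < 1 - rhoSup f T m ^ 2 := by nlinarith
  have hδ0 : 0 ≤ δ := le_trans (by positivity) hδ
  obtain ⟨gs1, gs2, gs3⟩ := hg (fun t => t) (Or.inl rfl)
  obtain ⟨gl1, gl2, gl3⟩ := hg (fun _ => (N : ℤ)) (Or.inr rfl)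
  have hts : ∀ t ∈ Finset.Ico a (a + m), (2 : ℤ) ≤ t := fun t ht => by
    have ht1 := Finset.mem_Ico.1 ht
    omega
  have qs := abs_sum_forecast_sub_le h hb hd hT hm h0 h1 hlow hup he0 he1 ha'
    (M := fun t => t) hx₂ hts hg1 hg2 gs1 gs2
    (fun t ht => (gs3 t ht).1) fun t ht => (gs3 t ht).2
  have ql := abs_sum_forecast_sub_le h hb hd hT hm h0 h1 hlow hup he0 he1 ha'
    (M := fun _ => (N : ℤ)) hx₂ (fun t _ => by exact_mod_cast hN) hg1 hg2 gl1 gl2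
    (fun t ht => (gl3 t ht).1) fun t ht => (gl3 t ht).2
  refine sum_lt_of_gap (J := Finset.Ico a (a + m)) (m := m) (by simp) hm
    (g := fun t => localCov f 0 ((min t T : ℤ) / (T : ℝ)))
    (a := fun t => localCov f 1 ((min t T : ℤ) / (T : ℝ)) / localCov f 0 ((min t T : ℤ) / (T : ℝ)))
    (bs := fun t => arRatio e₀ e₁ t t) (bl := fun t => arRatio e₀ e₁ N t)
    (ρ := rhoSup f T m) (D := DSup f T m)
    (fun t _ => h.le_localCov_zero hb _) (fun t _ => h.localCov_zero_le hb _) hmf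
    (fun t ht => h.abs_le_rhoSup (hval t ht)) hρ ?_
    (fun t ht => abs_arRatio_le_two h0 h1 (hts t ht) t) (DSup_nonneg f T m) (h.DSup_le_two hd T m)
    (by positivity) hδ0 ?_ qs ql hgap
  -- The expected stationary coefficient is close to the ratio of averaged covariances, which lies
  -- within D_sup of the local autocorrelation.
  · intro t ht
    have ht1 := Finset.mem_Ico.1 ht
    have s1 := abs_arRatio_sub_avgCov_le h hb hd hT (m := m) (by omega) h0 h1 he0 he1 (hts t ht)
      (by omega) (by omega)
    have s2 := h.abs_le_DSup hd (hval t ht)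
    refine (abs_sub_le _ _ _).trans ((add_le_add s1 s2).trans (le_of_eq (add_comm _ _)))
  · rw [div_le_iff₀ hρ2] at hδ
    exact hδ

end Comparison

/-! ### Probability that the deviations are large -/

section Union

variable {Ω : Type*} {m0 : MeasurableSpace Ω} {μ : Measure Ω} [IsProbabilityMeasure μ]
  {X : ℕ → ℤ → Ω → ℝ}

/-- The paths for which the sums that define the estimators and prediction errors are far from their
expectations, when segments of length `M t` are used at time `t`. -/
def badSet (μ : Measure Ω) (X : ℕ → ℤ → Ω → ℝ) (T : ℕ) (b : ℤ → ℝ) (J : Finset ℤ) (M : ℤ → ℤ)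
    (y₁ x₂ : ℝ) : Set Ω :=
  ({ω | y₁ ≤ |∑ t ∈ J, b t / 2 * (X T t ω * X T (t + 1) ω
      - ∫ ω, X T t ω * X T (t + 1) ω ∂μ)|} ∪
    {ω | y₁ ≤ |∑ t ∈ J, b t ^ 2 / 4 * (X T t ω * X T t ω - ∫ ω, X T t ω * X T t ω ∂μ)|}) ∪
  ⋃ t ∈ J,
    ({ω | M t * x₂ ≤ |∑ l ∈ Finset.Ico (t - M t + 1) (t + 1),
        (X T l ω * X T l ω - ∫ ω, X T l ω * X T l ω ∂μ)|} ∪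
      {ω | ((M t : ℝ) - 1) * x₂ ≤ |∑ l ∈ Finset.Ico (t - M t + 1) t,
        (X T l ω * X T (l + 1) ω - ∫ ω, X T l ω * X T (l + 1) ω ∂μ)|})

/-- Two weighted sums enter the squared errors of the whole block, and two further sums enter the
estimator at each of its m times. Every two-sided event costs 2 exp(-A). -/
theorem measureReal_badSet_le {K r c d Θ A₁ η₁ A₂ η₂ : ℝ} {T m n₀ : ℕ} (hT : 1 ≤ T)
    (hX : ∀ t, Measurable (X T t)) (hmix : IsGeometricallyMixing μ X K r)
    (hmom : BernsteinCondition μ X m c d) (hΘ : 0 < Θ) (hc : c ^ 2 ≤ Θ)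
    (hσ : ∀ t : ℤ, 1 ≤ t → t ≤ (T : ℤ) + m → variance (X T t) μ ≤ Θ)
    (hA₁ : 10 / 3 ≤ A₁) (hη₁ : 0 < η₁) (hηΘ₁ : η₁ ≤ Θ)
    (hvar₁ : 2 * A₁ * (16000 * (256 : ℝ) ^ d * Θ ^ 2 * mixFactor K r) ≤ m * η₁ ^ 2)
    (htail₁ : 260 * (8 : ℝ) ^ d * Θ * (1 + 1 / Real.log r) * (2 * A₁) ^ (2 + 2 * d) ≤ m * η₁)
    (hA₂ : 10 / 3 ≤ A₂) (hη₂ : 0 < η₂) (hηΘ₂ : η₂ ≤ Θ)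
    (hvar₂ : 2 * A₂ * (16000 * (256 : ℝ) ^ d * Θ ^ 2 * mixFactor K r) ≤ n₀ * η₂ ^ 2)
    (htail₂ : 260 * (8 : ℝ) ^ d * Θ * (1 + 1 / Real.log r) * (2 * A₂) ^ (2 + 2 * d) ≤ n₀ * η₂)
    {a : ℤ} (ha : 1 ≤ a) (ha' : a ≤ T) {M : ℤ → ℤ}
    (hM : ∀ t ∈ Finset.Ico a (a + m), (n₀ : ℤ) + 1 ≤ M t ∧ M t ≤ t) {b : ℤ → ℝ}
    (hb : ∀ t ∈ Finset.Ico a (a + m), |b t| ≤ 2) :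
    μ.real (badSet μ X T b (Finset.Ico a (a + m)) M (500 * (m * η₁)) (500 * η₂))
      ≤ 4 * Real.exp (-A₁) + m * (4 * Real.exp (-A₂)) := by
  -- Longer segments satisfy the conditions a fortiori, so it is enough to impose them for the
  -- shortest one. This is why only min 𝒩 occurs in the final bound.
  have mono₂ : ∀ n : ℕ, n₀ ≤ n →
      2 * A₂ * (16000 * (256 : ℝ) ^ d * Θ ^ 2 * mixFactor K r) ≤ n * η₂ ^ 2 ∧
      260 * (8 : ℝ) ^ d * Θ * (1 + 1 / Real.log r) * (2 * A₂) ^ (2 + 2 * d) ≤ n * η₂ := by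
    intro n hn
    have hn' : (n₀ : ℝ) ≤ n := by exact_mod_cast hn
    exact ⟨hvar₂.trans (by gcongr), htail₂.trans (by gcongr)⟩
  have c1 := measureReal_abs_sum_mul_ge_le hT hX hmix hmom hΘ hc hσ
    (I := Finset.Ico a (a + m)) (p := a) (k := 1) (n := m) subset_rfl zero_le_one le_rfl
    (fun t ht => by have := Finset.mem_Ico.1 ht; omega) (w := fun t => b t / 2)
    (fun t ht => by rw [abs_div, abs_two]; linarith [hb t ht]) hA₁ hη₁ hηΘ₁ hvar₁ htail₁
  have c2 := measureReal_abs_sum_mul_ge_le hT hX hmix hmom hΘ hc hσ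
    (I := Finset.Ico a (a + m)) (p := a) (k := 0) (n := m) subset_rfl le_rfl zero_le_one
    (fun t ht => by have := Finset.mem_Ico.1 ht; omega) (w := fun t => b t ^ 2 / 4)
    (fun t ht => by
      rw [abs_div, abs_pow]
      have h1 : |b t| ^ 2 ≤ 2 ^ 2 := pow_le_pow_left₀ (abs_nonneg _) (hb t ht) 2
      have h2 : |(4 : ℝ)| = 4 := by norm_num
      rw [h2]; linarith) hA₁ hη₁ hηΘ₁ hvar₁ htail₁
  have c3 : ∀ t ∈ Finset.Ico a (a + m),
      μ.real {ω | M t * (500 * η₂) ≤ |∑ l ∈ Finset.Ico (t - M t + 1) (t + 1),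
        (X T l ω * X T l ω - ∫ ω, X T l ω * X T l ω ∂μ)|} ≤ 2 * Real.exp (-A₂) := by
    intro t ht
    have ht1 := Finset.mem_Ico.1 ht
    have hMt := hM t ht
    obtain ⟨n, hn⟩ : ∃ n : ℕ, (n : ℤ) = M t := ⟨(M t).toNat, by omega⟩
    have hm2 := mono₂ n (by omega)
    have := measureReal_abs_sum_mul_ge_le hT hX hmix hmom hΘ hc hσ
      (I := Finset.Ico (t - M t + 1) (t + 1)) (p := t - M t + 1) (k := 0) (n := n)
      (Finset.Ico_subset_Ico_right (by omega)) le_rfl zero_le_one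
      (fun l hl => by have := Finset.mem_Ico.1 hl; omega) (w := fun _ => 1)
      (fun _ _ => by simp) hA₂ hη₂ hηΘ₂ hm2.1 hm2.2
    have e : (M t : ℝ) * (500 * η₂) = 500 * (n * η₂) := by
      rw [← hn]; push_cast; ring
    simp only [add_zero, one_mul] at this
    rw [e]
    exact this
  have c4 : ∀ t ∈ Finset.Ico a (a + m),
      μ.real {ω | ((M t : ℝ) - 1) * (500 * η₂) ≤ |∑ l ∈ Finset.Ico (t - M t + 1) t,
        (X T l ω * X T (l + 1) ω - ∫ ω, X T l ω * X T (l + 1) ω ∂μ)|}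
        ≤ 2 * Real.exp (-A₂) := by
    intro t ht
    have ht1 := Finset.mem_Ico.1 ht
    have hMt := hM t ht
    obtain ⟨n, hn⟩ : ∃ n : ℕ, (n : ℤ) + 1 = M t := ⟨(M t - 1).toNat, by omega⟩
    have hm2 := mono₂ n (by omega)
    have := measureReal_abs_sum_mul_ge_le hT hX hmix hmom hΘ hc hσ
      (I := Finset.Ico (t - M t + 1) t) (p := t - M t + 1) (k := 1) (n := n)
      (Finset.Ico_subset_Ico_right (by omega)) zero_le_one le_rfl
      (fun l hl => by have := Finset.mem_Ico.1 hl; omega) (w := fun _ => 1)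
      (fun _ _ => by simp) hA₂ hη₂ hηΘ₂ hm2.1 hm2.2
    have e : ((M t : ℝ) - 1) * (500 * η₂) = 500 * (n * η₂) := by
      rw [← hn]; push_cast; ring
    simp only [one_mul] at this
    rw [e]
    exact this
  simp only [add_zero] at c2
  have c5 : μ.real (⋃ t ∈ Finset.Ico a (a + m),
      ({ω | M t * (500 * η₂) ≤ |∑ l ∈ Finset.Ico (t - M t + 1) (t + 1),
        (X T l ω * X T l ω - ∫ ω, X T l ω * X T l ω ∂μ)|} ∪
      {ω | ((M t : ℝ) - 1) * (500 * η₂) ≤ |∑ l ∈ Finset.Ico (t - M t + 1) t,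
        (X T l ω * X T (l + 1) ω - ∫ ω, X T l ω * X T (l + 1) ω ∂μ)|}))
      ≤ m * (4 * Real.exp (-A₂)) := by
    refine (measureReal_biUnion_finset_le _ _).trans ?_
    refine (Finset.sum_le_card_nsmul _ _ (4 * Real.exp (-A₂)) fun t ht => ?_).trans ?_
    · exact (measureReal_union_le _ _).trans (by linarith [c3 t ht, c4 t ht])
    · simp
  unfold badSet
  refine (measureReal_union_le _ _).trans (add_le_add ?_ c5)
  exact (measureReal_union_le _ _).trans (by linarith)

/-- The two unweighted sums over the block are common to both forecasts, the rest is counted once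
for each: 12 = 2 + 2 + 4 + 4 and 8m = 4m + 4m. -/
theorem measureReal_not_lt_le {f : ℝ → ℝ → ℝ} {mf Mf Mf' C K r c d Θ A₁ η₁ A₂ η₂ δ : ℝ}
    {T m n₀ N : ℕ} (hT : 1 ≤ T) (hm : 1 ≤ m)
    (hX : ∀ t, Measurable (X T t)) (hmix : IsGeometricallyMixing μ X K r)
    (hmom : BernsteinCondition μ X m c d) (hΘ : 0 < Θ) (hc : c ^ 2 ≤ Θ)
    (hσ : ∀ t : ℤ, 1 ≤ t → t ≤ (T : ℤ) + m → variance (X T t) μ ≤ Θ)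
    (h : IsLocalSpectralDensity f) (hb : SpectralBounds f mf Mf) (hd : SpectralDerivBound f Mf')
    (hC : 0 ≤ C)
    (h1 : ∀ l, |∫ ω, X T l ω * X T (l + 1) ω ∂μ|
      ≤ (∫ ω, X T l ω * X T l ω ∂μ + ∫ ω, X T (l + 1) ω * X T (l + 1) ω ∂μ) / 2)
    (hlow : ∀ l, 6 * mf ≤ ∫ ω, X T l ω * X T l ω ∂μ)
    (hup : ∀ l, ∫ ω, X T l ω * X T l ω ∂μ ≤ 3 * Real.pi * Mf)
    (he0 : ∀ l : ℤ, |∫ ω, X T l ω * X T l ω ∂μ - localCov f 0 (l / (T : ℝ))| ≤ C / T)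
    (he1 : ∀ l : ℤ, |∫ ω, X T l ω * X T (l + 1) ω ∂μ - localCov f 1 ((l + 1 : ℤ) / (T : ℝ))|
      ≤ C / T)
    (hA₁ : 10 / 3 ≤ A₁) (hη₁ : 0 < η₁) (hηΘ₁ : η₁ ≤ Θ)
    (hvar₁ : 2 * A₁ * (16000 * (256 : ℝ) ^ d * Θ ^ 2 * mixFactor K r) ≤ m * η₁ ^ 2)
    (htail₁ : 260 * (8 : ℝ) ^ d * Θ * (1 + 1 / Real.log r) * (2 * A₁) ^ (2 + 2 * d) ≤ m * η₁)
    (hA₂ : 10 / 3 ≤ A₂) (hη₂ : 0 < η₂) (hηΘ₂ : η₂ ≤ Θ)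
    (hvar₂ : 2 * A₂ * (16000 * (256 : ℝ) ^ d * Θ ^ 2 * mixFactor K r) ≤ n₀ * η₂ ^ 2)
    (htail₂ : 260 * (8 : ℝ) ^ d * Θ * (1 + 1 / Real.log r) * (2 * A₂) ^ (2 + 2 * d) ≤ n₀ * η₂)
    {a : ℤ} (ha : (T : ℤ) - m ≤ a) (ha' : a ≤ T) (hN : 2 ≤ N) (hNT : N + m + 1 ≤ T)
    (hn₀ : n₀ + 1 ≤ N)
    (hρ : rhoSup f T m < 1) (hδ : 2 * DSup f T m ^ 2 / (1 - rhoSup f T m ^ 2) ≤ δ)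
    (hgap : 10 * Real.pi * Mf
        * (3 * (C / T + 2 * Real.pi * Mf' * (4 * m / T)) / (2 * Real.pi * mf))
      + (2 + δ) * (9 * (500 * η₁) + 6 * (3 * (500 * η₂) / (6 * mf)) * (3 * Real.pi * Mf + 500 * η₁)
          + 9 * (C / T + 2 * Real.pi * Mf' * (m / T)))
      < δ * Real.pi * mf * (1 - rhoSup f T m ^ 2)) :
    μ.real {ω | ¬ (∑ t ∈ Finset.Ico a (a + m),
          (X T (t + 1) ω - forecastS (fun t => X T t ω) t) ^ 2
        < (1 + δ) * ∑ t ∈ Finset.Ico a (a + m),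
          (X T (t + 1) ω - forecastLS (fun t => X T t ω) N t) ^ 2)}
      ≤ 12 * Real.exp (-A₁) + 8 * m * Real.exp (-A₂) := by
  set e₀ : ℤ → ℝ := fun l => ∫ ω, X T l ω * X T l ω ∂μ with he₀
  set e₁ : ℤ → ℝ := fun l => ∫ ω, X T l ω * X T (l + 1) ω ∂μ with he₁
  have h0 : ∀ l, 0 ≤ e₀ l := fun l => integral_nonneg fun ω => mul_self_nonneg _
  set J : Finset ℤ := Finset.Ico a (a + m) with hJ
  have hM : ∀ M : ℤ → ℤ, (M = fun t => t) ∨ (M = fun _ => (N : ℤ)) →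
      ∀ t ∈ J, (2 : ℤ) ≤ M t ∧ (n₀ : ℤ) + 1 ≤ M t ∧ M t ≤ t := by
    intro M hM t ht
    have ht1 := Finset.mem_Ico.1 ht
    rcases hM with rfl | rfl <;> simp only <;> omega
  set B : (ℤ → ℤ) → Set Ω := fun M =>
    badSet μ X T (fun t => arRatio e₀ e₁ (M t) t) J M (500 * (m * η₁)) (500 * η₂) with hB
  have hBM : ∀ M : ℤ → ℤ, (M = fun t => t) ∨ (M = fun _ => (N : ℤ)) →
      μ.real (B M) ≤ 4 * Real.exp (-A₁) + m * (4 * Real.exp (-A₂)) := fun M hM' =>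
    measureReal_badSet_le hT hX hmix hmom hΘ hc hσ hA₁ hη₁ hηΘ₁ hvar₁ htail₁ hA₂ hη₂ hηΘ₂ hvar₂
      htail₂ (by omega) ha' (fun t ht => (hM M hM' t ht).2)
      fun t ht => abs_arRatio_le_two h0 h1 (hM M hM' t ht).1 t
  set S₁ : Set Ω := {ω | 500 * (m * η₁) ≤
    |∑ t ∈ J, (X T (t + 1) ω * X T (t + 1) ω - e₀ (t + 1))|} with hS₁
  set S₂ : Set Ω := {ω | 500 * (m * η₁) ≤ |∑ t ∈ J, (X T t ω * X T t ω - e₀ t)|} with hS₂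
  have hS₁le : μ.real S₁ ≤ 2 * Real.exp (-A₁) := by
    have := measureReal_abs_sum_mul_ge_le hT hX hmix hmom hΘ hc hσ
      (I := Finset.Ico (a + 1) (a + m + 1)) (p := a + 1) (k := 0) (n := m)
      (Finset.Ico_subset_Ico_right (by omega)) le_rfl zero_le_one
      (fun t ht => by have := Finset.mem_Ico.1 ht; omega) (w := fun _ => 1)
      (fun _ _ => by simp) hA₁ hη₁ hηΘ₁ hvar₁ htail₁
    simp only [add_zero, one_mul] at this
    refine le_trans (le_of_eq ?_) this
    congr 1
    ext ω
    simp only [hS₁, Set.mem_ofPred_eq]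
    rw [hJ, Finset.sum_Ico_add' (fun t => X T t ω * X T t ω - e₀ t) a (a + m) 1]
  have hS₂le : μ.real S₂ ≤ 2 * Real.exp (-A₁) := by
    have := measureReal_abs_sum_mul_ge_le hT hX hmix hmom hΘ hc hσ
      (I := J) (p := a) (k := 0) (n := m) subset_rfl le_rfl zero_le_one
      (fun t ht => by have := Finset.mem_Ico.1 ht; omega) (w := fun _ => 1)
      (fun _ _ => by simp) hA₁ hη₁ hηΘ₁ hvar₁ htail₁
    simp only [add_zero, one_mul] at this
    exact this
  have hsub : {ω | ¬ (∑ t ∈ J, (X T (t + 1) ω - forecastS (fun t => X T t ω) t) ^ 2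
        < (1 + δ) * ∑ t ∈ J, (X T (t + 1) ω - forecastLS (fun t => X T t ω) N t) ^ 2)}
      ⊆ (S₁ ∪ S₂) ∪ (B (fun t => t) ∪ B (fun _ => (N : ℤ))) := by
    intro ω hω
    by_contra hcon
    simp only [Set.mem_union, not_or] at hcon
    obtain ⟨⟨k1, k2⟩, k3, k4⟩ := hcon
    refine hω ?_
    have e : 500 * (m * η₁) = m * (500 * η₁) := by ring
    simp only [hS₁, hS₂, Set.mem_ofPred_eq, not_le] at k1 k2
    rw [e] at k1 k2
    refine sum_sq_forecast_lt (x := fun t => X T t ω) h hb hd hT hm h0 h1 hlow hup he0 he1 hC ha ha'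
      hN hNT (x₂ := 500 * η₂) (by positivity) k1.le k2.le ?_ hρ hδ hgap
    intro M hM'
    have k5 : ω ∉ B M := by rcases hM' with rfl | rfl <;> assumption
    simp only [hB, badSet, Set.mem_union, Set.mem_iUnion, Set.mem_ofPred_eq, not_or, not_exists,
      not_le] at k5
    obtain ⟨⟨k6, k7⟩, k8⟩ := k5
    rw [e] at k6 k7
    exact ⟨k6.le, k7.le, fun t ht => ⟨(k8 t ht).1.le, (k8 t ht).2.le⟩⟩
  have b1 := hBM (fun t => t) (Or.inl rfl)
  have b2 := hBM (fun _ => (N : ℤ)) (Or.inr rfl)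
  calc _ ≤ _ := measureReal_mono hsub
    _ ≤ _ := measureReal_union_le _ _
    _ ≤ (μ.real S₁ + μ.real S₂) + (μ.real (B fun t => t) + μ.real (B fun _ => (N : ℤ))) :=
        add_le_add (measureReal_union_le _ _) (measureReal_union_le _ _)
    _ ≤ _ := by linarith

end Union

/-- Solving a Bernstein-type exponent for its scale. -/
theorem bounds_of_exponent_eq {A x H B q : ℝ} (hq : 0 < q) (hx : 0 ≤ x) (hH : 0 < H) (hB : 0 < B)
    (hA : 0 < A) (h : A = x ^ 2 / (2 * (H + x ^ (2 - q) * B ^ q))) :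
    0 < x ∧ 2 * A * H ≤ x ^ 2 ∧ (2 * A) ^ (1 / q) * B ≤ x := by
  have hx0 : 0 < x := by
    rcases hx.lt_or_eq with h0 | h0
    · exact h0
    · rw [← h0] at h
      simp at h
      exact absurd h hA.ne'
  have hp : 0 < x ^ (2 - q) * B ^ q := by positivity
  -- Both summands are nonnegative, so each of them times 2A is at most x². Cancelling x^{2-q} in
  -- the second one bounds the tail term.
  have h2 : 2 * A * (H + x ^ (2 - q) * B ^ q) = x ^ 2 := by
    rw [h]
    field_simp
  refine ⟨hx0, by nlinarith, ?_⟩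
  have h3 : x ^ 2 = x ^ (2 - q) * x ^ q := by
    rw [← Real.rpow_add hx0, sub_add_cancel]
    norm_cast
  have h4 : 2 * A * B ^ q ≤ x ^ q := by
    have h5 : x ^ (2 - q) * (2 * A * B ^ q) ≤ x ^ (2 - q) * x ^ q := by
      rw [← h3]
      nlinarith
    exact le_of_mul_le_mul_left h5 (by positivity)
  have h6 := Real.rpow_le_rpow (by positivity) h4 (show 0 ≤ 1 / q by positivity)
  rw [Real.mul_rpow (by positivity) (by positivity), ← Real.rpow_mul hB.le,
    ← Real.rpow_mul hx0.le, mul_one_div_cancel hq.ne', Real.rpow_one, Real.rpow_one] at h6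
  exact h6

theorem rpow_le_rpow_base_of_half_le {b s d : ℝ} (hs : 0 ≤ s) (hb : 1 ≤ b) (hsb : s ^ 2 ≤ b)
    (hd : 1 / 2 ≤ d) : s ≤ b ^ d := by
  calc s = √(s ^ 2) := (Real.sqrt_sq hs).symm
    _ ≤ √b := Real.sqrt_le_sqrt hsb
    _ = b ^ (1 / 2 : ℝ) := Real.sqrt_eq_rpow b
    _ ≤ b ^ d := Real.rpow_le_rpow_of_exponent_le hb hd

/-! ### Comparison with the constants of the bound -/

section Constants

variable {Mf c d K r : ℝ}

/-- The constant 16000 of the concentration inequality lies just below 12 · 2⁹ · e. -/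
theorem le_Cbar1_one (hr : 1 < r) :
    16000 * (256 : ℝ) ^ d * (max 1 (max (c ^ 2) (3 * Real.pi * Mf))) ^ 2 * mixFactor K r
      ≤ Cbar1 Mf c d K r 1 := by
  have hL : 0 < Real.log r := Real.log_pos hr
  have he := Real.exp_one_gt_d9
  set Θ := max 1 (max (c ^ 2) (3 * Real.pi * Mf))
  have h2 : (2 : ℝ) ^ (8 * ((1 : ℕ) : ℝ) * d + 9) = 512 * 256 ^ d := by
    rw [Real.rpow_add (by norm_num), Nat.cast_one, mul_one, Real.rpow_mul (by norm_num)]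
    norm_num
    ring
  have hP : 0 ≤ (256 : ℝ) ^ d * Θ ^ 2 * mixFactor K r := by
    unfold mixFactor
    positivity
  have : Cbar1 Mf c d K r 1 = 6144 * Real.exp 1 * ((256 : ℝ) ^ d * Θ ^ 2 * mixFactor K r) := by
    unfold Cbar1 mixFactor
    rw [h2]
    simp only [Nat.factorial_one, Nat.cast_one, Real.one_rpow]
    ring
  rw [this]
  nlinarith

/-- The additional powers for a = 2 leave 4096^d ≥ 64. The factor 64 is spent on dividing the
deviation level by 8. -/
theorem le_Cbar1_two (hr : 1 < r) (hd : 1 / 2 ≤ d) :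
    64 * (16000 * (256 : ℝ) ^ d * (max 1 (max (c ^ 2) (3 * Real.pi * Mf))) ^ 2 * mixFactor K r)
      ≤ Cbar1 Mf c d K r 2 := by
  have hL : 0 < Real.log r := Real.log_pos hr
  have he := Real.exp_one_gt_d9
  set Θ := max 1 (max (c ^ 2) (3 * Real.pi * Mf))
  have hΘ : 1 ≤ Θ := le_max_left _ _
  have h2 : (2 : ℝ) ^ (8 * ((2 : ℕ) : ℝ) * d + 9) * (2 : ℝ) ^ (4 * d)
      = 512 * (256 ^ d * 4096 ^ d) := by
    rw [← Real.mul_rpow (by norm_num) (by norm_num), ← Real.rpow_add (by norm_num),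
      show 8 * ((2 : ℕ) : ℝ) * d + 9 + 4 * d = 20 * d + 9 by push_cast; ring,
      Real.rpow_add (by norm_num), Real.rpow_mul (by norm_num)]
    norm_num
    ring
  have h3 : (64 : ℝ) ≤ 4096 ^ d := rpow_le_rpow_base_of_half_le (by norm_num) (by norm_num)
    (by norm_num) hd
  have hM : 0 ≤ (256 : ℝ) ^ d * mixFactor K r := by
    unfold mixFactor
    positivity
  have : Cbar1 Mf c d K r 2
      = 6144 * Real.exp 1 * 4096 ^ d * Θ ^ 4 * ((256 : ℝ) ^ d * mixFactor K r) := by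
    unfold Cbar1 mixFactor
    simp only [Nat.factorial_two]
    rw [mul_assoc 12, show ((2 : ℕ) : ℝ) ^ (4 * d) = (2 : ℝ) ^ (4 * d) by norm_num, h2]
    ring
  rw [this]
  have h4 : Θ ^ 2 ≤ Θ ^ 4 := pow_le_pow_right₀ hΘ (by norm_num)
  calc 64 * (16000 * (256 : ℝ) ^ d * Θ ^ 2 * mixFactor K r)
      = 16000 * 64 * Θ ^ 2 * ((256 : ℝ) ^ d * mixFactor K r) := by ring
    _ ≤ 6144 * Real.exp 1 * 4096 ^ d * Θ ^ 4 * ((256 : ℝ) ^ d * mixFactor K r) := by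
        gcongr
        linarith

/-- The constant 260 of the concentration inequality lies just below 96e. -/
theorem le_Cbar2_one (hr : 1 < r) :
    260 * (8 : ℝ) ^ d * max 1 (max (c ^ 2) (3 * Real.pi * Mf)) * (1 + 1 / Real.log r)
      ≤ Cbar2 Mf c d r 1 := by
  have hL : 0 < Real.log r := Real.log_pos hr
  have he := Real.exp_one_gt_d9
  set Θ := max 1 (max (c ^ 2) (3 * Real.pi * Mf))
  have hΘ : 1 ≤ Θ := le_max_left _ _
  have h2 : (2 : ℝ) ^ (3 * (((1 : ℕ) : ℝ) * d + 1)) = 8 * 8 ^ d := by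
    rw [Nat.cast_one, one_mul, mul_add, Real.rpow_add (by norm_num), Real.rpow_mul (by norm_num)]
    norm_num
    ring
  have hP : 0 ≤ (8 : ℝ) ^ d * Θ * (1 + 1 / Real.log r) := by positivity
  have : Cbar2 Mf c d r 1 = 96 * Real.exp 1 * ((8 : ℝ) ^ d * Θ * (1 + 1 / Real.log r)) := by
    unfold Cbar2
    rw [h2]
    simp only [Nat.factorial_one, Nat.cast_one, Real.one_rpow, pow_one]
    ring
  rw [this]
  nlinarith

theorem le_Cbar2_two (hr : 1 < r) (hd : 1 / 2 ≤ d) :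
    2 * (260 * (8 : ℝ) ^ d * max 1 (max (c ^ 2) (3 * Real.pi * Mf)) * (1 + 1 / Real.log r))
      ≤ Cbar2 Mf c d r 2 := by
  have hL : 0 < Real.log r := Real.log_pos hr
  have he := Real.exp_one_gt_d9
  set Θ := max 1 (max (c ^ 2) (3 * Real.pi * Mf))
  have hΘ : 1 ≤ Θ := le_max_left _ _
  have h2 : (2 : ℝ) ^ (3 * (((2 : ℕ) : ℝ) * d + 1)) * (2 : ℝ) ^ (2 * d) = 8 * (8 ^ d * 32 ^ d) := by
    rw [← Real.mul_rpow (by norm_num) (by norm_num), ← Real.rpow_add (by norm_num),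
      show 3 * (((2 : ℕ) : ℝ) * d + 1) + 2 * d = 8 * d + 3 by push_cast; ring,
      Real.rpow_add (by norm_num), Real.rpow_mul (by norm_num)]
    norm_num
    ring
  have h3 : (2 : ℝ) ≤ 32 ^ d := rpow_le_rpow_base_of_half_le (by norm_num) (by norm_num)
    (by norm_num) hd
  have : Cbar2 Mf c d r 2
      = 96 * Real.exp 1 * 32 ^ d * Θ ^ 2 * ((8 : ℝ) ^ d * (1 + 1 / Real.log r)) := by
    unfold Cbar2
    simp only [Nat.factorial_two]
    rw [mul_assoc 12, show ((2 : ℕ) : ℝ) ^ (2 * d) = (2 : ℝ) ^ (2 * d) by norm_num, h2]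
    ring
  rw [this]
  have h4 : Θ ≤ Θ ^ 2 := le_self_pow₀ hΘ (by norm_num)
  calc 2 * (260 * (8 : ℝ) ^ d * Θ * (1 + 1 / Real.log r))
      = 260 * 2 * Θ * ((8 : ℝ) ^ d * (1 + 1 / Real.log r)) := by ring
    _ ≤ 96 * Real.exp 1 * 32 ^ d * Θ ^ 2 * ((8 : ℝ) ^ d * (1 + 1 / Real.log r)) := by
        gcongr
        linarith

end Constants

/-- The conditions on the deviation level for the squared forecast errors. -/
theorem block_conditions_of_exponent {g m x A W V C₁ C₂ d : ℝ} (hg : 0 < g) (hm : 0 < m)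
    (hA : 10 / 3 ≤ A) (hd : 1 / 2 ≤ d) (hV : 0 ≤ V) (hW : 64 * W ≤ C₁) (hVC : 2 * V ≤ C₂)
    (h1 : 2 * A * (g ^ 4 * (C₁ / m)) ≤ x ^ 2)
    (h2 : (2 * A) ^ (2 + 4 * d) * (g ^ 2 * (C₂ / m)) ≤ x) :
    2 * A * W ≤ m * (x / (8 * g ^ 2)) ^ 2 ∧
      V * (2 * A) ^ (2 + 2 * d) ≤ m * (x / (8 * g ^ 2)) := by
  have hA0 : 0 < A := by linarith
  constructor
  · have e1 : 2 * A * (g ^ 4 * (C₁ / m)) = 2 * A * g ^ 4 * C₁ / m := by ring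
    rw [e1, div_le_iff₀ hm] at h1
    have e2 : m * (x / (8 * g ^ 2)) ^ 2 = x ^ 2 * m / (64 * g ^ 4) := by
      field_simp
      ring
    rw [e2, le_div_iff₀ (by positivity)]
    calc 2 * A * W * (64 * g ^ 4) = 2 * A * g ^ 4 * (64 * W) := by ring
      _ ≤ 2 * A * g ^ 4 * C₁ := by gcongr
      _ ≤ x ^ 2 * m := h1
  · have e1 : (2 * A) ^ (2 + 4 * d) * (g ^ 2 * (C₂ / m))
        = (2 * A) ^ (2 + 4 * d) * g ^ 2 * C₂ / m := by ring
    rw [e1, div_le_iff₀ hm] at h2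
    have e2 : m * (x / (8 * g ^ 2)) = x * m / (8 * g ^ 2) := by ring
    rw [e2, le_div_iff₀ (by positivity)]
    -- The exponent 2 + 4d of the bound exceeds the 2 + 2d needed by the concentration inequality.
    -- The surplus (2A)^{2d} ≥ 2A pays for the smaller level.
    have h3 : 4 * (2 * A) ^ (2 + 2 * d) ≤ (2 * A) ^ (2 + 4 * d) := by
      rw [show 2 + 4 * d = 2 * d + (2 + 2 * d) by ring,
        Real.rpow_add (by positivity) (2 * d)]
      gcongr
      calc (4 : ℝ) ≤ (2 * A) ^ (1 : ℝ) := by rw [Real.rpow_one]; linarith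
        _ ≤ (2 * A) ^ (2 * d) := Real.rpow_le_rpow_of_exponent_le (by linarith) (by linarith)
    calc V * (2 * A) ^ (2 + 2 * d) * (8 * g ^ 2)
        = 4 * (2 * A) ^ (2 + 2 * d) * g ^ 2 * (2 * V) := by ring
      _ ≤ (2 * A) ^ (2 + 4 * d) * g ^ 2 * C₂ := by gcongr
      _ ≤ x * m := h2

/-- Since exp(10/3) < 42, checked by cubing. The 42 is 6 · 7, the factor of the first exponential in
6P. -/
theorem ten_thirds_le_of_mul_exp_lt {A : ℝ} (h : 42 * Real.exp (-A) < 1) : 10 / 3 ≤ A := by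
  by_contra! hA
  have h1 : Real.exp A ^ 3 < 42 ^ 3 := by
    have he := Real.exp_one_lt_d9
    calc Real.exp A ^ 3 = Real.exp (3 * A) := by rw [← Real.exp_nat_mul]; norm_num
      _ ≤ Real.exp (10 : ℕ) := Real.exp_le_exp.2 (by push_cast; linarith)
      _ = Real.exp 1 ^ 10 := by rw [← Real.exp_nat_mul]; norm_num
      _ < 2.7182818286 ^ 10 := by gcongr
      _ < 42 ^ 3 := by norm_num
  have h2 : Real.exp A < 42 := lt_of_pow_lt_pow_left₀ 3 (by norm_num) h1
  rw [Real.exp_neg, ← div_eq_mul_inv, div_lt_one (Real.exp_pos A)] at h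
  linarith

/-! ### Bounds for the auxiliary quantities ε̄, μ and η -/

section Levels

variable {mf Mf c d ε : ℝ}

theorem five_halves_mul_le_C0 (hmf : 0 < mf) (hM : mf ≤ Mf) : 5 / 2 * Mf ≤ C0 mf Mf * mf := by
  have h1 : (5 / 2 : ℝ) ≤ √(2 * Real.pi) :=
    Real.le_sqrt_of_sq_le (by linarith [Real.pi_gt_d2])
  unfold C0
  rw [div_mul_cancel₀ _ hmf.ne']
  have : 0 < Mf := by linarith
  gcongr

/-- By `hY` the fourth root in the denominator is at least 10 mf, so ε̄ is linear in ε; 80 = 4 · 2 ·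
10. -/
theorem epsBar_le (hε : 0 ≤ ε) (hmf : 0 < mf)
    (hY : 100 * mf ^ 2 ≤ 6 * Real.pi * Mf * c ^ 2 * (24 : ℝ) ^ d) :
    epsBar 1 Mf c d ε ≤ ε / (80 * mf) := by
  unfold epsBar
  set Y := 6 * Real.pi * Mf * c ^ 2 * (24 : ℝ) ^ d
  have h1 : 10 * mf ≤ (Y ^ 2 + ε ^ 2 / (((1 : ℕ) : ℝ) + 1) ^ 4) ^ ((1 : ℝ) / 4) := by
    have h2 : (10 * mf) ^ (4 : ℕ) ≤ Y ^ 2 + ε ^ 2 / (((1 : ℕ) : ℝ) + 1) ^ 4 := by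
      have : (10 * mf) ^ 4 = (100 * mf ^ 2) ^ 2 := by ring
      rw [this]
      have : (100 * mf ^ 2) ^ 2 ≤ Y ^ 2 := by gcongr
      have : 0 ≤ ε ^ 2 / (((1 : ℕ) : ℝ) + 1) ^ 4 := by positivity
      linarith
    calc 10 * mf = ((10 * mf) ^ (4 : ℕ)) ^ ((1 : ℝ) / 4) := by
          rw [← Real.rpow_natCast, ← Real.rpow_mul (by positivity)]
          norm_num
      _ ≤ _ := Real.rpow_le_rpow (by positivity) h2 (by norm_num)
  calc _ ≤ (ε / (((1 : ℕ) : ℝ) + 1) ^ 2) / (2 * (10 * mf)) := by gcongr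
    _ = ε / (80 * mf) := by
        push_cast
        field_simp
        ring

theorem epsBar_nonneg (hε : 0 ≤ ε) : 0 ≤ epsBar 1 Mf c d ε := by
  unfold epsBar
  positivity

theorem muAux_le (hz : 0 ≤ C0 mf Mf) (hε : 0 ≤ ε) :
    muAux 1 1 mf Mf c d ε ≤ epsBar 1 Mf c d ε / (2 * (2 * C0 mf Mf + 1)) := by
  have h0 := epsBar_nonneg (Mf := Mf) (c := c) (d := d) hε
  unfold muAux
  have : 2 * C0 mf Mf + 1 ≤ √((2 * C0 mf Mf + 1) ^ (2 * 1) + epsBar 1 Mf c d ε) :=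
    Real.le_sqrt_of_sq_le (by rw [mul_one]; linarith)
  gcongr

theorem muAux_nonneg (hε : 0 ≤ ε) : 0 ≤ muAux 1 1 mf Mf c d ε := by
  have h0 := epsBar_nonneg (Mf := Mf) (c := c) (d := d) hε
  unfold muAux
  positivity

theorem etaAux_one_one : etaAux 1 1 mf Mf c d ε = mf / 4 *
    min 1 (muAux 1 1 mf Mf c d ε / (muAux 1 1 mf Mf c d ε + 1) / (8 * C0 mf Mf)) := by
  simp [etaAux, muBar]

theorem etaAux_nonneg (hmf : 0 ≤ mf) (hz : 0 ≤ C0 mf Mf) (hε : 0 ≤ ε) :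
    0 ≤ etaAux 1 1 mf Mf c d ε := by
  have := muAux_nonneg (mf := mf) (Mf := Mf) (c := c) (d := d) hε
  rw [etaAux_one_one]
  positivity

theorem etaAux_le_quarter (hmf : 0 ≤ mf) : etaAux 1 1 mf Mf c d ε ≤ mf / 4 := by
  rw [etaAux_one_one]
  exact mul_le_of_le_one_right (by positivity) (min_le_left _ _)

/-- The bounds for μ and ε̄ are chained; 5120 = 4 · 8 · 2 · 80. -/
theorem etaAux_le (hmf : 0 < mf) (hz : 0 < C0 mf Mf) (hε : 0 ≤ ε)
    (hY : 100 * mf ^ 2 ≤ 6 * Real.pi * Mf * c ^ 2 * (24 : ℝ) ^ d) :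
    etaAux 1 1 mf Mf c d ε ≤ ε / (5120 * C0 mf Mf * (2 * C0 mf Mf + 1)) := by
  have h0 := muAux_nonneg (mf := mf) (Mf := Mf) (c := c) (d := d) hε
  rw [etaAux_one_one]
  calc _ ≤ mf / 4 * (muAux 1 1 mf Mf c d ε / (muAux 1 1 mf Mf c d ε + 1) / (8 * C0 mf Mf)) := by
        gcongr
        exact min_le_right _ _
    _ ≤ mf / 4 * (muAux 1 1 mf Mf c d ε / (8 * C0 mf Mf)) := by
        gcongr
        exact div_le_self h0 (by linarith)
    _ ≤ mf / 4 * (ε / (80 * mf) / (2 * (2 * C0 mf Mf + 1)) / (8 * C0 mf Mf)) := by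
        gcongr
        refine (muAux_le hz.le hε).trans ?_
        gcongr
        exact epsBar_le hε hmf hY
    _ = ε / (5120 * C0 mf Mf * (2 * C0 mf Mf + 1)) := by
        field_simp
        ring

end Levels

/-- The error terms are dominated by the gap. -/
theorem total_error_lt_gap {mf Mf z ε δ u v η₁ η₂ : ℝ} (hmf : 0 < mf) (hM : mf ≤ Mf)
    (hz : 5 / 2 * Mf ≤ z * mf) (hε : 0 < ε) (hεm : ε ≤ Real.pi * mf / 20) (hδ : 0 ≤ δ)
    (hu : u ≤ ε / (96 * z ^ 3)) (hv : v ≤ ε / (6 * z ^ 3)) (hv0 : 0 ≤ v) (hu0 : 0 ≤ u)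
    (hη₁ : η₁ = ε / (64 * (2 * z + 1) ^ 2)) (hη₂ : η₂ ≤ ε / (5120 * z * (2 * z + 1))) :
    10 * Real.pi * Mf * (3 * (u + 8 * Real.pi * v) / (2 * Real.pi * mf))
      + (2 + δ) * (9 * (500 * η₁) + 6 * (3 * (500 * η₂) / (6 * mf)) * (3 * Real.pi * Mf + 500 * η₁)
          + 9 * (u + 2 * Real.pi * v))
      < 20 * (1 + δ) * ε := by
  have hpi := Real.pi_pos
  have hpi1 := Real.pi_lt_d2
  have hMf : 0 < Mf := by linarith
  have hz1 : 5 / 2 ≤ z := by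
    by_contra! h
    nlinarith
  have hz2 : (25 / 4 : ℝ) ≤ z ^ 2 := by nlinarith
  have hz3 : (125 / 8 : ℝ) ≤ z ^ 3 := by nlinarith
  have hR : Mf / mf ≤ z / (5 / 2) := by
    rw [div_le_div_iff₀ hmf (by norm_num)]
    linarith
  -- The ratio Mf/mf costs one power of z = C₀, while the condition on T supplies z⁻³.
  have t1 : 10 * Real.pi * Mf * (3 * (u + 8 * Real.pi * v) / (2 * Real.pi * mf)) ≤ 5 * ε := by
    have e : 10 * Real.pi * Mf * (3 * (u + 8 * Real.pi * v) / (2 * Real.pi * mf))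
        = 15 * (Mf / mf) * (u + 8 * Real.pi * v) := by
      field_simp
      ring
    have h2 : u + 8 * Real.pi * v ≤ 5 * ε / z ^ 3 := by
      have h3 : 8 * Real.pi * v ≤ 8 * 3.15 * (ε / (6 * z ^ 3)) := by gcongr
      have h4 : ε / (96 * z ^ 3) + 8 * 3.15 * (ε / (6 * z ^ 3))
          = (1 / 96 + 4.2) * (ε / z ^ 3) := by
        field_simp
        norm_num
      have h5 : 5 * ε / z ^ 3 = 5 * (ε / z ^ 3) := by ring
      have h6 : 0 ≤ ε / z ^ 3 := by positivity
      rw [h5]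
      nlinarith
    rw [e]
    calc 15 * (Mf / mf) * (u + 8 * Real.pi * v) ≤ 15 * (z / (5 / 2)) * (5 * ε / z ^ 3) := by gcongr
      _ = 30 * ε / z ^ 2 := by
          field_simp
          ring
      _ ≤ 30 * ε / (25 / 4) := by gcongr
      _ ≤ 5 * ε := by linarith
  have hη₁' : η₁ ≤ ε / 2304 := by
    rw [hη₁]
    gcongr
    nlinarith
  have t2 : 6 * (3 * (500 * η₂) / (6 * mf)) * (3 * Real.pi * Mf + 500 * η₁) ≤ 0.3 * ε := by
    have h1 : 3 * Real.pi * Mf + 500 * η₁ ≤ 9.5 * Mf := by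
      have : 3 * Real.pi * Mf ≤ 3 * 3.1416 * Mf := by
        gcongr
        exact Real.pi_lt_d4.le
      have : Real.pi * mf ≤ 3.15 * mf := by gcongr
      linarith
    have h0 : 0 ≤ η₁ := by
      rw [hη₁]
      positivity
    calc 6 * (3 * (500 * η₂) / (6 * mf)) * (3 * Real.pi * Mf + 500 * η₁)
        ≤ 6 * (3 * (500 * (ε / (5120 * z * (2 * z + 1)))) / (6 * mf)) * (9.5 * Mf) := by gcongr
      _ = 14250 / 5120 * ε * (Mf / mf) / (z * (2 * z + 1)) := by
          field_simp
          norm_num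
      _ ≤ 14250 / 5120 * ε * (z / (5 / 2)) / (z * 6) := by
          gcongr
          linarith
      _ = 14250 / 76800 * ε := by
          field_simp
          norm_num
      _ ≤ 0.3 * ε := by linarith
  have t3 : u + 2 * Real.pi * v ≤ 0.07 * ε := by
    have h2 : u ≤ ε / (96 * (125 / 8)) := hu.trans (by gcongr)
    have h3 : v ≤ ε / (6 * (125 / 8)) := hv.trans (by gcongr)
    have h4 : 2 * Real.pi * v ≤ 2 * 3.15 * (ε / (6 * (125 / 8))) := by gcongr
    have h5 : ε / (96 * (125 / 8)) + 2 * 3.15 * (ε / (6 * (125 / 8))) ≤ 0.07 * ε := by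
      ring_nf
      linarith
    linarith
  have t4 : 9 * (500 * η₁) + 6 * (3 * (500 * η₂) / (6 * mf)) * (3 * Real.pi * Mf + 500 * η₁)
      + 9 * (u + 2 * Real.pi * v) ≤ 3 * ε := by linarith
  -- In total 5ε + (2 + δ) · 3ε = (11 + 3δ)ε, which is less than 20(1 + δ)ε.
  have t5 := mul_le_mul_of_nonneg_left t4 (show 0 ≤ 2 + δ by linarith)
  have : 0 ≤ δ * ε := by positivity
  linarith

/-! ### From sums of squares to error ratios, and the choice of levels -/

theorem sum_Ioc_eq_sum_Ico_succ (a b : ℤ) (F : ℤ → ℝ) :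
    ∑ s ∈ Finset.Ioc a b, F s = ∑ t ∈ Finset.Ico a b, F (t + 1) := by
  refine Finset.sum_nbij' (fun s => s - 1) (fun t => t + 1) ?_ ?_ ?_ ?_ ?_
  · intro s hs
    rw [Finset.mem_Ioc] at hs
    rw [Finset.mem_Ico]
    omega
  · intro s hs
    rw [Finset.mem_Ico] at hs
    rw [Finset.mem_Ioc]
    omega
  · intro s _
    ring
  · intro s _
    ring
  · intro s _
    rw [sub_add_cancel]

theorem empMSPE_eq (x g : ℤ → ℝ) (T m : ℕ) (j : ℤ) :
    empMSPE x g T m j = (1 / (m : ℝ)) *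
      ∑ t ∈ Finset.Ico ((T : ℤ) + (j - 3) * m) ((T : ℤ) + (j - 3) * m + m),
        (x (t + 1) - g t) ^ 2 := by
  unfold empMSPE block
  rw [sum_Ioc_eq_sum_Ico_succ, show (T : ℤ) + (j - 2) * m = (T : ℤ) + (j - 3) * m + m by ring]
  simp only [add_sub_cancel_right]

/-- The strict inequality forces a positive denominator, so the convention for division by zero does
not enter. -/
theorem ratioMSPE_lt_of_sum_lt {x : ℤ → ℝ} {T m N : ℕ} {j : ℤ} {δ : ℝ} (hm : 1 ≤ m) (hδ : 0 ≤ δ)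
    (h : ∑ t ∈ Finset.Ico ((T : ℤ) + (j - 3) * m) ((T : ℤ) + (j - 3) * m + m),
          (x (t + 1) - forecastS x t) ^ 2
        < (1 + δ) * ∑ t ∈ Finset.Ico ((T : ℤ) + (j - 3) * m) ((T : ℤ) + (j - 3) * m + m),
          (x (t + 1) - forecastLS x N t) ^ 2) :
    ratioMSPE x T m N j < 1 + δ := by
  have hm0 : (0 : ℝ) < m := by exact_mod_cast hm
  have h0 : 0 ≤ ∑ t ∈ Finset.Ico ((T : ℤ) + (j - 3) * m) ((T : ℤ) + (j - 3) * m + m),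
      (x (t + 1) - forecastS x t) ^ 2 := Finset.sum_nonneg fun _ _ => sq_nonneg _
  unfold ratioMSPE
  rw [empMSPE_eq, empMSPE_eq, mul_div_mul_left _ _ (by positivity), div_lt_iff₀ ?_]
  · exact h
  · exact pos_of_mul_pos_right (h0.trans_lt h) (by linarith)

/-- Only subadditivity is used, so S and the sets B i need not be measurable. -/
theorem one_sub_le_measureReal_of_cover {Ω ι : Type*} [MeasurableSpace Ω] (μ : Measure Ω)
    [IsProbabilityMeasure μ] {S : Set Ω} {s : Finset ι} {B : ι → Set Ω} {b : ℝ}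
    (h : ∀ ω, ω ∉ S → ∃ i ∈ s, ω ∈ B i) (hb : ∀ i ∈ s, μ.real (B i) ≤ b) :
    1 - s.card * b ≤ μ.real S := by
  have h1 : μ.real Set.univ ≤ μ.real (S ∪ ⋃ i ∈ s, B i) := by
    refine measureReal_mono (fun ω _ => ?_)
    by_cases hω : ω ∈ S
    · exact Or.inl hω
    · obtain ⟨i, hi, hωi⟩ := h ω hω
      exact Or.inr (Set.mem_biUnion hi hωi)
  have h2 : μ.real (⋃ i ∈ s, B i) ≤ s.card * b := by
    refine (measureReal_biUnion_finset_le s B).trans ?_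
    rw [← nsmul_eq_mul]
    exact Finset.sum_le_card_nsmul _ _ _ hb
  have h3 := measureReal_union_le (μ := μ) S (⋃ i ∈ s, B i)
  rw [probReal_univ] at h1
  linarith

theorem abs_integral_mul_le_half {Ω : Type*} [MeasurableSpace Ω] {μ : Measure Ω} {Y Z : Ω → ℝ}
    (hY : MemLp Y 2 μ) (hZ : MemLp Z 2 μ) :
    |∫ ω, Y ω * Z ω ∂μ| ≤ (∫ ω, Y ω * Y ω ∂μ + ∫ ω, Z ω * Z ω ∂μ) / 2 := by
  have hYY : Integrable (fun ω => Y ω * Y ω) μ := hY.integrable_mul hY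
  have hZZ : Integrable (fun ω => Z ω * Z ω) μ := hZ.integrable_mul hZ
  have hYZ : Integrable (fun ω => Y ω * Z ω) μ := hY.integrable_mul hZ
  rw [← integral_add hYY hZZ, ← integral_div]
  refine (abs_integral_le_integral_abs).trans ?_
  refine integral_mono hYZ.abs ((hYY.add hZZ).div_const 2) (fun ω => ?_)
  simp only
  rw [abs_le']
  constructor <;> nlinarith [sq_nonneg (Y ω - Z ω), sq_nonneg (Y ω + Z ω)]

theorem LocStat.IsLocallyStationary.abs_integral_mul_sub_le {Ω : Type*} [MeasurableSpace Ω]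
    {μ : Measure Ω} [IsProbabilityMeasure μ] {X : ℕ → ℤ → Ω → ℝ} {f : ℝ → ℝ → ℝ} {C : ℝ}
    (h : IsLocallyStationary μ X f C) (hmean : ∀ T' : ℕ, 1 ≤ T' → ∀ t : ℤ, ∫ ω, X T' t ω ∂μ = 0)
    {T : ℕ} (hT : 1 ≤ T) (t k : ℤ) :
    |∫ ω, X T t ω * X T (t - k) ω ∂μ - localCov f k ((t : ℝ) / T)| ≤ C / T := by
  have h1 := h.cov_close T hT t k
  rw [covariance_eq_sub (h.memLp_two T hT t) (h.memLp_two T hT _), hmean T hT, zero_mul,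
    sub_zero] at h1
  exact (Complex.abs_re_le_norm _).trans h1

/-- The powers are rewritten as 2 - q with q = 1/(2 + 4d) or q = 1/(2 + 2d), the form in which
`bounds_of_exponent_eq` solves for the level. -/
theorem PBound_one_one (m N : ℕ) (mf Mf c d K r ε : ℝ) (hd : 0 < d) :
    ∃ A₁ A₂ : ℝ,
      A₁ = (ε / 8) ^ 2 / (2 * ((2 * C0 mf Mf + 1) ^ 4 * (Cbar1 Mf c d K r 2 / m)
        + (ε / 8) ^ (2 - 1 / (2 + 4 * d))
          * ((2 * C0 mf Mf + 1) ^ 2 * (Cbar2 Mf c d r 2 / m)) ^ (1 / (2 + 4 * d)))) ∧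
      A₂ = etaAux 1 1 mf Mf c d ε ^ 2 / (2 * (Cbar1 Mf c d K r 1 / (N - 1)
        + etaAux 1 1 mf Mf c d ε ^ (2 - 1 / (2 + 2 * d))
          * (Cbar2 Mf c d r 1 / (N - 1)) ^ (1 / (2 + 2 * d)))) ∧
      PBound 1 1 m N mf Mf c d K r ε = 7 * Real.exp (-A₁) + 12 * m * Real.exp (-A₂) := by
  refine ⟨_, _, rfl, rfl, ?_⟩
  have e1 : (3 + 8 * d) / (2 + 4 * d) = 2 - 1 / (2 + 4 * d) := by
    field_simp
    ring
  have e2 : (3 + 4 * d) / (2 + 2 * d) = 2 - 1 / (2 + 2 * d) := by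
    field_simp
    ring
  unfold PBound
  rw [e1, e2]
  have e3 : ε / (2 * (((1 : ℕ) : ℝ) + 1) ^ 2) = ε / 8 := by norm_num
  have e4 : ε ^ 2 / (((1 : ℕ) : ℝ) + 1) ^ 4 = (ε / 8) ^ 2 * 4 := by
    norm_num
    ring
  rw [e3, e4]
  simp only [Nat.cast_one, mul_one, add_sub_cancel_right, mul_one_div]
  set Q := (2 * C0 mf Mf + 1) ^ 4 * (Cbar1 Mf c d K r 2 / m)
        + (ε / 8) ^ (2 - 1 / (2 + 4 * d))
          * ((2 * C0 mf Mf + 1) ^ 2 * (Cbar2 Mf c d r 2 / m)) ^ (1 / (2 + 4 * d))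
  have e5 : (ε / 8) ^ 2 * 4 / (8 * Q) = (ε / 8) ^ 2 / (2 * Q) := by
    rw [show 8 * Q = 2 * Q * 4 by ring, mul_div_mul_right _ _ (by norm_num)]
  rw [e5]
  ring

/-- After inserting F = 20(1 + δ)ε the constants become 96 = 60 · 2⁵/20 and 6 = 40 · 3/20. -/
theorem bounds_of_TLargeEnough {T m : ℕ} {δ F C mf Mf Mf' ε : ℝ} (hT : 1 ≤ T)
    (hz : 0 < C0 mf Mf) (hδ : 0 ≤ δ) (hε : 0 < ε) (hF : F = 20 * (1 + δ) * ε)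
    (hM' : 0 ≤ Mf') (h : TLargeEnough T m 1 1 δ F C mf Mf Mf') :
    C / T ≤ ε / (96 * C0 mf Mf ^ 3) ∧ Mf' * m / T ≤ ε / (6 * C0 mf Mf ^ 3) := by
  obtain ⟨-, h2, h3⟩ := h
  have hT0 : (0 : ℝ) < T := by exact_mod_cast hT
  have hpM : 0 ≤ 2 * Real.pi * Mf' := by positivity
  refine ⟨?_, ?_⟩
  · have e : 60 * F⁻¹ * (1 + δ) * ((1 : ℕ) : ℝ) * 2 ^ (1 + 4) * C0 mf Mf ^ (2 * 1 + 1)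
        * ((1 : ℕ) : ℝ) ^ 2 * (2 * Real.pi * Mf' + C)
        = 96 * C0 mf Mf ^ 3 * (2 * Real.pi * Mf' + C) / ε := by
      rw [hF]
      push_cast
      field_simp
      ring
    rw [e, div_le_iff₀ hε] at h2
    rw [div_le_div_iff₀ hT0 (by positivity)]
    have : 0 ≤ C0 mf Mf ^ 3 * (2 * Real.pi * Mf') := by positivity
    linarith
  · have e : 40 * F⁻¹ * (1 + δ) * (m : ℝ) * (2 * ((1 : ℕ) : ℝ) + 1) * C0 mf Mf ^ (2 * 1 + 1) * Mf'
        = 6 * C0 mf Mf ^ 3 * (Mf' * m) / ε := by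
      rw [hF]
      push_cast
      field_simp
      ring
    rw [e, div_le_iff₀ hε] at h3
    rw [div_le_div_iff₀ hT0 (by positivity)]
    linarith

set_option maxHeartbeats 800000 in
/-- Deviation levels for which the exponents `A₁` and `A₂` are attained and the total error stays
below the gap. -/
theorem exists_deviation_levels {T m n₀ : ℕ} {Mf Mf' C K r mf c d δ ρ A₁ A₂ ε Θ : ℝ}
    (hT1 : 1 ≤ T) (hm : 1 ≤ m) (hn : 1 ≤ n₀) (hmf : 0 < mf) (hM : mf ≤ Mf) (hr : 1 < r)
    (hd : 1 / 2 ≤ d) (hM' : 0 ≤ Mf') (hC : 0 ≤ C) (hδ : 0 ≤ δ) (hρ0 : 0 ≤ ρ) (hρ1 : ρ < 1)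
    (hΘ : Θ = max 1 (max (c ^ 2) (3 * Real.pi * Mf)))
    (hε : ε = δ / (1 + δ) * (Real.pi * mf / 20) * (1 - ρ ^ 2))
    (hY : 6 * mf ≤ c ^ 2 * (24 : ℝ) ^ d)
    (hT : TLargeEnough T m 1 1 δ (δ * Real.pi * mf * (1 - ρ ^ 2)) C mf Mf Mf')
    (hA₁' : 10 / 3 ≤ A₁) (hA₂' : 10 / 3 ≤ A₂)
    (hA₁ : A₁ = (ε / 8) ^ 2 / (2 * ((2 * C0 mf Mf + 1) ^ 4 * (Cbar1 Mf c d K r 2 / m)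
        + (ε / 8) ^ (2 - 1 / (2 + 4 * d))
          * ((2 * C0 mf Mf + 1) ^ 2 * (Cbar2 Mf c d r 2 / m)) ^ (1 / (2 + 4 * d)))))
    (hA₂ : A₂ = etaAux 1 1 mf Mf c d ε ^ 2 / (2 * (Cbar1 Mf c d K r 1 / n₀
        + etaAux 1 1 mf Mf c d ε ^ (2 - 1 / (2 + 2 * d))
          * (Cbar2 Mf c d r 1 / n₀) ^ (1 / (2 + 2 * d))))) :
    ∃ η₁ η₂ : ℝ, 0 < η₁ ∧ η₁ ≤ Θ ∧ 0 < η₂ ∧ η₂ ≤ Θ ∧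
      2 * A₁ * (16000 * (256 : ℝ) ^ d * Θ ^ 2 * mixFactor K r) ≤ m * η₁ ^ 2 ∧
      260 * (8 : ℝ) ^ d * Θ * (1 + 1 / Real.log r) * (2 * A₁) ^ (2 + 2 * d) ≤ m * η₁ ∧
      2 * A₂ * (16000 * (256 : ℝ) ^ d * Θ ^ 2 * mixFactor K r) ≤ n₀ * η₂ ^ 2 ∧
      260 * (8 : ℝ) ^ d * Θ * (1 + 1 / Real.log r) * (2 * A₂) ^ (2 + 2 * d) ≤ n₀ * η₂ ∧
      10 * Real.pi * Mf
          * (3 * (C / T + 2 * Real.pi * Mf' * (4 * m / T)) / (2 * Real.pi * mf))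
        + (2 + δ) * (9 * (500 * η₁)
          + 6 * (3 * (500 * η₂) / (6 * mf)) * (3 * Real.pi * Mf + 500 * η₁)
          + 9 * (C / T + 2 * Real.pi * Mf' * (m / T)))
        < δ * Real.pi * mf * (1 - ρ ^ 2) := by
  have hS0 : 0 < 1 - ρ ^ 2 := by nlinarith
  have hS1 : 1 - ρ ^ 2 ≤ 1 := by nlinarith
  have hMf : 0 < Mf := by linarith
  have hpi := Real.pi_pos
  have hlog : 0 < Real.log r := Real.log_pos hr
  have hz := five_halves_mul_le_C0 hmf hM
  have hz0 : 0 < C0 mf Mf := pos_of_mul_pos_left (by linarith : 0 < C0 mf Mf * mf) hmf.le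
  have hm0 : (0 : ℝ) < m := by exact_mod_cast hm
  have hn0 : (0 : ℝ) < n₀ := by exact_mod_cast hn
  have hε0 : 0 ≤ ε := by
    rw [hε]
    positivity
  have hεm : ε ≤ Real.pi * mf / 20 := by
    have h1 : δ / (1 + δ) ≤ 1 := (div_le_one (by linarith)).2 (by linarith)
    calc ε ≤ 1 * (Real.pi * mf / 20) * 1 := by
          rw [hε]
          gcongr
      _ = Real.pi * mf / 20 := by ring
  have hF : δ * Real.pi * mf * (1 - ρ ^ 2) = 20 * (1 + δ) * ε := by
    rw [hε]
    field_simp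
  have hΘ1 : 1 ≤ Θ := hΘ ▸ le_max_left _ _
  have hΘM : 3 * Real.pi * Mf ≤ Θ := hΘ ▸ (le_max_right _ _).trans (le_max_right _ _)
  have hΘmf : mf ≤ Θ := by
    have : 1 * Mf ≤ 3 * Real.pi * Mf := by
      gcongr
      linarith [Real.pi_gt_three]
    linarith
  have hW₁ := le_Cbar1_one (Mf := Mf) (c := c) (d := d) (K := K) hr
  have hW₂ := le_Cbar1_two (Mf := Mf) (c := c) (K := K) hr hd
  have hV₁ := le_Cbar2_one (Mf := Mf) (c := c) (d := d) hr
  have hV₂ := le_Cbar2_two (Mf := Mf) (c := c) hr hd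
  have hmix0 : 0 < mixFactor K r := by
    unfold mixFactor
    positivity
  rw [← hΘ] at hW₁ hW₂ hV₁ hV₂
  have hW0 : 0 < 16000 * (256 : ℝ) ^ d * Θ ^ 2 * mixFactor K r := by positivity
  have hV0 : 0 < 260 * (8 : ℝ) ^ d * Θ * (1 + 1 / Real.log r) := by positivity
  generalize 16000 * (256 : ℝ) ^ d * Θ ^ 2 * mixFactor K r = W at *
  generalize 260 * (8 : ℝ) ^ d * Θ * (1 + 1 / Real.log r) = V at *
  have hC11 : 0 < Cbar1 Mf c d K r 1 := by linarith
  have hC12 : 0 < Cbar1 Mf c d K r 2 := by linarith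
  have hC21 : 0 < Cbar2 Mf c d r 1 := by linarith
  have hC22 : 0 < Cbar2 Mf c d r 2 := by linarith
  have hη0 := etaAux_nonneg (c := c) (d := d) hmf.le hz0.le hε0
  have hηq := etaAux_le_quarter (Mf := Mf) (c := c) (d := d) (ε := ε) hmf.le
  have hη₂ := etaAux_le (c := c) (d := d) hmf hz0 hε0 (by
    calc 100 * mf ^ 2 ≤ 6 * 3.14 * mf * (6 * mf) := by nlinarith
      _ ≤ 6 * Real.pi * Mf * (c ^ 2 * (24 : ℝ) ^ d) := by
          gcongr
          exact Real.pi_gt_d2.le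
      _ = _ := by ring)
  obtain ⟨hx1, hv1, ht1⟩ := bounds_of_exponent_eq (by positivity) (by positivity)
    (by positivity) (by positivity) (by linarith) hA₁
  obtain ⟨hx2, hv2, ht2⟩ := bounds_of_exponent_eq (by positivity) hη0
    (by positivity) (by positivity) (by linarith) hA₂
  rw [one_div_one_div] at ht1 ht2
  -- Positivity of ε comes from A₁ > 0, not from an assumption δ > 0: for ε = 0 the exponent would
  -- vanish.
  have hε' : 0 < ε := by linarith
  obtain ⟨hvar₁, htail₁⟩ := block_conditions_of_exponent (g := 2 * C0 mf Mf + 1) (by positivity)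
    hm0 hA₁' hd hV0.le hW₂ hV₂ hv1 ht1
  obtain ⟨hCT, hMT⟩ := bounds_of_TLargeEnough hT1 hz0 hδ hε' hF hM' hT
  have hη₁eq : ε / 8 / (8 * (2 * C0 mf Mf + 1) ^ 2) = ε / (64 * (2 * C0 mf Mf + 1) ^ 2) := by
    rw [div_div, ← mul_assoc]
    norm_num
  rw [hη₁eq] at hvar₁ htail₁
  have hgap := total_error_lt_gap hmf hM hz hε' hεm hδ hCT hMT
    (by positivity) (by positivity) rfl hη₂
  -- The first level is ε/8 divided by 8(2C₀ + 1)²; the reduction makes room for the factor 500 in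
  -- the concentration inequality. The second is η itself.
  refine ⟨ε / (64 * (2 * C0 mf Mf + 1) ^ 2), etaAux 1 1 mf Mf c d ε, by positivity, ?_, hx2,
    by linarith, hvar₁, htail₁, ?_, ?_, ?_⟩
  · have h1 : ε / (64 * (2 * C0 mf Mf + 1) ^ 2) ≤ ε := by
      refine div_le_self hε0 ?_
      have : 1 ≤ (2 * C0 mf Mf + 1) ^ 2 := one_le_pow₀ (by linarith)
      linarith
    have h2 : Real.pi * mf ≤ 4 * mf := by
      gcongr
      exact Real.pi_le_four
    linarith
  · rw [← mul_div_assoc, div_le_iff₀ hn0] at hv2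
    calc 2 * A₂ * W ≤ 2 * A₂ * Cbar1 Mf c d K r 1 := by gcongr
      _ ≤ n₀ * etaAux 1 1 mf Mf c d ε ^ 2 := by linarith
  · rw [← mul_div_assoc, div_le_iff₀ hn0] at ht2
    calc V * (2 * A₂) ^ (2 + 2 * d) ≤ Cbar2 Mf c d r 1 * (2 * A₂) ^ (2 + 2 * d) := by gcongr
      _ ≤ n₀ * etaAux 1 1 mf Mf c d ε := by linarith
  · rw [hF]
    have e1 : C / T + 2 * Real.pi * Mf' * (4 * m / T) = C / T + 8 * Real.pi * (Mf' * m / T) := by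
      ring
    have e2 : C / T + 2 * Real.pi * Mf' * (m / T) = C / T + 2 * Real.pi * (Mf' * m / T) := by
      ring
    rw [e1, e2]
    exact hgap

/-- The Bernstein condition of order 4 and (E X²)² ≤ E X⁴ give an inequality in which one variance
cancels. It bounds c² 24^d from below, as needed for the denominator of ε̄. -/
theorem LocStat.BernsteinCondition.integral_mul_self_le {Ω : Type*} [MeasurableSpace Ω]
    {μ : Measure Ω} [IsProbabilityMeasure μ] {X : ℕ → ℤ → Ω → ℝ} {T m : ℕ} {c d : ℝ}
    (h : BernsteinCondition μ X m c d) (hT : 1 ≤ T) (hX : Measurable (X T 1))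
    (hvar : variance (X T 1) μ = ∫ ω, X T 1 ω * X T 1 ω ∂μ)
    (hpos : 0 < ∫ ω, X T 1 ω * X T 1 ω ∂μ) :
    ∫ ω, X T 1 ω * X T 1 ω ∂μ ≤ c ^ 2 * (24 : ℝ) ^ d := by
  obtain ⟨hi, hle⟩ := h.2.2 T hT 1 le_rfl (by omega) 4 (by norm_num)
  simp only [Even.pow_abs (show Even 4 by decide)] at hi hle
  have h4 : MemLp (X T 1) 4 μ := memLp_four_of_integrable hX.aestronglyMeasurable hi
  rw [hvar] at hle
  have h7 : (∫ ω, X T 1 ω * X T 1 ω ∂μ) ^ 2 ≤ ∫ ω, X T 1 ω ^ 4 ∂μ := by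
    have h5 := sq_integral_le (memLp_sq h4)
    have e1 : ∀ ω, X T 1 ω ^ 2 = X T 1 ω * X T 1 ω := fun ω => pow_two _
    have e2 : ∀ ω, (X T 1 ω * X T 1 ω) ^ 2 = X T 1 ω ^ 4 := fun ω => by ring
    simpa only [e1, e2] using h5
  refine le_of_mul_le_mul_right ?_ hpos
  calc _ = (∫ ω, X T 1 ω * X T 1 ω ∂μ) ^ 2 := by ring
    _ ≤ _ := h7.trans hle
    _ = c ^ 2 * (24 : ℝ) ^ d * _ := by norm_num [Nat.factorial]

theorem corollary3p2
    {Ω : Type*} [MeasurableSpace Ω] (μ : Measure Ω) [IsProbabilityMeasure μ]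
    (X : ℕ → ℤ → Ω → ℝ) (f : ℝ → ℝ → ℝ)
    (C K r mf Mf Mf' c d : ℝ)
    (T m : ℕ) (hm : 1 ≤ m)
    (hls : IsLocallyStationary μ X f C)
    (hmix : IsGeometricallyMixing μ X K r)
    (hsd : SpectralBounds f mf Mf)
    (hsd' : SpectralDerivBound f Mf')
    (hmom : BernsteinCondition μ X m c d)
    (hmean : ∀ T' : ℕ, 1 ≤ T' → ∀ t : ℤ, ∫ ω, X T' t ω ∂μ = 0)
    (𝒩 : Finset ℕ) (h𝒩 : 𝒩.Nonempty)
    (h𝒩T : ∀ N ∈ 𝒩, 2 ≤ N ∧ N + m + 1 ≤ T)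
    (hρ : rhoSup f T m < 1)
    (δ : ℝ) (hδ : 2 * DSup f T m ^ 2 / (1 - rhoSup f T m ^ 2) ≤ δ)
    (hT : TLargeEnough T m 1 1 δ (δ * Real.pi * mf * (1 - rhoSup f T m ^ 2)) C mf Mf Mf')
    (Nhat : Ω → ℕ) (hNhat_meas : Measurable Nhat)
    (hNhat : ∀ ω, IsSelected (fun t => X T t ω) T m 𝒩 (Nhat ω)) :
    1 - 6 * (𝒩.card : ℝ) *
        PBound 1 1 m (𝒩.min' h𝒩) mf Mf c d K r
          (δ / (1 + δ) * (Real.pi * mf / 20) * (1 - rhoSup f T m ^ 2))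
      ≤ μ.real {ω |
          (1 + δ ≤ ratioMSPE (fun t => X T t ω) T m (Nhat ω) 2 ∧
            1 + δ ≤ ratioMSPE (fun t => X T t ω) T m (Nhat ω) 3) ∨
          (ratioMSPE (fun t => X T t ω) T m (Nhat ω) 2 < 1 + δ ∧
            ratioMSPE (fun t => X T t ω) T m (Nhat ω) 3 < 1 + δ)} := by
  have hρ0 := rhoSup_nonneg f T m
  have hS0 : 0 < 1 - rhoSup f T m ^ 2 := by nlinarith
  have hδ0 : 0 ≤ δ := le_trans (by positivity) hδ
  obtain ⟨hmf, hfb⟩ := id hsd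
  have hM : mf ≤ Mf := (hfb 0 0).1.trans (hfb 0 0).2
  obtain ⟨hK, hr, -⟩ := id hmix
  obtain ⟨hc0, hd, -⟩ := id hmom
  have hN₀ := h𝒩T _ (𝒩.min'_mem h𝒩)
  have hT1 : 1 ≤ T := by omega
  obtain ⟨n₀, hn₀⟩ : ∃ n₀, 𝒩.min' h𝒩 = n₀ + 1 := ⟨𝒩.min' h𝒩 - 1, by omega⟩
  set ε := δ / (1 + δ) * (Real.pi * mf / 20) * (1 - rhoSup f T m ^ 2) with hεdef
  obtain ⟨A₁, A₂, hA₁, hA₂, hP⟩ := PBound_one_one m (𝒩.min' h𝒩) mf Mf c d K r ε (by linarith)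
  have hcard : (1 : ℝ) ≤ 𝒩.card := by exact_mod_cast h𝒩.card_pos
  set S := {ω |
          (1 + δ ≤ ratioMSPE (fun t => X T t ω) T m (Nhat ω) 2 ∧
            1 + δ ≤ ratioMSPE (fun t => X T t ω) T m (Nhat ω) 3) ∨
          (ratioMSPE (fun t => X T t ω) T m (Nhat ω) 2 < 1 + δ ∧
            ratioMSPE (fun t => X T t ω) T m (Nhat ω) 3 < 1 + δ)} with hS
  -- If 6P ≥ 1 the claimed bound is at most 0. This covers δ = 0, where ε = 0 and the first
  -- exponential equals 1.
  rcases le_or_gt 1 (6 * PBound 1 1 m (𝒩.min' h𝒩) mf Mf c d K r ε) with hbig | hsmall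
  · have : 0 ≤ μ.real S := measureReal_nonneg
    nlinarith
  rw [hP] at hsmall ⊢
  have hm1 : (1 : ℝ) ≤ m := by exact_mod_cast hm
  have hA₁' : 10 / 3 ≤ A₁ := ten_thirds_le_of_mul_exp_lt (by
    have : 0 ≤ 12 * m * Real.exp (-A₂) := by positivity
    linarith)
  have hA₂' : 10 / 3 ≤ A₂ := ten_thirds_le_of_mul_exp_lt (by
    have h1 : 0 < Real.exp (-A₁) := Real.exp_pos _
    have h2 : Real.exp (-A₂) ≤ m * Real.exp (-A₂) :=
      le_mul_of_one_le_left (Real.exp_pos _).le hm1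
    linarith [Real.exp_pos (-A₂)])
  rw [hn₀, Nat.cast_add_one, add_sub_cancel_right] at hA₂
  have he0 : ∀ l : ℤ, |∫ ω, X T l ω * X T l ω ∂μ - localCov f 0 (l / (T : ℝ))| ≤ C / T := by
    intro l
    have := hls.abs_integral_mul_sub_le hmean hT1 l 0
    rwa [sub_zero] at this
  have he1 : ∀ l : ℤ, |∫ ω, X T l ω * X T (l + 1) ω ∂μ - localCov f 1 ((l + 1 : ℤ) / (T : ℝ))|
      ≤ C / T := by
    intro l
    have := hls.abs_integral_mul_sub_le hmean hT1 (l + 1) 1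
    rw [add_sub_cancel_right] at this
    simpa only [mul_comm] using this
  have hvar_eq : ∀ t, variance (X T t) μ = ∫ ω, X T t ω * X T t ω ∂μ := by
    intro t
    rw [variance_of_integral_eq_zero (hls.measurable T hT1 t).aemeasurable (hmean T hT1 t)]
    simp only [pow_two]
  have hpi1 : 3.14 * mf ≤ Real.pi * mf := by
    gcongr
    exact Real.pi_gt_d2.le
  have hpi2 : Real.pi * mf ≤ Real.pi * Mf := by gcongr
  have hCT6 : C / T ≤ mf / 6 := by
    have h1 := hT.1
    have e : 3 * ((1 : ℕ) : ℝ) * 2 ^ 1 * C1 mf Mf' C * ((1 : ℕ) : ℝ) ^ 2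
        = 6 * (2 * Real.pi * Mf' + C) / mf := by
      unfold C1
      push_cast
      ring
    have hM0 : 0 ≤ 2 * Real.pi * Mf' := by
      have := hsd'.1
      positivity
    rw [e, div_le_iff₀ hmf] at h1
    rw [div_le_iff₀ (by exact_mod_cast hT1)]
    linarith
  -- The variance is at least 2π mf - C/T, and C/T ≤ mf/6 by the first condition on T.
  have hlow : ∀ l, 6 * mf ≤ ∫ ω, X T l ω * X T l ω ∂μ := by
    intro l
    have h1 := (abs_le.1 (he0 l)).1
    have h2 := hls.spectralDensity.le_localCov_zero hsd (l / (T : ℝ))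
    linarith
  have hup : ∀ l, ∫ ω, X T l ω * X T l ω ∂μ ≤ 3 * Real.pi * Mf := by
    intro l
    have h1 := (abs_le.1 (he0 l)).2
    have h2 := hls.spectralDensity.localCov_zero_le hsd (l / (T : ℝ))
    linarith
  have hY := (hlow 1).trans (hmom.integral_mul_self_le hT1 (hls.measurable T hT1 1) (hvar_eq 1)
    (by linarith [hlow 1]))
  obtain ⟨Θ, hΘ⟩ : ∃ Θ, Θ = max 1 (max (c ^ 2) (3 * Real.pi * Mf)) := ⟨_, rfl⟩
  have hΘ1 : 1 ≤ Θ := hΘ ▸ le_max_left _ _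
  have hΘc : c ^ 2 ≤ Θ := hΘ ▸ (le_max_left _ _).trans (le_max_right _ _)
  have hΘM : 3 * Real.pi * Mf ≤ Θ := hΘ ▸ (le_max_right _ _).trans (le_max_right _ _)
  obtain ⟨η₁, η₂, hη₁, hηΘ₁, hη₂, hηΘ₂, hvar₁, htail₁, hvar₂, htail₂, hgap⟩ :=
    exists_deviation_levels hT1 hm (by omega) hmf hM hr hd hsd'.1 hls.const_nonneg hδ0 hρ0 hρ hΘ
      hεdef hY hT hA₁' hA₂' hA₁ hA₂
  -- For a fixed segment length the forecasts are explicit functions of the path; the random N̂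
  -- enters only through the union over 𝒩.
  have key : ∀ N ∈ 𝒩, ∀ j : ℤ, 2 ≤ j → j ≤ 3 →
      μ.real {ω | ¬ ratioMSPE (fun t => X T t ω) T m N j < 1 + δ}
        ≤ 12 * Real.exp (-A₁) + 8 * m * Real.exp (-A₂) := by
    intro N hN j hj2 hj3
    refine le_trans (measureReal_mono (fun ω hω => ?_)) (measureReal_not_lt_le hT1 hm
      (hls.measurable T hT1) hmix hmom (by linarith) hΘc
      (fun t _ _ => (hvar_eq t).le.trans ((hup t).trans hΘM)) hls.spectralDensity hsd hsd'
      hls.const_nonneg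
      (fun l => abs_integral_mul_le_half (hls.memLp_two T hT1 l) (hls.memLp_two T hT1 (l + 1)))
      hlow hup he0 he1 hA₁' hη₁ hηΘ₁ hvar₁ htail₁ hA₂' hη₂ hηΘ₂ hvar₂ htail₂
      (a := (T : ℤ) + (j - 3) * m) ?_ ?_ (h𝒩T N hN).1 (h𝒩T N hN).2 ?_ hρ hδ hgap)
    · exact fun h => hω (ratioMSPE_lt_of_sum_lt hm hδ0 h)
    · nlinarith
    · nlinarith
    · have := 𝒩.min'_le N hN
      omega
  refine le_trans (le_of_eq ?_) (one_sub_le_measureReal_of_cover μ (S := S) (s := 𝒩)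
    (B := fun N => {ω | ¬ ratioMSPE (fun t => X T t ω) T m N 2 < 1 + δ}
      ∪ {ω | ¬ ratioMSPE (fun t => X T t ω) T m N 3 < 1 + δ})
    (b := 6 * (7 * Real.exp (-A₁) + 12 * m * Real.exp (-A₂))) ?_ ?_)
  · ring
  · intro ω hω
    refine ⟨Nhat ω, (hNhat ω).1, ?_⟩
    by_contra hcon
    simp only [Set.mem_union, Set.mem_ofPred_eq, not_or, not_not] at hcon
    exact hω (Or.inr hcon)
  · intro N hN
    refine (measureReal_union_le _ _).trans ?_
    have h2 := key N hN 2 (by norm_num) (by norm_num)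
    have h3 := key N hN 3 (by norm_num) (by norm_num)
    have h4 := Real.exp_pos (-A₁)
    have h5 : 0 ≤ m * Real.exp (-A₂) := by positivity
    -- The two blocks together give 24 exp(-A₁) + 16m exp(-A₂), below the available 42 exp(-A₁) +
    -- 72m exp(-A₂).
    linarith
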